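/- Let $X$ be a finite connected CW complex with universal covering $\widetilde X$, let $G=\pi_1(X)$, let $R$ be an integral domain and let $\rho:G\to \mathrm{GL}(l,R)$ be a representation. Let $n=\mathrm{rk}\,H_1(X,\mathbb Z)$, let $\phi:G\to H_1(X,\mathbb Z)/\mathrm{Tors}\cong\mathbb Z^n$ be the projection, and let $C_*(\widetilde X)$ be the cellular chain complex of $\widetilde X$, regarded as a complex of right $\mathbb Z[G]$-modules. For a homomorphism $p:G\to A$ to an abelian group let $\rho\otimes p:G\to\mathrm{GL}(l,R[A])$ be the representation $g\mapsto \rho(g)\,[p(g)]$. Let $Q$ be the fraction field of $R[\mathbb Z^n]$ and put $$b_k^\circ(X,\rho)=\dim_{Q} H_k\big(C_*(\widetilde X)\otimes_{\rho\otimes\phi} Q^l\big).$$ For a homomorphism $\xi:G\to\mathbb R$ let $A=\xi(G)\subset\mathbb R$, a free abelian group of finite rank, let $p:G\to A$ be the epimorphism defined by $\xi$, and let $\widehat L_\xi$ be the Novikov ring of all formal series $\sum_{a\in A} r_a[a]$ with $r_a\in R$ such that for every $C\in\mathbb R$ the set $\{a\in A : r_a\neq 0,\ a\ge C\}$ is finite.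 Let $$\widehat b_k^\rho(X,\xi)=\mathrm{rk}_{\widehat L_\xi}\, H_k\big(C_*(\widetilde X)\otimes_{\rho\otimes p} \widehat L_\xi^{\,l}\big)$$ be the $k$-th twisted Novikov Betti number. A subgroup of $\mathrm{Hom}(\mathbb Z^n,\mathbb Z)$ is called full if it is a direct summand. Let $k\ge 0$ and $q>0$ be integers. Then there is a finite (possibly empty) family of proper full subgroups $G_i\subset \mathrm{Hom}(\mathbb Z^n,\mathbb Z)$ such that for every homomorphism $\xi:G\to\mathbb R$, regarded through $\phi$ as an element of $\mathrm{Hom}(\mathbb Z^n,\mathbb R)=\mathrm{Hom}(\mathbb Z^n,\mathbb Z)\otimes\mathbb R$, $$\widehat b_k^\rho(X,\xi)\ \ge\ b_k^\circ(X,\rho)+q \iff \xi\in\bigcup_i G_i\otimes\mathbb R .$$ -/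

import Mathlib

open CategoryTheory AlgebraicTopology TensorProduct

universe u v w

noncomputable section

namespace TwistedNovikov

/-! ### Cellular chains of a filtered space -/

section Cellular

variable {E : Type v} [TopologicalSpace E]

/-- The integral singular chain complex of a space. -/
abbrev singChains (E : Type v) [TopologicalSpace E] : ChainComplex AddCommGrpCat.{v} ℕ :=
  ((singularChainComplexFunctor AddCommGrpCat.{v}).obj (AddCommGrpCat.of (ULift.{v} ℤ))).obj
    (TopCat.of E)

/-- The map of singular chain complexes induced by a continuous map. -/
abbrev singMap {E E' : Type v} [TopologicalSpace E] [TopologicalSpace E'] (f : C(E, E')) :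
    singChains E ⟶ singChains E' :=
  ((singularChainComplexFunctor AddCommGrpCat.{v}).obj (AddCommGrpCat.of (ULift.{v} ℤ))).map
    (TopCat.ofHom f)

/-- The boundary of singular chains as a homomorphism of abelian groups. -/
abbrev bd (E : Type v) [TopologicalSpace E] (i j : ℕ) :
    (singChains E).X i →+ (singChains E).X j :=
  ((singChains E).d i j).hom

/-- The push-forward of singular chains as a homomorphism of abelian groups. -/
abbrev push {E E' : Type v} [TopologicalSpace E] [TopologicalSpace E'] (f : C(E, E')) (k : ℕ) :
    (singChains E).X k →+ (singChains E').X k :=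
  ((singMap f).f k).hom

/-- The inclusion of a subspace. -/
def incl (A : Set E) : C(A, E) := ⟨Subtype.val, continuous_subtype_val⟩

/-- The singular `k`-chains of `E` that lie in the subspace `A`. -/
def chainsIn (A : Set E) (k : ℕ) : AddSubgroup ((singChains E).X k) :=
  (push (incl A) k).range

theorem push_comp {E₁ E₂ E₃ : Type v} [TopologicalSpace E₁] [TopologicalSpace E₂]
    [TopologicalSpace E₃] (f : C(E₁, E₂)) (g : C(E₂, E₃)) (k : ℕ) (c : (singChains E₁).X k) :
    push (g.comp f) k c = push g k (push f k c) := by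
  have e : singMap (g.comp f) = singMap f ≫ singMap g := by
    rw [← Functor.map_comp]
    rfl
  simp [push, e]

theorem bd_push {E₁ E₂ : Type v} [TopologicalSpace E₁] [TopologicalSpace E₂] (f : C(E₁, E₂))
    (i j : ℕ) (c : (singChains E₁).X i) :
    bd E₂ i j (push f i c) = push f j (bd E₁ i j c) := by
  have := congrArg (fun m => m.hom c) ((singMap f).comm i j)
  exact this

theorem bd_bd (i j k : ℕ) (c : (singChains E).X i) : bd E j k (bd E i j c) = 0 := by
  have := congrArg (fun m => m.hom c) ((singChains E).d_comp_d i j k)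
  exact this

theorem push_mem_chainsIn {T : C(E, E)} {A B : Set E} (h : Set.MapsTo T A B) {k : ℕ}
    {c : (singChains E).X k} (hc : c ∈ chainsIn A k) : push T k c ∈ chainsIn B k := by
  obtain ⟨y, rfl⟩ := hc
  let T' : C(A, B) := ⟨h.restrict, T.continuous.continuousOn.mapsToRestrict h⟩
  refine ⟨push T' k y, ?_⟩
  rw [← push_comp, ← push_comp]
  rfl

/-- Relative cycles of a filtration `∅ = F 0 ⊆ F 1 ⊆ ...`, where `F (k + 1)` is to be thought of as
the `k`-skeleton: the `k`-chains of `F (k + 1)` whose boundary lies in `F k`. -/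
def relCycles (F : ℕ → Set E) (k : ℕ) : AddSubgroup ((singChains E).X k) :=
  chainsIn (F (k + 1)) k ⊓ ⨅ j, (chainsIn (F k) j).comap (bd E k j)

/-- Relative boundaries: boundaries of chains of `F (k + 1)`, plus chains of `F k`. -/
def relBoundaries (F : ℕ → Set E) (k : ℕ) : AddSubgroup ((singChains E).X k) :=
  (chainsIn (F (k + 1)) (k + 1)).map (bd E (k + 1) k) ⊔ chainsIn (F k) k

/-- The group of cellular `k`-chains: the relative singular homology group
`H_k(F (k + 1), F k; ℤ)`, that is, `H_k` of the `k`-skeleton modulo the `(k - 1)`-skeleton. -/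
abbrev CellChains (F : ℕ → Set E) (k : ℕ) : Type v :=
  relCycles F k ⧸ (relBoundaries F k).addSubgroupOf (relCycles F k)

theorem mem_relCycles {F : ℕ → Set E} {k : ℕ} {c : (singChains E).X k} :
    c ∈ relCycles F k ↔ c ∈ chainsIn (F (k + 1)) k ∧ ∀ j, bd E k j c ∈ chainsIn (F k) j := by
  simp only [relCycles, AddSubgroup.mem_inf, AddSubgroup.mem_iInf, AddSubgroup.mem_comap]

theorem bd_mem_relCycles {F : ℕ → Set E} {k : ℕ} {c : (singChains E).X (k + 1)}
    (hc : c ∈ relCycles F (k + 1)) : bd E (k + 1) k c ∈ relCycles F k := by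
  rw [mem_relCycles] at hc ⊢
  refine ⟨hc.2 k, fun j => ?_⟩
  rw [bd_bd]
  exact zero_mem _

theorem bd_mem_relBoundaries {F : ℕ → Set E} {k : ℕ} {c : (singChains E).X (k + 1)}
    (hc : c ∈ relBoundaries F (k + 1)) : bd E (k + 1) k c ∈ relBoundaries F k := by
  obtain ⟨_, ⟨e, -, rfl⟩, s, hs, rfl⟩ := AddSubgroup.mem_sup.1 hc
  rw [map_add, bd_bd, zero_add]
  exact AddSubgroup.mem_sup_left ⟨s, hs, rfl⟩

/-- The differential of the cellular chain complex, `[c] ↦ [∂c]`; it is the connecting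
homomorphism of the triple `(F (k + 2), F (k + 1), F k)`. -/
def cellD (F : ℕ → Set E) (k : ℕ) : CellChains F (k + 1) →+ CellChains F k :=
  QuotientAddGroup.map _ _
    (((bd E (k + 1) k).comp (relCycles F (k + 1)).subtype).codRestrict (relCycles F k)
      (fun c => bd_mem_relCycles c.2))
    (fun _ hc => bd_mem_relBoundaries hc)

theorem cellD_cellD (F : ℕ → Set E) (k : ℕ) (x : CellChains F (k + 2)) :
    cellD F k (cellD F (k + 1) x) = 0 := by
  obtain ⟨c, rfl⟩ := QuotientAddGroup.mk_surjective x
  refine (QuotientAddGroup.eq_zero_iff _).2 ?_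
  change bd E (k + 1) k (bd E (k + 2) (k + 1) c.1) ∈ relBoundaries F k
  rw [bd_bd]
  exact zero_mem _

theorem push_mem_relCycles {F : ℕ → Set E} {T : C(E, E)}
    (hT : ∀ j, Set.MapsTo T (F j) (F j)) {k : ℕ} {c : (singChains E).X k}
    (hc : c ∈ relCycles F k) : push T k c ∈ relCycles F k := by
  rw [mem_relCycles] at hc ⊢
  refine ⟨push_mem_chainsIn (hT _) hc.1, fun j => ?_⟩
  rw [bd_push]
  exact push_mem_chainsIn (hT _) (hc.2 j)

theorem push_mem_relBoundaries {F : ℕ → Set E} {T : C(E, E)}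
    (hT : ∀ j, Set.MapsTo T (F j) (F j)) {k : ℕ} {c : (singChains E).X k}
    (hc : c ∈ relBoundaries F k) : push T k c ∈ relBoundaries F k := by
  obtain ⟨_, ⟨e, he, rfl⟩, s, hs, rfl⟩ := AddSubgroup.mem_sup.1 hc
  rw [map_add, ← bd_push]
  exact AddSubgroup.add_mem_sup ⟨_, push_mem_chainsIn (hT _) he, rfl⟩
    (push_mem_chainsIn (hT _) hs)

/-- The map of cellular chains induced by a filtration preserving map. -/
def cellMap {F : ℕ → Set E} (T : C(E, E)) (hT : ∀ j, Set.MapsTo T (F j) (F j)) (k : ℕ) :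
    CellChains F k →+ CellChains F k :=
  QuotientAddGroup.map _ _
    (((push T k).comp (relCycles F k).subtype).codRestrict (relCycles F k)
      (fun c => push_mem_relCycles hT c.2))
    (fun _ hc => push_mem_relBoundaries hT hc)

theorem cellD_cellMap {F : ℕ → Set E} (T : C(E, E)) (hT : ∀ j, Set.MapsTo T (F j) (F j)) (k : ℕ)
    (x : CellChains F (k + 1)) :
    cellD F k (cellMap T hT (k + 1) x) = cellMap T hT k (cellD F k x) := by
  obtain ⟨c, rfl⟩ := QuotientAddGroup.mk_surjective x
  exact congrArg (QuotientAddGroup.mk (s := (relBoundaries F k).addSubgroupOf (relCycles F k)))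
    (Subtype.ext (bd_push T (k + 1) k c.1))

end Cellular

/-! ### Homology of a CW complex with twisted coefficients -/

section Twisted

variable {X : Type u} [TopologicalSpace X] {E : Type v} [TopologicalSpace E]

/-- `T` is the deck transformation of the universal covering `π : E → X` that corresponds to the
class `g` in the fundamental group: it is a map over `X` which sends the base point `e₀` to the
end point of a path from `e₀` that lifts a loop of class `g`.

In Mathlib's fundamental group `g * h` is the class of a loop of class `h` followed by a loop
of class `g`. Hence the deck transformation of `g * h` is that of `h` composed with
that of `g`, the one of `g` being applied first: this is a right action on `E`. -/
def IsDeck (π : C(E, X)) (e₀ : E) (g : FundamentalGroup X (π e₀)) (T : C(E, E)) : Prop :=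
  (∀ e, π (T e) = π e) ∧ ∃ (h : π (T e₀) = π e₀) (Γ : Path e₀ (T e₀)),
    g = FundamentalGroup.fromPath
      (Path.Homotopic.Quotient.mk ((Γ.map π.continuous).cast rfl h.symm))

variable [T2Space X] [Topology.CWComplex (Set.univ : Set X)]

/-- The filtration of a covering of `X` by the preimages of the skeleta of `X`:
`liftedSkeleta π (k + 1)` is the preimage of the `k`-skeleton, `liftedSkeleta π 0 = ∅`. -/
def liftedSkeleta (π : C(E, X)) (j : ℕ) : Set E :=
  π ⁻¹' (Topology.CWComplex.skeletonLT (Set.univ : Set X) (j : ℕ∞) : Set X)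

theorem IsDeck.mapsTo {π : C(E, X)} {e₀ : E} {g : FundamentalGroup X (π e₀)} {T : C(E, E)}
    (h : IsDeck π e₀ g T) (j : ℕ) : Set.MapsTo T (liftedSkeleta π j) (liftedSkeleta π j) := by
  intro e he
  simpa only [liftedSkeleta, Set.mem_preimage, h.1 e] using he

variable {K : Type w} [CommRing K] {l : ℕ}

/-- The relations `(c · g) ⊗ v = c ⊗ σ(g) v` that define the tensor product over the group ring of
`π₁(X)` inside the tensor product over `ℤ` of the cellular chains of the universal covering
with `K ^ l`; the factor `K ^ l` is written on the left. -/
def twistedRel (π : C(E, X)) (e₀ : E)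
    (σ : FundamentalGroup X (π e₀) →* Matrix.GeneralLinearGroup (Fin l) K) (k : ℕ) :
    Submodule K ((Fin l → K) ⊗[ℤ] CellChains (liftedSkeleta π) k) :=
  Submodule.span K {x | ∃ (g : FundamentalGroup X (π e₀)) (T : C(E, E)) (hT : IsDeck π e₀ g T)
    (v : Fin l → K) (c : CellChains (liftedSkeleta π) k),
    x = v ⊗ₜ[ℤ] cellMap T hT.mapsTo k c - ((σ g : Matrix (Fin l) (Fin l) K).mulVec v) ⊗ₜ[ℤ] c}

/-- The module of twisted cellular `k`-chains `C_k(E) ⊗_σ K ^ l`. -/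
abbrev TwistedChains (π : C(E, X)) (e₀ : E)
    (σ : FundamentalGroup X (π e₀) →* Matrix.GeneralLinearGroup (Fin l) K) (k : ℕ) :
    Type (max v w) :=
  ((Fin l → K) ⊗[ℤ] CellChains (liftedSkeleta π) k) ⧸ twistedRel π e₀ σ k

/-- `id ⊗ ∂` before passing to the quotient. -/
def tensorD (π : C(E, X)) (K : Type w) [CommRing K] (l k : ℕ) :
    ((Fin l → K) ⊗[ℤ] CellChains (liftedSkeleta π) (k + 1)) →ₗ[K]
      ((Fin l → K) ⊗[ℤ] CellChains (liftedSkeleta π) k) :=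
  TensorProduct.AlgebraTensorModule.map LinearMap.id (cellD (liftedSkeleta π) k).toIntLinearMap

theorem twistedRel_le (π : C(E, X)) (e₀ : E)
    (σ : FundamentalGroup X (π e₀) →* Matrix.GeneralLinearGroup (Fin l) K) (k : ℕ) :
    twistedRel π e₀ σ (k + 1) ≤ (twistedRel π e₀ σ k).comap (tensorD π K l k) := by
  refine Submodule.span_le.2 ?_
  rintro _ ⟨g, T, hT, v, c, rfl⟩
  refine Submodule.subset_span ⟨g, T, hT, v, cellD _ k c, ?_⟩
  rw [← cellD_cellMap, map_sub]
  rfl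

/-- The differential `id ⊗ ∂` of the twisted cellular chain complex. -/
def twistedD (π : C(E, X)) (e₀ : E)
    (σ : FundamentalGroup X (π e₀) →* Matrix.GeneralLinearGroup (Fin l) K) (k : ℕ) :
    TwistedChains π e₀ σ (k + 1) →ₗ[K] TwistedChains π e₀ σ k :=
  Submodule.mapQ _ _ (tensorD π K l k) (twistedRel_le π e₀ σ k)

theorem tensorD_tensorD (π : C(E, X)) (K : Type w) [CommRing K] (l k : ℕ) :
    tensorD π K l k ∘ₗ tensorD π K l (k + 1) = 0 := by
  refine TensorProduct.AlgebraTensorModule.ext fun v c => ?_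
  change v ⊗ₜ[ℤ] cellD _ k (cellD _ (k + 1) c) = 0
  rw [cellD_cellD, TensorProduct.tmul_zero]

theorem twistedD_twistedD (π : C(E, X)) (e₀ : E)
    (σ : FundamentalGroup X (π e₀) →* Matrix.GeneralLinearGroup (Fin l) K) (k : ℕ) :
    twistedD π e₀ σ k ∘ₗ twistedD π e₀ σ (k + 1) = 0 := by
  refine LinearMap.ext fun x => ?_
  obtain ⟨c, rfl⟩ := Submodule.Quotient.mk_surjective _ x
  have := LinearMap.congr_fun (tensorD_tensorD π K l k) c
  exact congrArg (Submodule.Quotient.mk (p := twistedRel π e₀ σ k)) this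

/-- The complex of `K`-modules `C_*(E) ⊗_σ K ^ l`. -/
def twistedComplex (π : C(E, X)) (e₀ : E)
    (σ : FundamentalGroup X (π e₀) →* Matrix.GeneralLinearGroup (Fin l) K) :
    ChainComplex (ModuleCat.{max v w} K) ℕ :=
  ChainComplex.of (fun k => ModuleCat.of K (TwistedChains π e₀ σ k))
    (fun k => ModuleCat.ofHom (twistedD π e₀ σ k))
    (fun k => by
      rw [← ModuleCat.ofHom_comp, twistedD_twistedD]
      rfl)

/-- The rank over `K` of `H_k(C_*(E) ⊗_σ K ^ l)`. -/
def twistedRank (π : C(E, X)) (e₀ : E)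
    (σ : FundamentalGroup X (π e₀) →* Matrix.GeneralLinearGroup (Fin l) K) (k : ℕ) : ℕ :=
  Module.finrank K ((twistedComplex π e₀ σ).homology k)

end Twisted

/-! ### Twisting a representation, and the Novikov ring -/

section Novikov

/-- The tensor product `g ↦ ρ(g) · [p(g)]` of a representation `ρ` over `R` with a
homomorphism `p` to an abelian group `A`, a representation over the group ring `R[A]`. -/
def twistRep {G : Type u} [Group G] {R : Type w} [CommRing R] {A : Type v} [AddCommGroup A] {l : ℕ}
    (ρ : G →* Matrix.GeneralLinearGroup (Fin l) R) (p : Additive G →+ A) :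
    G →* Matrix.GeneralLinearGroup (Fin l) (AddMonoidAlgebra R A) :=
  MonoidHom.toHomUnits
    { toFun := fun g => Matrix.of fun i j =>
        AddMonoidAlgebra.single (p (Additive.ofMul g)) ((ρ g : Matrix (Fin l) (Fin l) R) i j)
      map_one' := by
        ext1 i j
        by_cases h : i = j
        · subst h
          simp [AddMonoidAlgebra.one_def]
        · simp [Matrix.one_apply_ne h]
      map_mul' := fun g h => by
        ext1 i j
        have e : (ρ (g * h) : Matrix (Fin l) (Fin l) R) i j =
            ∑ m, (ρ g : Matrix (Fin l) (Fin l) R) i m * (ρ h : Matrix (Fin l) (Fin l) R) m j := by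
          rw [map_mul, Units.val_mul, Matrix.mul_apply]
        simp only [ofMul_mul, map_add, Matrix.mul_apply, Matrix.of_apply,
          AddMonoidAlgebra.single_mul_single, e]
        exact map_sum (AddMonoidAlgebra.singleAddHom (R := R) _) _ _ }

/-- The finiteness condition in the definition of the Novikov completion: for every real `C` only
finitely many exponents `a ≥ C` occur in the series. -/
def IsNovikov {R : Type w} [CommRing R] {A : AddSubgroup ℝ} (x : HahnSeries Aᵒᵈ R) : Prop :=
  ∀ C : ℝ, {a : A | x.coeff (OrderDual.toDual a) ≠ 0 ∧ C ≤ (a : ℝ)}.Finite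

theorem isNovikov_single {R : Type w} [CommRing R] {A : AddSubgroup ℝ} (a : A) (r : R) :
    IsNovikov (HahnSeries.single (OrderDual.toDual a) r : HahnSeries Aᵒᵈ R) := by
  intro C
  refine (Set.finite_singleton a).subset fun b hb => ?_
  by_contra h
  exact hb.1 (HahnSeries.coeff_single_of_ne (fun e => h (OrderDual.toDual.injective e)))

theorem IsNovikov.add {R : Type w} [CommRing R] {A : AddSubgroup ℝ} {x y : HahnSeries Aᵒᵈ R}
    (hx : IsNovikov x) (hy : IsNovikov y) : IsNovikov (x + y) := by
  intro C
  refine ((hx C).union (hy C)).subset fun a ha => ?_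
  by_contra h
  simp only [Set.mem_union, Set.mem_ofPred_eq, ha.2, and_true, not_or, not_not] at h
  exact ha.1 (by rw [HahnSeries.coeff_add, h.1, h.2, add_zero])

theorem IsNovikov.exists_bound {R : Type w} [CommRing R] {A : AddSubgroup ℝ}
    {x : HahnSeries Aᵒᵈ R} (hx : IsNovikov x) :
    ∃ M : ℝ, ∀ a : A, x.coeff (OrderDual.toDual a) ≠ 0 → (a : ℝ) ≤ M := by
  obtain ⟨M, hM⟩ := ((hx 0).image (fun a : A => (a : ℝ))).bddAbove
  refine ⟨max M 0, fun a ha => ?_⟩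
  rcases le_total 0 (a : ℝ) with h | h
  · exact (hM ⟨a, ⟨ha, h⟩, rfl⟩).trans (le_max_left _ _)
  · exact h.trans (le_max_right _ _)

theorem IsNovikov.mul {R : Type w} [CommRing R] {A : AddSubgroup ℝ} {x y : HahnSeries Aᵒᵈ R}
    (hx : IsNovikov x) (hy : IsNovikov y) : IsNovikov (x * y) := by
  intro C
  obtain ⟨M, hM⟩ := hx.exists_bound
  obtain ⟨N, hN⟩ := hy.exists_bound
  refine (((hx (C - N)).prod (hy (C - M))).image (fun p : A × A => p.1 + p.2)).subset
    fun a ha => ?_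
  obtain ⟨b, hb, c, hc, hbc⟩ := HahnSeries.support_mul_subset (x := x) (y := y) ha.1
  have e : OrderDual.ofDual b + OrderDual.ofDual c = a := hbc
  have e' : ((OrderDual.ofDual b : A) : ℝ) + ((OrderDual.ofDual c : A) : ℝ) = a := by
    rw [← e]
    rfl
  have h1 := hM (OrderDual.ofDual b) hb
  have h2 := hN (OrderDual.ofDual c) hc
  have h3 : C ≤ (a : ℝ) := ha.2
  exact ⟨(OrderDual.ofDual b, OrderDual.ofDual c),
    ⟨⟨hb, show C - N ≤ ((OrderDual.ofDual b : A) : ℝ) by linarith⟩,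
      ⟨hc, show C - M ≤ ((OrderDual.ofDual c : A) : ℝ) by linarith⟩⟩, e⟩

/-- The Novikov completion of the group ring `R[A]` of a subgroup `A` of `ℝ`: the formal series
`∑ r_a [a]` over `a ∈ A` such that for every real `C` only finitely many `a ≥ C` have
`r_a ≠ 0`, with the convolution product. They are realised inside the Hahn series over `A` with
the reversed order, in which every support of this kind is well-ordered. -/
def NovikovRing (R : Type w) [CommRing R] (A : AddSubgroup ℝ) :
    Subalgebra R (HahnSeries Aᵒᵈ R) where
  carrier := {x | IsNovikov x}
  add_mem' hx hy := hx.add hy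
  mul_mem' hx hy := hx.mul hy
  algebraMap_mem' r := by
    have e : algebraMap R (HahnSeries Aᵒᵈ R) r =
        HahnSeries.single (OrderDual.toDual (0 : A)) r := rfl
    rw [e]
    exact isNovikov_single 0 r

/-- The inclusion of the group ring in its Novikov completion. -/
def toNovikov (R : Type w) [CommRing R] (A : AddSubgroup ℝ) :
    AddMonoidAlgebra R A →ₐ[R] NovikovRing R A :=
  AddMonoidAlgebra.lift R (NovikovRing R A) A
    { toFun := fun a =>
        ⟨HahnSeries.single (OrderDual.toDual (Multiplicative.toAdd a)) 1, isNovikov_single _ _⟩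
      map_one' := rfl
      map_mul' := fun a b => Subtype.ext (by
        simp [HahnSeries.single_mul_single]) }

end Novikov

/-! ### The Betti numbers and the jump loci -/

section Betti

variable {X : Type u} [TopologicalSpace X] [T2Space X] [Topology.CWComplex (Set.univ : Set X)]
  {E : Type v} [TopologicalSpace E] {R : Type w} [CommRing R] {l : ℕ}

/-- The Betti number of the maximal free abelian covering with `ρ`-twisted coefficients: with
`φ : π₁(X) → ℤ ^ n` the projection to `H₁(X)` modulo torsion, the dimension over the fraction
field `Q` of the Laurent polynomial ring `R[ℤ ^ n]` of `H_k(C_*(E) ⊗ Q ^ l)`, where `π₁(X)` acts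
on `Q ^ l` by `ρ ⊗ φ`. -/
def genericBetti (π : C(E, X)) (e₀ : E)
    (ρ : FundamentalGroup X (π e₀) →* Matrix.GeneralLinearGroup (Fin l) R) {n : ℕ}
    (φ : Additive (FundamentalGroup X (π e₀)) →+ (Fin n → ℤ)) (k : ℕ) : ℕ :=
  twistedRank (K := FractionRing (AddMonoidAlgebra R (Fin n → ℤ))) π e₀
    ((Matrix.GeneralLinearGroup.map (algebraMap (AddMonoidAlgebra R (Fin n → ℤ)) _)).comp
      (twistRep ρ φ)) k

/-- The twisted Novikov Betti number of `X` with respect to `ξ : π₁(X) → ℝ`. The homomorphism `ξ`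
is factored as the epimorphism `p` to its image, a free abelian group, followed by the inclusion
of the image in `ℝ`. The number is the rank of `H_k(C_*(E) ⊗ L ^ l)` over the Novikov completion
`L` of the group ring of the image, where `π₁(X)` acts on `L ^ l` by `ρ ⊗ p`. -/
def novikovBetti (π : C(E, X)) (e₀ : E)
    (ρ : FundamentalGroup X (π e₀) →* Matrix.GeneralLinearGroup (Fin l) R)
    (ξ : Additive (FundamentalGroup X (π e₀)) →+ ℝ) (k : ℕ) : ℕ :=
  twistedRank (K := NovikovRing R ξ.range) π e₀
    ((Matrix.GeneralLinearGroup.map (toNovikov R ξ.range).toRingHom).comp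
      (twistRep ρ ξ.rangeRestrict)) k

end Betti

/-- A full subgroup: a direct summand. -/
def IsFull {M : Type u} [AddCommGroup M] (H : AddSubgroup M) : Prop :=
  ∃ H' : AddSubgroup M, IsCompl H H'

/-- For a subgroup `H` of `Hom(ℤ ^ n, ℤ)`, the real subspace `H ⊗ ℝ` of
`Hom(ℤ ^ n, ℝ) = Hom(ℤ ^ n, ℤ) ⊗ ℝ`. -/
def realSpan {n : ℕ} (H : AddSubgroup ((Fin n → ℤ) →+ ℤ)) : Submodule ℝ ((Fin n → ℤ) →+ ℝ) :=
  Submodule.span ℝ ((fun h => (Int.castAddHom ℝ).comp h) '' (H : Set ((Fin n → ℤ) →+ ℤ)))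

end TwistedNovikov

end

/-!
In each degree the cellular chains of the universal covering are `ℤ[G]`, with `G = π₁(X)`, tensored
with a finitely generated abelian group, the relative homology of the cells modulo their collars.
Over an algebra over a field the twisted chains are therefore finite free, and the ranks of their
differentials do not change along injective ring homomorphisms. Hence the Novikov Betti number of
`ξ` can be computed over the fraction field of `F[ξ(ℤⁿ)]`, where `F` is the fraction field of `R`.

There the differentials are specialisations along `ξ` of matrices over `F[ℤⁿ]`, and their ranks are
decided by the vanishing of finitely many minors. Whether a minor vanishes in `F[ξ(ℤⁿ)]` depends
only on which of the differences of its exponents are killed by `ξ`. All jump conditions are thus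
governed by a finite set `D ⊆ ℤⁿ`: the more elements of `D` a homomorphism kills, the larger its
Betti number. Hence the jump locus is a finite union of real annihilators of subsets of `D`, and
integral annihilators are direct summands. An injective `ξ` has the generic Betti number, so for
`q > 0` the summands are proper.
-/

noncomputable section

namespace TwistedNovikov

/-- The singular `n`-simplices of a space, as continuous maps out of the standard simplex. -/
abbrev SingSimplex (n : ℕ) (E : Type v) [TopologicalSpace E] : Type v :=
  C(stdSimplex ℝ (Fin (n + 1)), E)

/-- The integral singular `n`-chains as finitely supported functions: a model of the categorical
`(singChains E).X n` in which subdivision and prism operators can be computed on generators. -/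
abbrev SingChain (n : ℕ) (E : Type v) [TopologicalSpace E] : Type v := SingSimplex n E →₀ ℤ

/-- The inclusion of the face of the standard simplex that is opposite to the vertex `i`. -/
def stdFace (n : ℕ) (i : Fin (n + 2)) :
    C(stdSimplex ℝ (Fin (n + 1)), stdSimplex ℝ (Fin (n + 2))) :=
  ⟨stdSimplex.map i.succAbove, stdSimplex.continuous_map _⟩

section
variable {E : Type v} [TopologicalSpace E]

/-- The boundary of singular chains, in the model by finitely supported functions. -/
def boundary (n : ℕ) : SingChain (n + 1) E →ₗ[ℤ] SingChain n E :=
  Finsupp.linearCombination ℤ fun σ => ∑ i : Fin (n + 2), (-1 : ℤ) ^ (i : ℕ) •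
    Finsupp.single (σ.comp (stdFace n i)) 1

theorem boundary_single (n : ℕ) (σ : SingSimplex (n + 1) E) :
    boundary n (Finsupp.single σ 1) =
      ∑ i : Fin (n + 2), (-1 : ℤ) ^ (i : ℕ) • Finsupp.single (σ.comp (stdFace n i)) 1 := by
  simp [boundary]

/-- The push-forward of singular chains, in the model by finitely supported functions. The two
spaces may live in different universes, unlike for the categorical `push`. -/
def pushforward {E' : Type w} [TopologicalSpace E'] (f : C(E, E')) (n : ℕ) :
    SingChain n E →ₗ[ℤ] SingChain n E' :=
  Finsupp.lmapDomain ℤ ℤ fun σ => f.comp σ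

theorem pushforward_single {E' : Type w} [TopologicalSpace E'] (f : C(E, E')) (n : ℕ)
    (σ : SingSimplex n E) (a : ℤ) :
    pushforward f n (Finsupp.single σ a) = Finsupp.single (f.comp σ) a := by
  simp [pushforward]

/-- The `n`-simplices of the singular simplicial set of `E` are its singular simplices. -/
def toSSetEquiv (n : ℕ) (E : Type v) [TopologicalSpace E] :
    (TopCat.toSSet.obj (TopCat.of E)).obj (Opposite.op (SimplexCategory.mk n)) ≃ SingSimplex n E :=
  TopCat.toSSetObjEquiv (TopCat.of E) _

/-- The coefficient object `ℤ` of `singChains`, lifted to the universe of the space. -/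
abbrev ZGrp : AddCommGrpCat.{v} := AddCommGrpCat.of (ULift.{v} ℤ)

/-- The homomorphism from the categorical singular chains to finitely supported functions, defined
by the universal property of the coproduct. -/
def singChainsToFinsupp (n : ℕ) (E : Type v) [TopologicalSpace E] :
    (singChains E).X n ⟶ AddCommGrpCat.of (SingChain n E) :=
  ((TopCat.toSSet.obj (TopCat.of E)).isColimitChainComplexXCofan ZGrp n).desc
    (Limits.Cofan.mk _ fun x => AddCommGrpCat.ofHom
      ((Finsupp.singleAddHom (toSSetEquiv n E x)).comp AddEquiv.ulift.toAddMonoidHom))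

/-- The coproduct inclusion of the copy of `ℤ` indexed by the simplex `x`. -/
abbrev simplexInclusion {n : ℕ}
    (x : (TopCat.toSSet.obj (TopCat.of E)).obj (Opposite.op (SimplexCategory.mk n))) :
    ZGrp ⟶ (singChains E).X n :=
  (TopCat.toSSet.obj (TopCat.of E)).ιChainComplex x

theorem simplexInclusion_singChainsToFinsupp {n : ℕ} (x) :
    simplexInclusion (E := E) (n := n) x ≫ singChainsToFinsupp n E = AddCommGrpCat.ofHom
      ((Finsupp.singleAddHom (toSSetEquiv n E x)).comp AddEquiv.ulift.toAddMonoidHom) :=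
  ((TopCat.toSSet.obj (TopCat.of E)).isColimitChainComplexXCofan ZGrp n).fac _ ⟨x⟩

/-- The chain given by a single singular simplex with coefficient `1`. -/
def singGenerator {n : ℕ} (σ : SingSimplex n E) : (singChains E).X n :=
  (simplexInclusion ((toSSetEquiv n E).symm σ)).hom (ULift.up 1)

theorem singChainsToFinsupp_singGenerator {n : ℕ} (σ : SingSimplex n E) :
    (singChainsToFinsupp n E).hom (singGenerator σ) = Finsupp.single σ 1 := by
  refine (congrArg (fun m => m.hom (ULift.up 1))
    (simplexInclusion_singChainsToFinsupp ((toSSetEquiv n E).symm σ))).trans ?_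
  change Finsupp.single ((toSSetEquiv n E) ((toSSetEquiv n E).symm σ)) (1 : ℤ) = _
  rw [Equiv.apply_symm_apply]

/-- The inverse of `singChainsToFinsupp`. -/
def finsuppToSingChains (n : ℕ) (E : Type v) [TopologicalSpace E] :
    SingChain n E →+ (singChains E).X n :=
  (Finsupp.lift ((singChains E).X n) ℤ (SingSimplex n E) singGenerator).toAddMonoidHom

theorem finsuppToSingChains_single {n : ℕ} (σ : SingSimplex n E) :
    finsuppToSingChains n E (Finsupp.single σ 1) = singGenerator σ := by
  simp [finsuppToSingChains]

theorem singChains_hom_ext {n : ℕ} {A : Type v} [AddCommGroup A] {f g : (singChains E).X n →+ A}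
    (h : ∀ σ : SingSimplex n E, f (singGenerator σ) = g (singGenerator σ)) : f = g := by
  have hom_eq : AddCommGrpCat.ofHom f = AddCommGrpCat.ofHom g := by
    refine SSet.chainComplex_hom_ext fun x => AddCommGrpCat.hom_ext ?_
    have eq_on_one := h (toSSetEquiv n E x)
    rw [singGenerator, Equiv.symm_apply_apply] at eq_on_one
    refine DFunLike.ext _ _ fun y => ?_
    have y_eq : y = ULift.down y • (ULift.up 1 : ULift.{v} ℤ) := ULift.ext _ _ (by simp)
    rw [y_eq, map_zsmul, map_zsmul]
    exact congrArg _ eq_on_one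
  exact congrArg (fun m => m.hom) hom_eq

/-- The comparison of the two models of singular chains. -/
def singChainsEquiv (n : ℕ) (E : Type v) [TopologicalSpace E] :
    (singChains E).X n ≃+ SingChain n E :=
  AddMonoidHom.toAddEquiv (singChainsToFinsupp n E).hom (finsuppToSingChains n E)
    (singChains_hom_ext fun σ =>
      (congrArg (finsuppToSingChains n E) (singChainsToFinsupp_singGenerator σ)).trans
        (finsuppToSingChains_single σ))
    (Finsupp.addHom_ext' fun σ => AddMonoidHom.ext_int
      ((congrArg (singChainsToFinsupp n E).hom (finsuppToSingChains_single σ)).trans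
        (singChainsToFinsupp_singGenerator σ)))

@[simp] theorem singChainsEquiv_singGenerator {n : ℕ} (σ : SingSimplex n E) :
    singChainsEquiv n E (singGenerator σ) = Finsupp.single σ 1 :=
  singChainsToFinsupp_singGenerator σ

theorem bd_singGenerator {n : ℕ} (σ : SingSimplex (n + 1) E) :
    bd E (n + 1) n (singGenerator σ) =
      ∑ i : Fin (n + 2), (-1 : ℤ) ^ (i : ℕ) • singGenerator (σ.comp (stdFace n i)) := by
  have d_eq := congrArg (fun m => m.hom (ULift.up 1)) (SSet.ιChainComplex_d (R := ZGrp)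
    (X := TopCat.toSSet.obj (TopCat.of E)) ((toSSetEquiv _ E).symm σ))
  have δ_eq : ∀ i : Fin (n + 2),
      (TopCat.toSSet.obj (TopCat.of E)).δ i ((toSSetEquiv _ E).symm σ) =
        (toSSetEquiv _ E).symm (σ.comp (stdFace n i)) := fun i => rfl
  have sum_apply : ∀ (s : Finset (Fin (n + 2))) (f : Fin (n + 2) → (ZGrp ⟶ (singChains E).X n)),
      (∑ i ∈ s, f i).hom (ULift.up 1) = ∑ i ∈ s, (f i).hom (ULift.up 1) := fun s f =>
    map_sum (((AddMonoidHom.eval (ULift.up 1)).comp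
      (AddCommGrpCat.homAddEquiv (M := ZGrp) (N := (singChains E).X n)).toAddMonoidHom)) f s
  refine d_eq.trans ?_
  simp only [δ_eq]
  exact sum_apply _ _

theorem push_singGenerator {E' : Type v} [TopologicalSpace E'] (f : C(E, E')) {n : ℕ}
    (σ : SingSimplex n E) :
    push f n (singGenerator σ) = singGenerator (f.comp σ) :=
  congrArg (fun m : ZGrp ⟶ (singChains E').X n => m.hom (ULift.up 1))
    (SSet.ι_chainComplexMap_f (R := ZGrp) _ _ (TopCat.toSSet.map (TopCat.ofHom f))
      ((toSSetEquiv _ E).symm σ))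

theorem singChainsEquiv_bd (n : ℕ) (c : (singChains E).X (n + 1)) :
    singChainsEquiv n E (bd E (n + 1) n c) = boundary n (singChainsEquiv (n + 1) E c) := by
  have hom_eq : (singChainsEquiv n E).toAddMonoidHom.comp (bd E (n + 1) n) =
      (boundary n).toAddMonoidHom.comp (singChainsEquiv (n + 1) E).toAddMonoidHom :=
    singChains_hom_ext fun σ => by simp [bd_singGenerator, boundary]
  exact DFunLike.congr_fun hom_eq c

theorem singChainsEquiv_push {E' : Type v} [TopologicalSpace E'] (f : C(E, E')) (n : ℕ)
    (c : (singChains E).X n) :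
    singChainsEquiv n E' (push f n c) = pushforward f n (singChainsEquiv n E c) := by
  have hom_eq : (singChainsEquiv n E').toAddMonoidHom.comp (push f n) =
      (pushforward f n).toAddMonoidHom.comp (singChainsEquiv n E).toAddMonoidHom :=
    singChains_hom_ext fun σ => by simp [push_singGenerator, pushforward]
  exact DFunLike.congr_fun hom_eq c

end


theorem apply_eq_of_apply_single {α M : Type*} [AddCommGroup M] (f g : (α →₀ ℤ) →ₗ[ℤ] M)
    (h : ∀ a, f (Finsupp.single a 1) = g (Finsupp.single a 1)) (c : α →₀ ℤ) : f c = g c :=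
  LinearMap.congr_fun (Finsupp.lhom_ext' fun a => LinearMap.ext_ring (h a)) c

section Naturality

variable {E : Type u} {E' : Type v} {E'' : Type w} [TopologicalSpace E] [TopologicalSpace E']
  [TopologicalSpace E'']

theorem pushforward_comp (f : C(E, E')) (g : C(E', E'')) (n : ℕ) (c : SingChain n E) :
    pushforward (g.comp f) n c = pushforward g n (pushforward f n c) :=
  apply_eq_of_apply_single (pushforward (g.comp f) n) (pushforward g n ∘ₗ pushforward f n)
    (fun σ => by simp [pushforward_single, ContinuousMap.comp_assoc]) c

theorem pushforward_id (n : ℕ) (c : SingChain n E) : pushforward (ContinuousMap.id E) n c = c :=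
  apply_eq_of_apply_single (pushforward (ContinuousMap.id E) n) LinearMap.id
    (fun σ => by simp [pushforward_single]) c

theorem boundary_pushforward (f : C(E, E')) (n : ℕ) (c : SingChain (n + 1) E) :
    boundary n (pushforward f (n + 1) c) = pushforward f n (boundary n c) :=
  apply_eq_of_apply_single (boundary n ∘ₗ pushforward f (n + 1)) (pushforward f n ∘ₗ boundary n)
    (fun σ => by simp [pushforward_single, boundary_single, ContinuousMap.comp_assoc]) c

end Naturality

/-! ### Chains of ordered tuples -/

section Tuples

/-- The chains of ordered `(n + 1)`-tuples of points of a set `Y`. For `Y` convex they model the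
singular chains of affine simplices, and the operators on them only involve combinatorics. -/
abbrev TupleChain (n : ℕ) (Y : Type v) : Type v := (Fin (n + 1) → Y) →₀ ℤ

variable {Y : Type u} {Z : Type v}

/-- The simplicial boundary of chains of tuples. -/
def tupleBoundary (n : ℕ) : TupleChain (n + 1) Y →ₗ[ℤ] TupleChain n Y :=
  Finsupp.linearCombination ℤ fun p => ∑ i : Fin (n + 2), (-1 : ℤ) ^ (i : ℕ) •
    Finsupp.single (p ∘ i.succAbove) 1

theorem tupleBoundary_single (n : ℕ) (p : Fin (n + 2) → Y) :
    tupleBoundary n (Finsupp.single p 1) =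
      ∑ i : Fin (n + 2), (-1 : ℤ) ^ (i : ℕ) • Finsupp.single (p ∘ i.succAbove) 1 := by
  simp [tupleBoundary]

/-- The map of chains of tuples induced by a map of sets. -/
def tupleMap (f : Y → Z) (n : ℕ) : TupleChain n Y →ₗ[ℤ] TupleChain n Z :=
  Finsupp.lmapDomain ℤ ℤ fun p => f ∘ p

theorem tupleMap_single (f : Y → Z) (n : ℕ) (p : Fin (n + 1) → Y) (a : ℤ) :
    tupleMap f n (Finsupp.single p a) = Finsupp.single (f ∘ p) a := by
  simp [tupleMap]

theorem tupleBoundary_tupleMap (f : Y → Z) (n : ℕ) (c : TupleChain (n + 1) Y) :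
    tupleBoundary n (tupleMap f (n + 1) c) = tupleMap f n (tupleBoundary n c) :=
  apply_eq_of_apply_single (tupleBoundary n ∘ₗ tupleMap f (n + 1)) (tupleMap f n ∘ₗ tupleBoundary n)
    (fun p => by simp [tupleMap_single, tupleBoundary_single, Function.comp_assoc]) c

/-- The cone with apex `b`, which is prepended to every tuple. -/
def tupleCone (b : Y) (n : ℕ) : TupleChain n Y →ₗ[ℤ] TupleChain (n + 1) Y :=
  Finsupp.lmapDomain ℤ ℤ fun p => (Fin.cons b p : Fin (n + 2) → Y)

theorem tupleCone_single (b : Y) (n : ℕ) (p : Fin (n + 1) → Y) (a : ℤ) :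
    tupleCone b n (Finsupp.single p a) = Finsupp.single (Fin.cons b p : Fin (n + 2) → Y) a := by
  simp [tupleCone]

theorem tupleMap_tupleCone (f : Y → Z) (b : Y) (n : ℕ) (c : TupleChain n Y) :
    tupleMap f (n + 1) (tupleCone b n c) = tupleCone (f b) n (tupleMap f n c) :=
  apply_eq_of_apply_single (tupleMap f (n + 1) ∘ₗ tupleCone b n) (tupleCone (f b) n ∘ₗ tupleMap f n)
    (fun p => by
      have comp_cons : f ∘ (Fin.cons b p : Fin (n + 2) → Y) =
          (Fin.cons (f b) (f ∘ p) : Fin (n + 2) → Z) := by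
        funext i
        refine Fin.cases ?_ (fun j => ?_) i <;> simp
      simp [tupleMap_single, tupleCone_single, comp_cons]) c

/-- The augmentation of `0`-chains, the sum of the coefficients. -/
def augmentation : TupleChain 0 Y →ₗ[ℤ] ℤ := Finsupp.linearCombination ℤ fun _ => 1

theorem augmentation_single (p : Fin 1 → Y) : augmentation (Finsupp.single p 1) = 1 := by
  simp [augmentation]

theorem augmentation_tupleBoundary (c : TupleChain 1 Y) : augmentation (tupleBoundary 0 c) = 0 :=
  apply_eq_of_apply_single (augmentation ∘ₗ tupleBoundary 0) 0 (fun p => by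
    simp [tupleBoundary_single, augmentation_single, Fin.sum_univ_two]) c

theorem augmentation_tupleMap (f : Y → Z) (c : TupleChain 0 Y) :
    augmentation (tupleMap f 0 c) = augmentation c :=
  apply_eq_of_apply_single (augmentation ∘ₗ tupleMap f 0) augmentation
    (fun p => by simp [tupleMap_single, augmentation_single]) c

theorem tupleBoundary_tupleCone (b : Y) (n : ℕ) (c : TupleChain (n + 1) Y) :
    tupleBoundary (n + 1) (tupleCone b (n + 1) c) = c - tupleCone b n (tupleBoundary n c) :=
  apply_eq_of_apply_single (tupleBoundary (n + 1) ∘ₗ tupleCone b (n + 1))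
    (LinearMap.id - tupleCone b n ∘ₗ tupleBoundary n)
    (fun p => by
      have face_succ : ∀ i : Fin (n + 2), (Fin.cons b p : Fin (n + 3) → Y) ∘ i.succ.succAbove =
          (Fin.cons b (p ∘ i.succAbove) : Fin (n + 2) → Y) := by
        intro i
        funext j
        refine Fin.cases ?_ (fun j => ?_) j <;> simp
      have face_zero : (Fin.cons b p : Fin (n + 3) → Y) ∘ (0 : Fin (n + 3)).succAbove = p := by
        funext j
        simp
      simp only [LinearMap.comp_apply, LinearMap.sub_apply, LinearMap.id_apply, tupleCone_single,
        tupleBoundary_single, Fin.sum_univ_succ (n := n + 2), face_succ, face_zero, map_sum,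
        map_zsmul]
      simp [pow_succ, sub_eq_add_neg]) c

theorem tupleBoundary_tupleCone_zero (b : Y) (c : TupleChain 0 Y) :
    tupleBoundary 0 (tupleCone b 0 c) = c - augmentation c • Finsupp.single (fun _ => b) 1 :=
  apply_eq_of_apply_single (tupleBoundary 0 ∘ₗ tupleCone b 0)
    (LinearMap.id - LinearMap.toSpanSingleton ℤ _ (Finsupp.single (fun _ => b) 1) ∘ₗ augmentation)
    (fun p => by
      have face_one : (Fin.cons b p : Fin 2 → Y) ∘ (1 : Fin 2).succAbove = fun _ => b := by
        funext j
        fin_cases j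
        rfl
      have face_zero : (Fin.cons b p : Fin 2 → Y) ∘ (0 : Fin 2).succAbove = p := by
        funext j
        simp
      simp only [LinearMap.comp_apply, LinearMap.sub_apply, LinearMap.id_apply, tupleCone_single,
        tupleBoundary_single, augmentation_single, LinearMap.toSpanSingleton_apply]
      rw [Fin.sum_univ_two, face_zero, face_one]
      simp [sub_eq_add_neg]) c

theorem tupleBoundary_tupleBoundary (n : ℕ) (c : TupleChain (n + 2) Y) :
    tupleBoundary n (tupleBoundary (n + 1) c) = 0 := by
  induction n with
  | zero =>
    refine apply_eq_of_apply_single (tupleBoundary 0 ∘ₗ tupleBoundary 1) 0 (fun p => ?_) c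
    rw [← Fin.cons_self_tail p, ← tupleCone_single]
    simp only [LinearMap.comp_apply, tupleBoundary_tupleCone, map_sub,
      tupleBoundary_tupleCone_zero, augmentation_tupleBoundary]
    simp
  | succ n ih =>
    refine apply_eq_of_apply_single (tupleBoundary (n + 1) ∘ₗ tupleBoundary (n + 2)) 0
      (fun p => ?_) c
    rw [← Fin.cons_self_tail p, ← tupleCone_single]
    simp only [LinearMap.comp_apply, tupleBoundary_tupleCone, map_sub, ih]
    simp

/-- The chain homotopy between two augmentation preserving chain maps `F` and `G`, built by
induction on the degree by coning off with apex `b n p` on the tuple `p`. -/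
def coneHomotopy (F G : ∀ n, TupleChain n Y →ₗ[ℤ] TupleChain n Z) (b : ∀ n, (Fin (n + 1) → Y) → Z) :
    ∀ n, TupleChain n Y →ₗ[ℤ] TupleChain (n + 1) Z
  | 0 => Finsupp.linearCombination ℤ fun p =>
      tupleCone (b 0 p) 0 (F 0 (Finsupp.single p 1) - G 0 (Finsupp.single p 1))
  | n + 1 => Finsupp.linearCombination ℤ fun p =>
      tupleCone (b (n + 1) p) (n + 1)
        (F (n + 1) (Finsupp.single p 1) - G (n + 1) (Finsupp.single p 1) -
          coneHomotopy F G b n (tupleBoundary n (Finsupp.single p 1)))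

section

variable (F G : ∀ n, TupleChain n Y →ₗ[ℤ] TupleChain n Z) (b : ∀ n, (Fin (n + 1) → Y) → Z)

theorem coneHomotopy_zero_single (p : Fin 1 → Y) :
    coneHomotopy F G b 0 (Finsupp.single p 1) =
      tupleCone (b 0 p) 0 (F 0 (Finsupp.single p 1) - G 0 (Finsupp.single p 1)) := by
  simp [coneHomotopy]

theorem coneHomotopy_succ_single (n : ℕ) (p : Fin (n + 2) → Y) :
    coneHomotopy F G b (n + 1) (Finsupp.single p 1) =
      tupleCone (b (n + 1) p) (n + 1)
        (F (n + 1) (Finsupp.single p 1) - G (n + 1) (Finsupp.single p 1) -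
          coneHomotopy F G b n (tupleBoundary n (Finsupp.single p 1))) := by
  rw [coneHomotopy]
  simp

variable {F G}

theorem tupleBoundary_coneHomotopy_zero (h : ∀ c, augmentation (F 0 c) = augmentation (G 0 c))
    (c : TupleChain 0 Y) :
    tupleBoundary 0 (coneHomotopy F G b 0 c) = F 0 c - G 0 c :=
  apply_eq_of_apply_single (tupleBoundary 0 ∘ₗ coneHomotopy F G b 0) (F 0 - G 0) (fun p => by
    simp [coneHomotopy_zero_single, tupleBoundary_tupleCone_zero, h, -map_sub,
      map_sub augmentation]) c

theorem tupleBoundary_coneHomotopy (h : ∀ c, augmentation (F 0 c) = augmentation (G 0 c))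
    (hF : ∀ n c, tupleBoundary n (F (n + 1) c) = F n (tupleBoundary n c))
    (hG : ∀ n c, tupleBoundary n (G (n + 1) c) = G n (tupleBoundary n c)) (n : ℕ)
    (c : TupleChain (n + 1) Y) :
    tupleBoundary (n + 1) (coneHomotopy F G b (n + 1) c) =
      F (n + 1) c - G (n + 1) c - coneHomotopy F G b n (tupleBoundary n c) := by
  induction n with
  | zero =>
    refine apply_eq_of_apply_single (tupleBoundary 1 ∘ₗ coneHomotopy F G b 1)
      (F 1 - G 1 - coneHomotopy F G b 0 ∘ₗ tupleBoundary 0) (fun p => ?_) c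
    simp only [LinearMap.comp_apply, LinearMap.sub_apply, coneHomotopy_succ_single,
      tupleBoundary_tupleCone, map_sub, tupleBoundary_coneHomotopy_zero b h, hF, hG]
    abel
  | succ n ih =>
    refine apply_eq_of_apply_single (tupleBoundary (n + 2) ∘ₗ coneHomotopy F G b (n + 2))
      (F (n + 2) - G (n + 2) - coneHomotopy F G b (n + 1) ∘ₗ tupleBoundary (n + 1)) (fun p => ?_) c
    simp only [LinearMap.comp_apply, LinearMap.sub_apply, coneHomotopy_succ_single,
      tupleBoundary_tupleCone, map_sub, ih, hF, hG, tupleBoundary_tupleBoundary, map_zero]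
    abel

theorem coneHomotopy_tupleMap {Y' : Type*} {Z' : Type*}
    {F' G' : ∀ n, TupleChain n Y' →ₗ[ℤ] TupleChain n Z'} {b' : ∀ n, (Fin (n + 1) → Y') → Z'}
    (f : Y → Y') (g : Z → Z') (hF : ∀ n c, F' n (tupleMap f n c) = tupleMap g n (F n c))
    (hG : ∀ n c, G' n (tupleMap f n c) = tupleMap g n (G n c))
    (hb : ∀ n p, b' n (f ∘ p) = g (b n p)) (n : ℕ) (c : TupleChain n Y) :
    coneHomotopy F' G' b' n (tupleMap f n c) = tupleMap g (n + 1) (coneHomotopy F G b n c) := by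
  induction n with
  | zero =>
    refine apply_eq_of_apply_single (coneHomotopy F' G' b' 0 ∘ₗ tupleMap f 0)
      (tupleMap g 1 ∘ₗ coneHomotopy F G b 0) (fun p => ?_) c
    simp only [LinearMap.comp_apply, tupleMap_single, coneHomotopy_zero_single, tupleMap_tupleCone,
      map_sub, hb, ← hF, ← hG]
  | succ n ih =>
    refine apply_eq_of_apply_single (coneHomotopy F' G' b' (n + 1) ∘ₗ tupleMap f (n + 1))
      (tupleMap g (n + 2) ∘ₗ coneHomotopy F G b (n + 1)) (fun p => ?_) c
    simp only [LinearMap.comp_apply, tupleMap_single, coneHomotopy_succ_single, tupleMap_tupleCone,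
      map_sub, hb, ← hF, ← hG, ← ih, ← tupleBoundary_tupleMap]

end

/-- The subdivision operator determined by a choice `b` of barycentres of tuples: the subdivision
of a simplex is the cone from its barycentre on the subdivision of its boundary. -/
def tupleSubdiv (b : ∀ n, (Fin (n + 1) → Y) → Y) : ∀ n, TupleChain n Y →ₗ[ℤ] TupleChain n Y
  | 0 => LinearMap.id
  | n + 1 => Finsupp.linearCombination ℤ fun p =>
      tupleCone (b (n + 1) p) n (tupleSubdiv b n (tupleBoundary n (Finsupp.single p 1)))

section

variable (b : ∀ n, (Fin (n + 1) → Y) → Y)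

theorem tupleSubdiv_succ_single (n : ℕ) (p : Fin (n + 2) → Y) :
    tupleSubdiv b (n + 1) (Finsupp.single p 1) =
      tupleCone (b (n + 1) p) n (tupleSubdiv b n (tupleBoundary n (Finsupp.single p 1))) := by
  rw [tupleSubdiv]
  simp

theorem tupleBoundary_tupleSubdiv (n : ℕ) (c : TupleChain (n + 1) Y) :
    tupleBoundary n (tupleSubdiv b (n + 1) c) = tupleSubdiv b n (tupleBoundary n c) := by
  induction n with
  | zero =>
    refine apply_eq_of_apply_single (tupleBoundary 0 ∘ₗ tupleSubdiv b 1)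
      (tupleSubdiv b 0 ∘ₗ tupleBoundary 0) (fun p => ?_) c
    simp only [LinearMap.comp_apply, tupleSubdiv_succ_single, tupleBoundary_tupleCone_zero]
    simp [tupleSubdiv, augmentation_tupleBoundary]
  | succ n ih =>
    refine apply_eq_of_apply_single (tupleBoundary (n + 1) ∘ₗ tupleSubdiv b (n + 2))
      (tupleSubdiv b (n + 1) ∘ₗ tupleBoundary (n + 1)) (fun p => ?_) c
    simp only [LinearMap.comp_apply, tupleSubdiv_succ_single, tupleBoundary_tupleCone, ih,
      tupleBoundary_tupleBoundary]
    simp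

theorem tupleSubdiv_tupleMap {Y' : Type*} {b' : ∀ n, (Fin (n + 1) → Y') → Y'} (f : Y → Y')
    (hb : ∀ n p, b' n (f ∘ p) = f (b n p)) (n : ℕ) (c : TupleChain n Y) :
    tupleSubdiv b' n (tupleMap f n c) = tupleMap f n (tupleSubdiv b n c) := by
  induction n with
  | zero => rfl
  | succ n ih =>
    refine apply_eq_of_apply_single (tupleSubdiv b' (n + 1) ∘ₗ tupleMap f (n + 1))
      (tupleMap f (n + 1) ∘ₗ tupleSubdiv b (n + 1)) (fun p => ?_) c
    simp only [LinearMap.comp_apply, tupleMap_single, tupleSubdiv_succ_single, tupleMap_tupleCone,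
      hb, ← ih, ← tupleBoundary_tupleMap]

end

end Tuples

/-! ### Affine simplices in a convex set -/

section Affine

variable {V : Type u} [AddCommGroup V] [Module ℝ V] [TopologicalSpace V] [ContinuousAdd V]
  [ContinuousSMul ℝ V] {K : Set V}

/-- The affine singular simplex of a convex set with given vertices, in barycentric
coordinates. -/
def affineSimplex (hK : Convex ℝ K) {n : ℕ} (p : Fin (n + 1) → K) : SingSimplex n K :=
  ⟨fun x => ⟨∑ i, x i • (p i : V),
    hK.sum_mem (fun i _ => x.2.1 i) x.2.2 (fun i _ => (p i).2)⟩, by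
    refine Continuous.subtype_mk (continuous_finsetSum _ fun i _ => ?_) _
    exact (((continuous_apply i).comp continuous_subtype_val).smul continuous_const)⟩

theorem affineSimplex_apply (hK : Convex ℝ K) {n : ℕ} (p : Fin (n + 1) → K)
    (x : stdSimplex ℝ (Fin (n + 1))) :
    (affineSimplex hK p x : V) = ∑ i, x i • (p i : V) := rfl

theorem stdSimplex_sum_map {X Y : Type*} [Fintype X] [Fintype Y] {W : Type*} [AddCommGroup W]
    [Module ℝ W] (f : X → Y) (x : stdSimplex ℝ X) (q : Y → W) :
    ∑ j, stdSimplex.map f x j • q j = ∑ i, x i • q (f i) := by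
  classical
  have map_apply : ∀ j, stdSimplex.map f x j = ∑ i with f i = j, x i := fun j => by
    rw [stdSimplex.map_coe, FunOnFinite.linearMap_apply_apply]
  simp only [map_apply, Finset.sum_smul]
  rw [← Finset.sum_fiberwise (s := Finset.univ) (g := f)]
  refine Finset.sum_congr rfl fun j _ => Finset.sum_congr rfl fun i hi => ?_
  rw [(Finset.mem_filter.1 hi).2]

theorem affineSimplex_comp_stdFace (hK : Convex ℝ K) {n : ℕ} (p : Fin (n + 2) → K)
    (i : Fin (n + 2)) :
    (affineSimplex hK p).comp (stdFace n i) = affineSimplex hK (p ∘ i.succAbove) := by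
  ext x
  exact stdSimplex_sum_map i.succAbove x fun j => (p j : V)

/-- The singular chain of a chain of tuples: a tuple is sent to the affine simplex it spans. -/
def realize (hK : Convex ℝ K) (n : ℕ) : TupleChain n K →ₗ[ℤ] SingChain n K :=
  Finsupp.lmapDomain ℤ ℤ fun p => affineSimplex hK p

theorem realize_single (hK : Convex ℝ K) (n : ℕ) (p : Fin (n + 1) → K) (a : ℤ) :
    realize hK n (Finsupp.single p a) = Finsupp.single (affineSimplex hK p) a := by
  simp [realize]

theorem boundary_realize (hK : Convex ℝ K) (n : ℕ) (c : TupleChain (n + 1) K) :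
    boundary n (realize hK (n + 1) c) = realize hK n (tupleBoundary n c) :=
  apply_eq_of_apply_single (boundary n ∘ₗ realize hK (n + 1)) (realize hK n ∘ₗ tupleBoundary n)
    (fun p => by simp [realize_single, boundary_single, tupleBoundary_single,
      affineSimplex_comp_stdFace]) c

/-- The barycentre of a tuple of points of a convex set, the apex of the cones in barycentric
subdivision. -/
def tupleBarycenter (hK : Convex ℝ K) (n : ℕ) (p : Fin (n + 1) → K) : K :=
  affineSimplex hK p stdSimplex.barycenter

variable {V' : Type v} [AddCommGroup V'] [Module ℝ V'] [TopologicalSpace V'] [ContinuousAdd V']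
  [ContinuousSMul ℝ V'] {K' : Set V'}

/-- Affinity of a continuous map of convex sets, in the form in which it is used: affine simplices
are sent to affine simplices. -/
def IsAffineMap (hK : Convex ℝ K) (hK' : Convex ℝ K') (a : C(K, K')) : Prop :=
  ∀ (n : ℕ) (p : Fin (n + 1) → K), a.comp (affineSimplex hK p) = affineSimplex hK' (a ∘ p)

theorem IsAffineMap.pushforward_realize {hK : Convex ℝ K} {hK' : Convex ℝ K'} {a : C(K, K')}
    (ha : IsAffineMap hK hK' a) (n : ℕ) (c : TupleChain n K) :
    pushforward a n (realize hK n c) = realize hK' n (tupleMap a n c) :=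
  apply_eq_of_apply_single (pushforward a n ∘ₗ realize hK n) (realize hK' n ∘ₗ tupleMap a n)
    (fun p => by simp [realize_single, tupleMap_single, pushforward_single, ha n p]) c

theorem IsAffineMap.tupleBarycenter {hK : Convex ℝ K} {hK' : Convex ℝ K'} {a : C(K, K')}
    (ha : IsAffineMap hK hK' a) (n : ℕ) (p : Fin (n + 1) → K) :
    tupleBarycenter hK' n (a ∘ p) = a (tupleBarycenter hK n p) :=
  (congrArg (fun f => f stdSimplex.barycenter) (ha n p)).symm

end Affine

/-! ### Standard simplices and prisms -/

/-- The standard `n`-simplex as a subset of its ambient space, on which affine simplices live. -/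
abbrev StdSimplex (n : ℕ) : Set (Fin (n + 1) → ℝ) := stdSimplex ℝ (Fin (n + 1))

theorem convex_StdSimplex (n : ℕ) : Convex ℝ (StdSimplex n) := convex_stdSimplex ℝ _

/-- The prism over the standard `n`-simplex, the domain of homotopies of singular simplices. -/
def Prism (n : ℕ) : Set ((Fin (n + 1) → ℝ) × ℝ) := StdSimplex n ×ˢ Set.Icc (0 : ℝ) 1

theorem convex_prism (n : ℕ) : Convex ℝ (Prism n) := (convex_StdSimplex n).prod (convex_Icc 0 1)

/-- The tuple of vertices of the standard simplex. -/
def stdVertices (n : ℕ) : Fin (n + 1) → StdSimplex n := fun i => stdSimplex.vertex i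

theorem sum_smul_stdVertices (n : ℕ) (x : StdSimplex n) :
    ∑ i, x i • ((stdVertices n i : StdSimplex n) : Fin (n + 1) → ℝ) = (x : Fin (n + 1) → ℝ) := by
  funext j
  simp [stdVertices, Pi.single_apply]

theorem affineSimplex_stdVertices (n : ℕ) :
    affineSimplex (convex_StdSimplex n) (stdVertices n) = ContinuousMap.id _ := by
  ext x : 2
  exact sum_smul_stdVertices n x

theorem stdFace_comp_stdVertices (n : ℕ) (i : Fin (n + 2)) :
    stdFace n i ∘ stdVertices n = stdVertices (n + 1) ∘ i.succAbove := by
  funext j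
  exact stdSimplex.map_vertex _ _

theorem affineSimplex_comp_stdVertices {V : Type u} [AddCommGroup V] [Module ℝ V]
    [TopologicalSpace V] [ContinuousAdd V] [ContinuousSMul ℝ V] {K : Set V} (hK : Convex ℝ K)
    {n : ℕ} (p : Fin (n + 1) → K) :
    affineSimplex hK p ∘ stdVertices n = p := by
  funext j
  ext1
  change ∑ i, (stdVertices n j) i • (p i : V) = p j
  simp [stdVertices, Pi.single_apply]

theorem isAffineMap_affineSimplex {V : Type u} [AddCommGroup V] [Module ℝ V] [TopologicalSpace V]
    [ContinuousAdd V] [ContinuousSMul ℝ V] {K : Set V} (hK : Convex ℝ K) {n : ℕ}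
    (p : Fin (n + 1) → K) :
    IsAffineMap (convex_StdSimplex n) hK (affineSimplex hK p) := by
  intro m q
  ext x
  change ∑ i, (∑ j, x j • ((q j : StdSimplex n) : Fin (n + 1) → ℝ)) i • (p i : V) =
    ∑ j, x j • ∑ i, (q j) i • (p i : V)
  simp only [Finset.sum_apply, Finset.sum_smul, Pi.smul_apply, smul_eq_mul, Finset.smul_sum,
    mul_smul]
  exact Finset.sum_comm

theorem stdFace_eq_affineSimplex (n : ℕ) (i : Fin (n + 2)) :
    stdFace n i =
      affineSimplex (convex_StdSimplex (n + 1)) (stdVertices (n + 1) ∘ i.succAbove) := by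
  rw [← affineSimplex_comp_stdFace, affineSimplex_stdVertices, ContinuousMap.id_comp]

theorem isAffineMap_stdFace (n : ℕ) (i : Fin (n + 2)) :
    IsAffineMap (convex_StdSimplex n) (convex_StdSimplex (n + 1)) (stdFace n i) := by
  rw [stdFace_eq_affineSimplex]
  exact isAffineMap_affineSimplex _ _

/-- The inclusion of the standard simplex in the prism at height `t`. -/
def prismSlice (n : ℕ) (t : unitInterval) : C(StdSimplex n, Prism n) :=
  ⟨fun x => ⟨((x : Fin (n + 1) → ℝ), (t : ℝ)), ⟨x.2, t.2⟩⟩, by fun_prop⟩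

/-- The inclusion of the lateral face of the prism over the face opposite to the vertex `i`. -/
def prismFace (n : ℕ) (i : Fin (n + 2)) : C(Prism n, Prism (n + 1)) :=
  ⟨fun z => ⟨(stdFace n i ⟨z.1.1, z.2.1⟩, z.1.2), ⟨(stdFace n i ⟨z.1.1, z.2.1⟩).2, z.2.2⟩⟩, by
    fun_prop⟩

theorem isAffineMap_prismSlice (n : ℕ) (t : unitInterval) :
    IsAffineMap (convex_StdSimplex n) (convex_prism n) (prismSlice n t) := by
  intro m p
  ext1 x
  apply Subtype.ext
  change ((∑ i, x i • ((p i : StdSimplex n) : Fin (n + 1) → ℝ)), (t : ℝ)) =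
    ∑ i, x i • (((p i : StdSimplex n) : Fin (n + 1) → ℝ), (t : ℝ))
  ext1
  · simp [Prod.fst_sum]
  · simp [Prod.snd_sum, ← Finset.sum_mul]

theorem isAffineMap_prismFace (n : ℕ) (i : Fin (n + 2)) :
    IsAffineMap (convex_prism n) (convex_prism (n + 1)) (prismFace n i) := by
  intro m p
  ext1 x
  apply Subtype.ext
  have stdFace_affine := congrArg (fun f => (f x : Fin (n + 2) → ℝ))
    (isAffineMap_stdFace n i m fun j => ⟨(p j).1.1, (p j).2.1⟩)
  refine Prod.ext ?_ ?_
  · refine Eq.trans ?_ (stdFace_affine.trans ?_)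
    · change ((stdFace n i _ : StdSimplex (n + 1)) : Fin (n + 2) → ℝ) =
        ((stdFace n i _ : StdSimplex (n + 1)) : Fin (n + 2) → ℝ)
      congr 2
      apply Subtype.ext
      simp [affineSimplex_apply, Prod.fst_sum]
    · simp only [affineSimplex_apply, Prod.fst_sum, Prod.smul_fst]
      rfl
  · change (affineSimplex (convex_prism n) p x).1.2 = _
    simp only [affineSimplex_apply, Prod.snd_sum, Prod.smul_snd]
    rfl

/-! ### Barycentric subdivision -/

section Subdivision

variable {V : Type u} [AddCommGroup V] [Module ℝ V] [TopologicalSpace V] [ContinuousAdd V]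
  [ContinuousSMul ℝ V] {K : Set V} (hK : Convex ℝ K)
  {V' : Type w} [AddCommGroup V'] [Module ℝ V'] [TopologicalSpace V'] [ContinuousAdd V']
  [ContinuousSMul ℝ V'] {K' : Set V'} {hK' : Convex ℝ K'}

/-- The barycentric subdivision of chains of tuples of points of a convex set. -/
def barySubdiv (n : ℕ) : TupleChain n K →ₗ[ℤ] TupleChain n K := tupleSubdiv (tupleBarycenter hK) n

/-- The chain homotopy between the identity and `barySubdiv`. -/
def barySubdivHomotopy (n : ℕ) : TupleChain n K →ₗ[ℤ] TupleChain (n + 1) K :=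
  coneHomotopy (fun _ => LinearMap.id) (barySubdiv hK) (tupleBarycenter hK) n

theorem tupleBoundary_barySubdiv (n : ℕ) (c : TupleChain (n + 1) K) :
    tupleBoundary n (barySubdiv hK (n + 1) c) = barySubdiv hK n (tupleBoundary n c) :=
  tupleBoundary_tupleSubdiv _ n c

theorem tupleBoundary_barySubdivHomotopy_zero (c : TupleChain 0 K) :
    tupleBoundary 0 (barySubdivHomotopy hK 0 c) = c - barySubdiv hK 0 c :=
  tupleBoundary_coneHomotopy_zero (tupleBarycenter hK) (F := fun _ => LinearMap.id)
    (G := barySubdiv hK) (fun _ => rfl) c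

theorem tupleBoundary_barySubdivHomotopy (n : ℕ) (c : TupleChain (n + 1) K) :
    tupleBoundary (n + 1) (barySubdivHomotopy hK (n + 1) c) =
      c - barySubdiv hK (n + 1) c - barySubdivHomotopy hK n (tupleBoundary n c) :=
  tupleBoundary_coneHomotopy (tupleBarycenter hK) (F := fun _ => LinearMap.id) (G := barySubdiv hK)
    (fun _ => rfl) (fun _ _ => rfl) (tupleBoundary_barySubdiv hK) n c

variable {hK}

theorem barySubdiv_tupleMap {a : C(K, K')} (ha : IsAffineMap hK hK' a) (n : ℕ)
    (c : TupleChain n K) :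
    barySubdiv hK' n (tupleMap a n c) = tupleMap a n (barySubdiv hK n c) :=
  tupleSubdiv_tupleMap (tupleBarycenter hK) a (fun m p => ha.tupleBarycenter m p) n c

theorem barySubdivHomotopy_tupleMap {a : C(K, K')} (ha : IsAffineMap hK hK' a) (n : ℕ)
    (c : TupleChain n K) :
    barySubdivHomotopy hK' n (tupleMap a n c) = tupleMap a (n + 1) (barySubdivHomotopy hK n c) :=
  coneHomotopy_tupleMap (tupleBarycenter hK) (F := fun _ => LinearMap.id) (G := barySubdiv hK)
    (F' := fun _ => LinearMap.id) (G' := barySubdiv hK') (b' := tupleBarycenter hK') _ _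
    (fun _ _ => rfl) (barySubdiv_tupleMap ha) (fun m p => ha.tupleBarycenter m p) n c

variable {E : Type v} [TopologicalSpace E]

/-- The barycentric subdivision of singular chains, the push-forward of the subdivision of the
standard simplex. -/
def subdivide (n : ℕ) : SingChain n E →ₗ[ℤ] SingChain n E :=
  Finsupp.linearCombination ℤ fun σ =>
    pushforward σ n (realize (convex_StdSimplex n) n
      (barySubdiv (convex_StdSimplex n) n (Finsupp.single (stdVertices n) 1)))

/-- The chain homotopy between the identity and `subdivide`. -/
def subdivideHomotopy (n : ℕ) : SingChain n E →ₗ[ℤ] SingChain (n + 1) E :=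
  Finsupp.linearCombination ℤ fun σ =>
    pushforward σ (n + 1) (realize (convex_StdSimplex n) (n + 1)
      (barySubdivHomotopy (convex_StdSimplex n) n (Finsupp.single (stdVertices n) 1)))

theorem subdivide_single (n : ℕ) (σ : SingSimplex n E) :
    subdivide n (Finsupp.single σ 1) =
      pushforward σ n (realize (convex_StdSimplex n) n
        (barySubdiv (convex_StdSimplex n) n (Finsupp.single (stdVertices n) 1))) := by
  simp [subdivide]

theorem subdivideHomotopy_single (n : ℕ) (σ : SingSimplex n E) :
    subdivideHomotopy n (Finsupp.single σ 1) =
      pushforward σ (n + 1) (realize (convex_StdSimplex n) (n + 1)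
        (barySubdivHomotopy (convex_StdSimplex n) n (Finsupp.single (stdVertices n) 1))) := by
  simp [subdivideHomotopy]

theorem tupleBoundary_stdVertices (n : ℕ) :
    tupleBoundary n (Finsupp.single (stdVertices (n + 1)) 1) =
      ∑ i : Fin (n + 2),
        (-1 : ℤ) ^ (i : ℕ) • tupleMap (stdFace n i) n (Finsupp.single (stdVertices n) 1) := by
  simp only [tupleBoundary_single, tupleMap_single, stdFace_comp_stdVertices]

theorem boundary_subdivide (n : ℕ) (c : SingChain (n + 1) E) :
    boundary n (subdivide (n + 1) c) = subdivide n (boundary n c) := by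
  refine apply_eq_of_apply_single (boundary n ∘ₗ subdivide (n + 1)) (subdivide n ∘ₗ boundary n)
    (fun σ => ?_) c
  simp only [LinearMap.comp_apply, subdivide_single, boundary_pushforward, boundary_realize,
    tupleBoundary_barySubdiv, tupleBoundary_stdVertices, map_sum, map_zsmul, boundary_single,
    barySubdiv_tupleMap (isAffineMap_stdFace n _), ← (isAffineMap_stdFace n _).pushforward_realize,
    pushforward_comp]

theorem boundary_subdivideHomotopy_zero (c : SingChain 0 E) :
    boundary 0 (subdivideHomotopy 0 c) = c - subdivide 0 c := by
  refine apply_eq_of_apply_single (boundary 0 ∘ₗ subdivideHomotopy 0) (LinearMap.id - subdivide 0)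
    (fun σ => ?_) c
  simp only [LinearMap.comp_apply, LinearMap.sub_apply, LinearMap.id_apply, subdivide_single,
    subdivideHomotopy_single, boundary_pushforward, boundary_realize]
  rw [tupleBoundary_barySubdivHomotopy_zero]
  simp [realize_single, affineSimplex_stdVertices, pushforward_single]

theorem boundary_subdivideHomotopy (n : ℕ) (c : SingChain (n + 1) E) :
    boundary (n + 1) (subdivideHomotopy (n + 1) c) =
      c - subdivide (n + 1) c - subdivideHomotopy n (boundary n c) := by
  refine apply_eq_of_apply_single (boundary (n + 1) ∘ₗ subdivideHomotopy (n + 1))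
    (LinearMap.id - subdivide (n + 1) - subdivideHomotopy n ∘ₗ boundary n) (fun σ => ?_) c
  simp only [LinearMap.comp_apply, LinearMap.sub_apply, LinearMap.id_apply, subdivide_single,
    subdivideHomotopy_single, boundary_pushforward, boundary_realize]
  rw [tupleBoundary_barySubdivHomotopy]
  simp only [map_sub, tupleBoundary_stdVertices, map_sum, map_zsmul,
    barySubdivHomotopy_tupleMap (isAffineMap_stdFace n _),
    ← (isAffineMap_stdFace n _).pushforward_realize, boundary_single, subdivideHomotopy_single,
    pushforward_comp]
  simp [realize_single, affineSimplex_stdVertices, pushforward_single]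

theorem subdivide_pushforward {E' : Type w} [TopologicalSpace E'] (f : C(E, E')) (n : ℕ)
    (c : SingChain n E) :
    subdivide n (pushforward f n c) = pushforward f n (subdivide n c) :=
  apply_eq_of_apply_single (subdivide n ∘ₗ pushforward f n) (pushforward f n ∘ₗ subdivide n)
    (fun σ => by simp [pushforward_single, subdivide_single, pushforward_comp]) c

theorem subdivide_realize (hK : Convex ℝ K) (n : ℕ) (c : TupleChain n K) :
    subdivide n (realize hK n c) = realize hK n (barySubdiv hK n c) := by
  refine apply_eq_of_apply_single (subdivide n ∘ₗ realize hK n) (realize hK n ∘ₗ barySubdiv hK n)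
    (fun p => ?_) c
  simp only [LinearMap.comp_apply, realize_single, subdivide_single]
  rw [(isAffineMap_affineSimplex hK p).pushforward_realize,
    ← barySubdiv_tupleMap (isAffineMap_affineSimplex hK p), tupleMap_single,
    affineSimplex_comp_stdVertices]

end Subdivision

/-! ### The prism operator -/

section PrismOperator

/-- The prism operator on tuples of vertices, built by coning off. -/
def prismTuples (n : ℕ) : TupleChain n (StdSimplex n) →ₗ[ℤ] TupleChain (n + 1) (Prism n) :=
  coneHomotopy (tupleMap (prismSlice n 1)) (tupleMap (prismSlice n 0))
    (fun m p => prismSlice n 0 (tupleBarycenter (convex_StdSimplex n) m p)) n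

variable {E : Type u} {E' : Type v} [TopologicalSpace E] [TopologicalSpace E']

/-- The prism operator on singular chains determined by a family `F` of homotopies, one for every
singular simplex. It is a chain homotopy between the two ends of `F` when `F` is compatible with
faces. -/
def prismOperator (F : ∀ n, SingSimplex n E → C(Prism n, E')) (n : ℕ) :
    SingChain n E →ₗ[ℤ] SingChain (n + 1) E' :=
  Finsupp.linearCombination ℤ fun σ =>
    pushforward (F n σ) (n + 1) (realize (convex_prism n) (n + 1)
      (prismTuples n (Finsupp.single (stdVertices n) 1)))

/-- The operator on singular chains given by the slice at time `t` of a family of homotopies. -/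
def prismEnd (F : ∀ n, SingSimplex n E → C(Prism n, E')) (t : unitInterval) (n : ℕ) :
    SingChain n E →ₗ[ℤ] SingChain n E' :=
  Finsupp.lmapDomain ℤ ℤ fun σ => (F n σ).comp (prismSlice n t)

variable (F : ∀ n, SingSimplex n E → C(Prism n, E'))

theorem prismOperator_single (n : ℕ) (σ : SingSimplex n E) :
    prismOperator F n (Finsupp.single σ 1) =
      pushforward (F n σ) (n + 1)
        (realize (convex_prism n) (n + 1) (prismTuples n (Finsupp.single (stdVertices n) 1))) := by
  simp [prismOperator]

theorem prismEnd_single (t : unitInterval) (n : ℕ) (σ : SingSimplex n E) (a : ℤ) :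
    prismEnd F t n (Finsupp.single σ a) = Finsupp.single ((F n σ).comp (prismSlice n t)) a := by
  simp [prismEnd]

theorem realize_prismSlice (t : unitInterval) (n : ℕ) (G : C(Prism n, E')) :
    pushforward G n
        (realize (convex_prism n) n
          (tupleMap (prismSlice n t) n (Finsupp.single (stdVertices n) 1))) =
      Finsupp.single (G.comp (prismSlice n t)) 1 := by
  rw [← (isAffineMap_prismSlice n t).pushforward_realize]
  simp [realize_single, affineSimplex_stdVertices, pushforward_single]

theorem boundary_prismOperator_zero (c : SingChain 0 E) :
    boundary 0 (prismOperator F 0 c) = prismEnd F 1 0 c - prismEnd F 0 0 c := by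
  refine apply_eq_of_apply_single (boundary 0 ∘ₗ prismOperator F 0)
    (prismEnd F 1 0 - prismEnd F 0 0) (fun σ => ?_) c
  simp only [LinearMap.comp_apply, LinearMap.sub_apply, prismOperator_single, boundary_pushforward,
    boundary_realize, prismTuples]
  rw [tupleBoundary_coneHomotopy_zero _ fun c => by
    rw [augmentation_tupleMap, augmentation_tupleMap]]
  simp only [map_sub, realize_prismSlice, prismEnd_single]

theorem coneHomotopy_prismSlice_stdFace (n : ℕ) (i : Fin (n + 2)) :
    coneHomotopy (tupleMap (prismSlice (n + 1) 1)) (tupleMap (prismSlice (n + 1) 0))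
        (fun m p => prismSlice (n + 1) 0 (tupleBarycenter (convex_StdSimplex (n + 1)) m p)) n
        (tupleMap (stdFace n i) n (Finsupp.single (stdVertices n) 1)) =
      tupleMap (prismFace n i) (n + 1) (prismTuples n (Finsupp.single (stdVertices n) 1)) := by
  have slice_face : ∀ (t : unitInterval) (m : ℕ) (c : TupleChain m (StdSimplex n)),
      tupleMap (prismSlice (n + 1) t) m (tupleMap (stdFace n i) m c) =
        tupleMap (prismFace n i) m (tupleMap (prismSlice n t) m c) := fun t m =>
    apply_eq_of_apply_single (tupleMap (prismSlice (n + 1) t) m ∘ₗ tupleMap (stdFace n i) m)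
      (tupleMap (prismFace n i) m ∘ₗ tupleMap (prismSlice n t) m)
      fun p => by simp only [LinearMap.comp_apply, tupleMap_single]; rfl
  refine coneHomotopy_tupleMap _ _ _ (slice_face 1) (slice_face 0) (fun m p => ?_) n _
  rw [(isAffineMap_stdFace n i).tupleBarycenter]
  rfl

theorem boundary_prismOperator
    (hF : ∀ n (σ : SingSimplex (n + 1) E) i,
      F n (σ.comp (stdFace n i)) = (F (n + 1) σ).comp (prismFace n i))
    (n : ℕ) (c : SingChain (n + 1) E) :
    boundary (n + 1) (prismOperator F (n + 1) c) =
      prismEnd F 1 (n + 1) c - prismEnd F 0 (n + 1) c - prismOperator F n (boundary n c) := by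
  refine apply_eq_of_apply_single (boundary (n + 1) ∘ₗ prismOperator F (n + 1))
    (prismEnd F 1 (n + 1) - prismEnd F 0 (n + 1) - prismOperator F n ∘ₗ boundary n) (fun σ => ?_) c
  simp only [LinearMap.comp_apply, LinearMap.sub_apply, prismOperator_single, boundary_pushforward,
    boundary_realize]
  rw [prismTuples, tupleBoundary_coneHomotopy _
    (fun c => by rw [augmentation_tupleMap, augmentation_tupleMap])
    (fun n c => tupleBoundary_tupleMap _ n c) (fun n c => tupleBoundary_tupleMap _ n c)]
  simp only [map_sub, realize_prismSlice, prismEnd_single, tupleBoundary_stdVertices, map_sum,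
    map_zsmul, coneHomotopy_prismSlice_stdFace, ← (isAffineMap_prismFace n _).pushforward_realize,
    boundary_single, prismOperator_single, hF, pushforward_comp]

end PrismOperator

/-! ### Supports of singular chains -/

section Supports

theorem map_mem_of_supported {α M : Type*} [AddCommGroup M] (L : (α →₀ ℤ) →ₗ[ℤ] M)
    (N : Submodule ℤ M) {s : Set α} (h : ∀ a ∈ s, L (Finsupp.single a 1) ∈ N) {c : α →₀ ℤ}
    (hc : c ∈ Finsupp.supported ℤ ℤ s) :
    L c ∈ N := by
  rw [Finsupp.supported_eq_span_single] at hc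
  have span_le_comap : Submodule.span ℤ ((fun i => Finsupp.single i (1 : ℤ)) '' s) ≤ N.comap L :=
    Submodule.span_le.2 (by rintro _ ⟨a, ha, rfl⟩; exact h a ha)
  exact span_le_comap hc

variable {E : Type u} [TopologicalSpace E] {E' : Type v} [TopologicalSpace E']

/-- The singular chains whose simplices lie in `A`. Subspaces are treated as sets of chains of the
ambient space, so that no push-forward along an inclusion is needed. -/
def chainsWithin (A : Set E) (n : ℕ) : Submodule ℤ (SingChain n E) :=
  Finsupp.supported ℤ ℤ {σ : SingSimplex n E | ∀ x, σ x ∈ A}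

/-- The singular chains whose simplices each lie in one of the sets `U i`, the chains to which
excision applies when `U` is a cover. -/
def smallChains {ι : Type*} (U : ι → Set E) (n : ℕ) : Submodule ℤ (SingChain n E) :=
  Finsupp.supported ℤ ℤ {σ : SingSimplex n E | ∃ i, ∀ x, σ x ∈ U i}

theorem single_mem_chainsWithin {A : Set E} {n : ℕ} {σ : SingSimplex n E} (h : ∀ x, σ x ∈ A)
    (a : ℤ) : Finsupp.single σ a ∈ chainsWithin A n :=
  Finsupp.single_mem_supported ℤ a h

theorem chainsWithin_mono {A B : Set E} (h : A ⊆ B) (n : ℕ) : chainsWithin A n ≤ chainsWithin B n :=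
  Finsupp.supported_mono fun _ hσ x => h (hσ x)

theorem mem_chainsWithin_univ {n : ℕ} (c : SingChain n E) : c ∈ chainsWithin Set.univ n :=
  fun _ _ _ => Set.mem_univ _

theorem pushforward_mem_chainsWithin {f : C(E, E')} {A : Set E} {B : Set E'} (h : Set.MapsTo f A B)
    {n : ℕ} {c : SingChain n E} (hc : c ∈ chainsWithin A n) :
    pushforward f n c ∈ chainsWithin B n :=
  map_mem_of_supported _ _ (fun σ hσ => by
    rw [pushforward_single]
    exact single_mem_chainsWithin (fun x => h (hσ x)) 1) hc

theorem pushforward_mem_chainsWithin_of_forall {f : C(E, E')} {B : Set E'} (h : ∀ x, f x ∈ B)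
    {n : ℕ} (c : SingChain n E) :
    pushforward f n c ∈ chainsWithin B n :=
  pushforward_mem_chainsWithin (fun x _ => h x) (mem_chainsWithin_univ c)

theorem boundary_mem_chainsWithin {A : Set E} {n : ℕ} {c : SingChain (n + 1) E}
    (hc : c ∈ chainsWithin A (n + 1)) :
    boundary n c ∈ chainsWithin A n :=
  map_mem_of_supported _ _ (fun σ hσ => by
    rw [boundary_single]
    exact Submodule.sum_mem _ fun i _ => Submodule.smul_mem _ _
      (single_mem_chainsWithin (σ := σ.comp (stdFace n i)) (fun x => hσ _) 1)) hc

theorem subdivide_mem_chainsWithin {A : Set E} {n : ℕ} {c : SingChain n E}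
    (hc : c ∈ chainsWithin A n) :
    subdivide n c ∈ chainsWithin A n :=
  map_mem_of_supported _ _ (fun σ hσ => by
    rw [subdivide_single]
    exact pushforward_mem_chainsWithin_of_forall hσ _) hc

theorem subdivideHomotopy_mem_chainsWithin {A : Set E} {n : ℕ} {c : SingChain n E}
    (hc : c ∈ chainsWithin A n) :
    subdivideHomotopy n c ∈ chainsWithin A (n + 1) :=
  map_mem_of_supported _ _ (fun σ hσ => by
    rw [subdivideHomotopy_single]
    exact pushforward_mem_chainsWithin_of_forall hσ _) hc

theorem subdivide_mem_smallChains {ι : Type*} {U : ι → Set E} {n : ℕ} {c : SingChain n E}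
    (hc : c ∈ smallChains U n) :
    subdivide n c ∈ smallChains U n :=
  map_mem_of_supported _ _ (fun σ hσ => by
    obtain ⟨i, hi⟩ := hσ
    rw [subdivide_single]
    have within_le_small : chainsWithin (U i) n ≤ smallChains U n :=
      Finsupp.supported_mono fun τ hτ => ⟨i, hτ⟩
    exact within_le_small (pushforward_mem_chainsWithin_of_forall hi _)) hc

theorem exists_pushforward_eq {f : C(E, E')} (hf : Topology.IsInducing f) {n : ℕ}
    {c : SingChain n E'} (hc : c ∈ chainsWithin (Set.range f) n) :
    ∃ b : SingChain n E, pushforward f n b = c := by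
  refine map_mem_of_supported LinearMap.id (LinearMap.range (pushforward f n)) (fun σ hσ => ?_) hc
  choose g hg using hσ
  have g_continuous : Continuous g := hf.continuous_iff.2 (by
    convert σ.continuous
    exact funext hg)
  refine ⟨Finsupp.single ⟨g, g_continuous⟩ 1, ?_⟩
  rw [pushforward_single]
  congr 1
  ext x
  exact hg x

theorem pushforward_injective {f : C(E, E')} (hf : Function.Injective f) (n : ℕ) :
    Function.Injective (pushforward f n) :=
  Finsupp.mapDomain_injective fun σ τ h => by
    ext x
    exact hf (DFunLike.congr_fun h x)

theorem mem_chainsWithin_of_pushforward {f : C(E, E')} (hf : Function.Injective f) {n : ℕ}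
    {c : SingChain n E} {B : Set E'} (hc : pushforward f n c ∈ chainsWithin B n) :
    c ∈ chainsWithin (f ⁻¹' B) n := by
  intro σ hσ x
  have hinj : Function.Injective fun σ : SingSimplex n E => f.comp σ := fun σ τ h => by
    ext x
    exact hf (DFunLike.congr_fun h x)
  refine hc (a := f.comp σ) ?_ x
  simp only [pushforward, Finsupp.lmapDomain_apply, Finset.mem_coe, Finsupp.mem_support_iff] at hσ ⊢
  rw [Finsupp.mapDomain_apply hinj]
  exact hσ

end Supports

/-! ### Relative cycles and boundaries of pairs of subspaces -/

section Pairs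

variable {E : Type u} [TopologicalSpace E] {E' : Type v} [TopologicalSpace E']

/-- The boundary as a map out of every degree, zero in degree `0` (where `k - 1` is again `0`): it
lets relative cycles be treated uniformly in all degrees. -/
def boundaryPred : ∀ k, SingChain k E →ₗ[ℤ] SingChain (k - 1) E
  | 0 => 0
  | k + 1 => boundary k

theorem boundaryPred_pushforward (f : C(E, E')) (k : ℕ) (c : SingChain k E) :
    boundaryPred k (pushforward f k c) = pushforward f (k - 1) (boundaryPred k c) := by
  cases k with
  | zero => simp [boundaryPred]
  | succ k => exact boundary_pushforward f k c

theorem boundaryPred_subdivide (k : ℕ) (c : SingChain k E) :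
    boundaryPred k (subdivide k c) = subdivide (k - 1) (boundaryPred k c) := by
  cases k with
  | zero => simp [boundaryPred]
  | succ k => exact boundary_subdivide k c

theorem boundaryPred_mem_chainsWithin {A : Set E} {k : ℕ} {c : SingChain k E}
    (hc : c ∈ chainsWithin A k) :
    boundaryPred k c ∈ chainsWithin A (k - 1) := by
  cases k with
  | zero => simp [boundaryPred]
  | succ k => exact boundary_mem_chainsWithin hc

/-- The relative singular cycles of the pair `(S, A)` of subspaces of `E`. Only `S ∩ A` matters for
the homology of the pair; `A ⊆ S` is not assumed. -/
def pairCycles (S A : Set E) (k : ℕ) : Submodule ℤ (SingChain k E) :=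
  chainsWithin S k ⊓ (chainsWithin A (k - 1)).comap (boundaryPred k)

/-- The relative singular boundaries of the pair `(S, A)` of subspaces of `E`. -/
def pairBoundaries (S A : Set E) (k : ℕ) : Submodule ℤ (SingChain k E) :=
  (chainsWithin S (k + 1)).map (boundary k) ⊔ chainsWithin A k

theorem mem_pairCycles {S A : Set E} {k : ℕ} {c : SingChain k E} :
    c ∈ pairCycles S A k ↔ c ∈ chainsWithin S k ∧ boundaryPred k c ∈ chainsWithin A (k - 1) :=
  Iff.rfl

theorem mem_pairBoundaries {S A : Set E} {k : ℕ} {c : SingChain k E} :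
    c ∈ pairBoundaries S A k ↔
      ∃ b ∈ chainsWithin S (k + 1), ∃ a ∈ chainsWithin A k, boundary k b + a = c := by
  simp [pairBoundaries, Submodule.mem_sup]

theorem pairCycles_mono {S A S' A' : Set E} (hS : S ⊆ S') (hA : A ⊆ A') (k : ℕ) :
    pairCycles S A k ≤ pairCycles S' A' k :=
  fun _ hc => ⟨chainsWithin_mono hS k hc.1, chainsWithin_mono hA _ hc.2⟩

theorem pairBoundaries_mono {S A S' A' : Set E} (hS : S ⊆ S') (hA : A ⊆ A') (k : ℕ) :
    pairBoundaries S A k ≤ pairBoundaries S' A' k :=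
  sup_le_sup (Submodule.map_mono (chainsWithin_mono hS _)) (chainsWithin_mono hA _)

theorem pushforward_mem_pairCycles {f : C(E, E')} {S A : Set E} {S' A' : Set E'}
    (hS : Set.MapsTo f S S') (hA : Set.MapsTo f A A') {k : ℕ} {c : SingChain k E}
    (hc : c ∈ pairCycles S A k) :
    pushforward f k c ∈ pairCycles S' A' k :=
  ⟨pushforward_mem_chainsWithin hS hc.1, by
    change boundaryPred k (pushforward f k c) ∈ chainsWithin A' (k - 1)
    rw [boundaryPred_pushforward]
    exact pushforward_mem_chainsWithin hA hc.2⟩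

/-- The map on relative cycles induced by a map of pairs. -/
def pairCyclesMap {f : C(E, E')} {S A : Set E} {S' A' : Set E'} (hS : Set.MapsTo f S S')
    (hA : Set.MapsTo f A A') (k : ℕ) : pairCycles S A k →ₗ[ℤ] pairCycles S' A' k :=
  (pushforward f k).restrict fun _ => pushforward_mem_pairCycles hS hA

theorem pushforward_mem_pairBoundaries {f : C(E, E')} {S A : Set E} {S' A' : Set E'}
    (hS : Set.MapsTo f S S') (hA : Set.MapsTo f A A') {k : ℕ} {c : SingChain k E}
    (hc : c ∈ pairBoundaries S A k) :
    pushforward f k c ∈ pairBoundaries S' A' k := by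
  obtain ⟨b, hb, a, ha, rfl⟩ := mem_pairBoundaries.1 hc
  exact mem_pairBoundaries.2 ⟨_, pushforward_mem_chainsWithin hS hb, _,
    pushforward_mem_chainsWithin hA ha, by rw [map_add, boundary_pushforward]⟩

theorem subdivide_mem_pairCycles {S A : Set E} {k : ℕ} {c : SingChain k E}
    (hc : c ∈ pairCycles S A k) :
    subdivide k c ∈ pairCycles S A k :=
  ⟨subdivide_mem_chainsWithin hc.1, by
    change boundaryPred k (subdivide k c) ∈ chainsWithin A (k - 1)
    rw [boundaryPred_subdivide]
    exact subdivide_mem_chainsWithin hc.2⟩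

theorem sub_subdivide_mem_pairBoundaries {S A : Set E} {k : ℕ} {c : SingChain k E}
    (hc : c ∈ pairCycles S A k) :
    c - subdivide k c ∈ pairBoundaries S A k := by
  cases k with
  | zero =>
    exact mem_pairBoundaries.2
      ⟨subdivideHomotopy 0 c, subdivideHomotopy_mem_chainsWithin hc.1, 0, zero_mem _,
        by rw [boundary_subdivideHomotopy_zero, add_zero]⟩
  | succ k =>
    exact mem_pairBoundaries.2
      ⟨subdivideHomotopy (k + 1) c, subdivideHomotopy_mem_chainsWithin hc.1,
        subdivideHomotopy k (boundary k c), subdivideHomotopy_mem_chainsWithin hc.2,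
        by rw [boundary_subdivideHomotopy, sub_add_cancel]⟩

theorem subdivide_iterate_mem_pairCycles {S A : Set E} {k : ℕ} {c : SingChain k E}
    (hc : c ∈ pairCycles S A k) (m : ℕ) :
    (subdivide k)^[m] c ∈ pairCycles S A k := by
  induction m with
  | zero => exact hc
  | succ m ih =>
    rw [Function.iterate_succ_apply']
    exact subdivide_mem_pairCycles ih

theorem sub_subdivide_iterate_mem_pairBoundaries {S A : Set E} {k : ℕ} {c : SingChain k E}
    (hc : c ∈ pairCycles S A k) (m : ℕ) :
    c - (subdivide k)^[m] c ∈ pairBoundaries S A k := by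
  induction m with
  | zero => simp
  | succ m ih =>
    rw [Function.iterate_succ_apply']
    simpa only [sub_add_sub_cancel] using
      add_mem ih (sub_subdivide_mem_pairBoundaries (subdivide_iterate_mem_pairCycles hc m))

theorem prismOperator_mem_chainsWithin {F : ∀ n, SingSimplex n E → C(Prism n, E')} {A : Set E}
    {A' : Set E'} {n : ℕ} (hA : ∀ σ : SingSimplex n E, (∀ x, σ x ∈ A) → ∀ z, F n σ z ∈ A')
    {c : SingChain n E} (hc : c ∈ chainsWithin A n) :
    prismOperator F n c ∈ chainsWithin A' (n + 1) :=
  map_mem_of_supported _ _ (fun σ hσ => by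
    rw [prismOperator_single]
    exact pushforward_mem_chainsWithin_of_forall (hA σ hσ) _) hc

theorem prismEnd_sub_mem_pairBoundaries {F : ∀ n, SingSimplex n E → C(Prism n, E')}
    (hF : ∀ n (σ : SingSimplex (n + 1) E) i,
      F n (σ.comp (stdFace n i)) = (F (n + 1) σ).comp (prismFace n i))
    {S A : Set E'} {k : ℕ} {c : SingChain k E} (hS : prismOperator F k c ∈ chainsWithin S (k + 1))
    (hA : prismOperator F (k - 1) (boundaryPred k c) ∈ chainsWithin A (k - 1 + 1)) :
    prismEnd F 1 k c - prismEnd F 0 k c ∈ pairBoundaries S A k := by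
  cases k with
  | zero =>
    exact mem_pairBoundaries.2
      ⟨prismOperator F 0 c, hS, 0, zero_mem _, by rw [boundary_prismOperator_zero, add_zero]⟩
  | succ k =>
    exact mem_pairBoundaries.2
      ⟨prismOperator F (k + 1) c, hS, prismOperator F k (boundary k c), hA,
        by rw [boundary_prismOperator F hF, sub_add_cancel]⟩

/-- The homotopy `f` precomposed with the singular simplex `σ`, as a map of the prism over the
simplex: the family to which `prismOperator` is applied for a homotopy of maps. -/
def homotopyOnSimplex (f : C(unitInterval × E, E')) (n : ℕ) (σ : SingSimplex n E) :
    C(Prism n, E') :=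
  ⟨fun z => f (⟨z.1.2, z.2.2⟩, σ ⟨z.1.1, z.2.1⟩), by fun_prop⟩

/-- The map at time `t` of the homotopy `f`. -/
def homotopyAt (f : C(unitInterval × E, E')) (t : unitInterval) : C(E, E') :=
  ⟨fun x => f (t, x), by fun_prop⟩

theorem prismEnd_homotopyOnSimplex (f : C(unitInterval × E, E')) (t : unitInterval) (n : ℕ) :
    prismEnd (homotopyOnSimplex f) t n = pushforward (homotopyAt f t) n :=
  rfl

theorem pushforward_sub_mem_pairBoundaries {f : C(unitInterval × E, E')} {S A : Set E}
    {S' A' : Set E'} (hS : ∀ t, ∀ x ∈ S, f (t, x) ∈ S') (hA : ∀ t, ∀ x ∈ A, f (t, x) ∈ A') {k : ℕ}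
    {c : SingChain k E} (hc : c ∈ pairCycles S A k) :
    pushforward (homotopyAt f 1) k c - pushforward (homotopyAt f 0) k c ∈
      pairBoundaries S' A' k := by
  rw [← prismEnd_homotopyOnSimplex, ← prismEnd_homotopyOnSimplex]
  exact prismEnd_sub_mem_pairBoundaries (fun n σ i => rfl)
    (prismOperator_mem_chainsWithin (fun σ hσ z => hS _ _ (hσ _)) hc.1)
    (prismOperator_mem_chainsWithin (fun σ hσ z => hA _ _ (hσ _)) hc.2)

end Pairs

/-! ### Iterated subdivisions are small -/

section Small

variable {V : Type u} [NormedAddCommGroup V] [NormedSpace ℝ V] {K : Set V}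

theorem dist_tupleBarycenter_le (hK : Convex ℝ K) {n : ℕ} {p : Fin (n + 1) → K} {d : ℝ}
    (hd : ∀ i j, dist (p i) (p j) ≤ d) (j : Fin (n + 1)) :
    dist (p j : V) (tupleBarycenter hK n p) ≤ (n : ℝ) / (n + 1) * d := by
  have coord_barycenter : ∀ i,
      (stdSimplex.barycenter : stdSimplex ℝ (Fin (n + 1))) i = ((n : ℝ) + 1)⁻¹ :=
    fun i => (stdSimplex.barycenter_apply i).trans (by simp)
  have sub_eq_average :
      (p j : V) - tupleBarycenter hK n p = ∑ i, ((n : ℝ) + 1)⁻¹ • ((p j : V) - p i) := by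
    simp only [smul_sub, Finset.sum_sub_distrib, Finset.sum_const, Finset.card_univ,
      Fintype.card_fin, tupleBarycenter, affineSimplex_apply, coord_barycenter,
      ← Nat.cast_smul_eq_nsmul ℝ, smul_smul]
    push_cast
    rw [mul_inv_cancel₀ (by positivity), one_smul]
  have norm_term_le : ∀ i, ‖((n : ℝ) + 1)⁻¹ • ((p j : V) - p i)‖ ≤ ((n : ℝ) + 1)⁻¹ * d := by
    intro i
    rw [norm_smul, Real.norm_of_nonneg (by positivity), ← dist_eq_norm]
    exact mul_le_mul_of_nonneg_left (hd j i) (by positivity)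
  calc dist (p j : V) (tupleBarycenter hK n p)
      ≤ ∑ i, ‖((n : ℝ) + 1)⁻¹ • ((p j : V) - p i)‖ := by
        rw [dist_eq_norm, sub_eq_average]
        exact norm_sum_le _ _
    _ = ∑ i ∈ Finset.univ.erase j, ‖((n : ℝ) + 1)⁻¹ • ((p j : V) - p i)‖ := by
        rw [← Finset.sum_erase_add _ _ (Finset.mem_univ j), sub_self, smul_zero, norm_zero,
          add_zero]
    _ ≤ (Finset.univ.erase j).card • (((n : ℝ) + 1)⁻¹ * d) :=
        Finset.sum_le_card_nsmul _ _ _ fun i _ => norm_term_le i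
    _ = (n : ℝ) / (n + 1) * d := by
        rw [Finset.card_erase_of_mem (Finset.mem_univ j), Finset.card_univ, Fintype.card_fin,
          nsmul_eq_mul, Nat.add_sub_cancel]
        ring

theorem tupleBarycenter_mem_convexHull (hK : Convex ℝ K) {n : ℕ} (p : Fin (n + 1) → K) :
    (tupleBarycenter hK n p : V) ∈ convexHull ℝ (Set.range fun j => (p j : V)) :=
  (convex_convexHull ℝ _).sum_mem
    (fun i _ => (stdSimplex.barycenter : stdSimplex ℝ (Fin (n + 1))).2.1 i)
    (stdSimplex.barycenter : stdSimplex ℝ (Fin (n + 1))).2.2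
    fun i _ => subset_convexHull _ _ ⟨i, rfl⟩

theorem dist_tupleBarycenter_le_of_mem_convexHull (hK : Convex ℝ K) {n : ℕ} {p : Fin (n + 1) → K}
    {d : ℝ} (hd : ∀ i j, dist (p i) (p j) ≤ d) {y : V}
    (hy : y ∈ convexHull ℝ (Set.range fun j => (p j : V))) :
    dist y (tupleBarycenter hK n p) ≤ (n : ℝ) / (n + 1) * d :=
  convexHull_min (by rintro _ ⟨j, rfl⟩; exact dist_tupleBarycenter_le hK hd j)
    (convex_closedBall (tupleBarycenter hK n p : V) _) hy

/-- The tuples of points in the convex hull of the points of `p` that are at mutual distance at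
most `r`: the vertices of the simplices of a subdivision of mesh `r`. -/
def fineTuples {m : ℕ} (p : Fin (m + 1) → K) (n : ℕ) (r : ℝ) : Set (Fin (n + 1) → K) :=
  {q | (∀ i, (q i : V) ∈ convexHull ℝ (Set.range fun j => (p j : V))) ∧
    ∀ i j, dist (q i) (q j) ≤ r}

theorem cons_tupleBarycenter_mem_fineTuples (hK : Convex ℝ K) {n : ℕ} {p : Fin (n + 2) → K}
    {d : ℝ} (hd : ∀ i j, dist (p i) (p j) ≤ d) {q : Fin (n + 1) → K}
    (hq : q ∈ fineTuples p n ((n : ℝ) / (n + 1) * d)) :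
    (Fin.cons (tupleBarycenter hK (n + 1) p) q : Fin (n + 2) → K) ∈
      fineTuples p (n + 1) (((n + 1 : ℕ) : ℝ) / ((n + 1 : ℕ) + 1) * d) := by
  have d_nonneg : 0 ≤ d := dist_nonneg.trans (hd 0 0)
  have dist_barycenter_le : ∀ i, dist (q i : V) (tupleBarycenter hK (n + 1) p) ≤
      ((n + 1 : ℕ) : ℝ) / ((n + 1 : ℕ) + 1) * d :=
    fun i => dist_tupleBarycenter_le_of_mem_convexHull hK hd (hq.1 i)
  have ratio_le : (n : ℝ) / (n + 1) ≤ ((n + 1 : ℕ) : ℝ) / ((n + 1 : ℕ) + 1) := by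
    rw [div_le_div_iff₀ (by positivity) (by positivity)]
    push_cast
    nlinarith
  refine ⟨fun i => ?_, fun i j => ?_⟩
  · exact Fin.cases (tupleBarycenter_mem_convexHull hK p) hq.1 i
  · refine Fin.cases ?_ (fun i => ?_) i <;> refine Fin.cases ?_ (fun j => ?_) j
    · rw [dist_self]
      positivity
    · exact (dist_comm _ _).trans_le (dist_barycenter_le j)
    · exact dist_barycenter_le i
    · exact (hq.2 i j).trans (mul_le_mul_of_nonneg_right ratio_le d_nonneg)

theorem barySubdiv_mem_supported_fineTuples (hK : Convex ℝ K) {n : ℕ} {p : Fin (n + 1) → K} {d : ℝ}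
    (hd : ∀ i j, dist (p i) (p j) ≤ d) :
    barySubdiv hK n (Finsupp.single p 1) ∈
      Finsupp.supported ℤ ℤ (fineTuples p n ((n : ℝ) / (n + 1) * d)) := by
  induction n with
  | zero =>
    refine Finsupp.single_mem_supported ℤ _ ⟨fun i => subset_convexHull _ _ ⟨i, rfl⟩, fun i j => ?_⟩
    simp [Subsingleton.elim (α := Fin 1) i j]
  | succ n ih =>
    rw [barySubdiv, tupleSubdiv_succ_single]
    refine map_mem_of_supported _ _ (s := fineTuples p n ((n : ℝ) / (n + 1) * d))
      (fun q hq => ?_) ?_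
    · rw [tupleCone_single]
      exact Finsupp.single_mem_supported ℤ _ (cons_tupleBarycenter_mem_fineTuples hK hd hq)
    · rw [tupleBoundary_single, map_sum]
      refine Submodule.sum_mem _ fun i _ => ?_
      rw [map_zsmul]
      refine Submodule.smul_mem _ _ (Finsupp.supported_mono ?_ (ih fun a b => hd _ _))
      rintro q ⟨mem_hull, dist_le⟩
      refine ⟨fun a => convexHull_mono ?_ (mem_hull a), dist_le⟩
      rintro _ ⟨j, rfl⟩
      exact ⟨i.succAbove j, rfl⟩

theorem barySubdiv_iterate_mem_supported (hK : Convex ℝ K) {n : ℕ} {p : Fin (n + 1) → K} {d : ℝ}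
    (hd : ∀ i j, dist (p i) (p j) ≤ d) (m : ℕ) :
    (barySubdiv hK n)^[m] (Finsupp.single p 1) ∈
      Finsupp.supported ℤ ℤ {q : Fin (n + 1) → K |
        ∀ i j, dist (q i) (q j) ≤ ((n : ℝ) / (n + 1)) ^ m * d} := by
  induction m with
  | zero => exact Finsupp.single_mem_supported ℤ _ (by simpa using hd)
  | succ m ih =>
    rw [Function.iterate_succ_apply']
    refine map_mem_of_supported _ _ (fun q hq => ?_) ih
    refine Finsupp.supported_mono ?_ (barySubdiv_mem_supported_fineTuples hK hq)
    rintro r ⟨-, hr⟩ i j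
    rw [pow_succ', mul_assoc]
    exact hr i j

variable {E : Type v} [TopologicalSpace E]

theorem subdivide_iterate_single (n m : ℕ) (σ : SingSimplex n E) :
    (subdivide n)^[m] (Finsupp.single σ 1) =
      pushforward σ n (realize (convex_StdSimplex n) n
        ((barySubdiv (convex_StdSimplex n) n)^[m] (Finsupp.single (stdVertices n) 1))) := by
  induction m with
  | zero => simp [realize_single, affineSimplex_stdVertices, pushforward_single]
  | succ m ih =>
    rw [Function.iterate_succ_apply', Function.iterate_succ_apply', ih, subdivide_pushforward,
      subdivide_realize]

theorem dist_affineSimplex_le (hK : Convex ℝ K) {n : ℕ} {q : Fin (n + 1) → K} {d : ℝ}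
    (hd : ∀ i j, dist (q i) (q j) ≤ d) (x : StdSimplex n) :
    dist (affineSimplex hK q x) (q 0) ≤ d :=
  (convex_closedBall (q 0 : V) d).sum_mem (fun i _ => x.2.1 i) x.2.2 fun i _ => hd i 0

theorem exists_subdivide_iterate_single_mem_smallChains {ι : Type*} {U : ι → Set E}
    (hU : ∀ i, IsOpen (U i)) {S : Set E} (hS : S ⊆ ⋃ i, U i) {n : ℕ} {σ : SingSimplex n E}
    (hσ : ∀ x, σ x ∈ S) :
    ∃ m, (subdivide n)^[m] (Finsupp.single σ 1) ∈ smallChains (fun i => U i ∩ S) n := by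
  obtain ⟨δ, δ_pos, exists_ball_subset⟩ := lebesgue_number_lemma_of_metric
    (s := (Set.univ : Set (StdSimplex n))) (c := fun i => σ ⁻¹' U i) isCompact_univ
    (fun i => (hU i).preimage σ.continuous) (fun x _ => by simpa using hS (hσ x))
  have dist_vertices_le : ∀ i j, dist (stdVertices n i) (stdVertices n j) ≤
      Metric.diam (Set.univ : Set (StdSimplex n)) := fun i j =>
    Metric.dist_le_diam_of_mem isCompact_univ.isBounded trivial trivial
  have mesh_tendsto : Filter.Tendsto (fun m : ℕ => ((n : ℝ) / (n + 1)) ^ m *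
      Metric.diam (Set.univ : Set (StdSimplex n))) Filter.atTop (nhds (0 * _)) :=
    (tendsto_pow_atTop_nhds_zero_of_lt_one (by positivity)
      ((div_lt_one (by positivity)).2 (by linarith))).mul_const _
  rw [zero_mul] at mesh_tendsto
  obtain ⟨m, hm⟩ := (mesh_tendsto.eventually_lt_const δ_pos).exists
  refine ⟨m, ?_⟩
  rw [subdivide_iterate_single]
  refine map_mem_of_supported (pushforward σ n ∘ₗ realize (convex_StdSimplex n) n) _
    (fun q hq => ?_) (barySubdiv_iterate_mem_supported (convex_StdSimplex n) dist_vertices_le m)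
  obtain ⟨i, hi⟩ := exists_ball_subset (q 0) trivial
  simp only [LinearMap.comp_apply, realize_single, pushforward_single]
  refine Finsupp.single_mem_supported ℤ _ ⟨i, fun x => ⟨hi ?_, hσ _⟩⟩
  exact (dist_affineSimplex_le (convex_StdSimplex n) hq x).trans_lt hm

theorem subdivide_iterate_mem_smallChains {ι : Type*} {U : ι → Set E} {n : ℕ} {c : SingChain n E}
    (hc : c ∈ smallChains U n) (m : ℕ) :
    (subdivide n)^[m] c ∈ smallChains U n := by
  induction m with
  | zero => exact hc
  | succ m ih =>
    rw [Function.iterate_succ_apply']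
    exact subdivide_mem_smallChains ih

theorem subdivide_iterate_mem_smallChains_of_le {ι : Type*} {U : ι → Set E} {n : ℕ}
    {c : SingChain n E} {m m' : ℕ} (h : m ≤ m') (hc : (subdivide n)^[m] c ∈ smallChains U n) :
    (subdivide n)^[m'] c ∈ smallChains U n := by
  obtain ⟨a, rfl⟩ := Nat.exists_eq_add_of_le' h
  rw [Function.iterate_add_apply]
  exact subdivide_iterate_mem_smallChains hc a

theorem exists_subdivide_iterate_mem_smallChains {ι : Type*} {U : ι → Set E}
    (hU : ∀ i, IsOpen (U i)) {S : Set E} (hS : S ⊆ ⋃ i, U i) {n : ℕ} {c : SingChain n E}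
    (hc : c ∈ chainsWithin S n) :
    ∃ m, (subdivide n)^[m] c ∈ smallChains (fun i => U i ∩ S) n := by
  rw [chainsWithin, Finsupp.supported_eq_span_single] at hc
  induction hc using Submodule.span_induction with
  | mem x hx =>
    obtain ⟨σ, hσ, rfl⟩ := hx
    exact exists_subdivide_iterate_single_mem_smallChains hU hS hσ
  | zero => exact ⟨0, zero_mem _⟩
  | add x y _ _ hx hy =>
    obtain ⟨m, hm⟩ := hx
    obtain ⟨m', hm'⟩ := hy
    refine ⟨max m m', ?_⟩
    rw [← Module.End.coe_pow, map_add, Module.End.coe_pow]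
    exact add_mem (subdivide_iterate_mem_smallChains_of_le (le_max_left _ _) hm)
      (subdivide_iterate_mem_smallChains_of_le (le_max_right _ _) hm')
  | smul a x _ hx =>
    obtain ⟨m, hm⟩ := hx
    refine ⟨m, ?_⟩
    rw [← Module.End.coe_pow, map_zsmul, Module.End.coe_pow]
    exact Submodule.smul_mem _ _ hm

theorem exists_subdivide_iterate_boundaryPred_mem_smallChains {ι : Type*} {U : ι → Set E}
    (hU : ∀ i, IsOpen (U i)) {A : Set E} (hA : A ⊆ ⋃ i, U i) {k : ℕ} {c : SingChain k E}
    (hc : boundaryPred k c ∈ chainsWithin A (k - 1)) :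
    ∃ m, boundaryPred k ((subdivide k)^[m] c) ∈ smallChains (fun i => U i ∩ A) (k - 1) := by
  obtain ⟨m, hm⟩ := exists_subdivide_iterate_mem_smallChains hU hA hc
  refine ⟨m, ?_⟩
  rwa [(show Function.Semiconj (boundaryPred k) (subdivide k) (subdivide (k - 1)) from
    boundaryPred_subdivide k).iterate_right m c]

end Small

/-! ### Finite generation of the relative homology of a ball -/

section BallFG

variable {V : Type u} [NormedAddCommGroup V] [NormedSpace ℝ V]

/-- The open unit ball, the model of an open cell. -/
abbrev unitBall (V : Type u) [NormedAddCommGroup V] : Set V := Metric.ball (0 : V) 1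

/-- The collar of the open unit ball: the points of norm greater than `1 / 2`. The relative homology
of the ball modulo its collar is the model of the contribution of one cell. -/
def ballCollar (V : Type u) [NormedAddCommGroup V] : Set (unitBall V) := {x | 1 / 2 < ‖(x : V)‖}

/-- A closed part of the collar of the ball, with room to move inside the collar. -/
def ballShell (V : Type u) [NormedAddCommGroup V] : Set (unitBall V) := {x | 3 / 4 ≤ ‖(x : V)‖}

theorem ballShell_subset_ballCollar (V : Type u) [NormedAddCommGroup V] :
    ballShell V ⊆ ballCollar V :=
  fun _ hx => lt_of_lt_of_le (b := (3 / 4 : ℝ)) (by norm_num) hx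

theorem convex_unitBall (V : Type u) [NormedAddCommGroup V] [NormedSpace ℝ V] :
    Convex ℝ (unitBall V) :=
  convex_ball 0 1

/-- The factor by which the ball is stretched at distance `r` from the centre. It is chosen so that
`stretchFactor r * r` is at least `3 / 4` for `r > 1 / 2` and stays below `1` for `r < 1`. -/
def stretchFactor (r : ℝ) : ℝ := max 1 (3 / 4 / max r (1 / 2))

theorem continuous_stretchFactor : Continuous stretchFactor := by
  refine continuous_const.max
    (continuous_const.div (continuous_id.max continuous_const) fun r => ?_)
  exact (lt_of_lt_of_le (by norm_num) (le_max_right _ _)).ne'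

theorem one_le_stretchFactor (r : ℝ) : 1 ≤ stretchFactor r := le_max_left _ _

theorem stretchFactor_mul_lt {r : ℝ} (hr : r < 1) : stretchFactor r * r < 1 := by
  have max_pos : 0 < max r (1 / 2) := lt_of_lt_of_le (by norm_num) (le_max_right _ _)
  rcases max_cases 1 (3 / 4 / max r (1 / 2)) with h | h <;> rw [stretchFactor, h.1]
  · linarith
  · rw [div_mul_eq_mul_div, div_lt_one max_pos]
    linarith [le_max_left r (1 / 2)]

theorem le_stretchFactor_mul {r : ℝ} (h : 1 / 2 < r) : 3 / 4 ≤ stretchFactor r * r := by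
  have div_le : 3 / 4 / max r (1 / 2) ≤ stretchFactor r := le_max_right _ _
  rw [max_eq_left h.le] at div_le
  exact (div_le_iff₀ (by linarith)).1 div_le

theorem one_le_stretch (t : unitInterval) (r : ℝ) : 1 ≤ 1 + (t : ℝ) * (stretchFactor r - 1) := by
  linarith [mul_nonneg t.2.1 (sub_nonneg.2 (one_le_stretchFactor r))]

theorem stretch_le (t : unitInterval) (r : ℝ) :
    1 + (t : ℝ) * (stretchFactor r - 1) ≤ stretchFactor r := by
  linarith [mul_le_mul_of_nonneg_right t.2.2 (sub_nonneg.2 (one_le_stretchFactor r))]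

/-- The radial homotopy of the ball from the identity to a map that takes the collar into the shell
`ballShell V`, and that keeps the collar inside itself. -/
def ballStretch (V : Type u) [NormedAddCommGroup V] [NormedSpace ℝ V] :
    C(unitInterval × unitBall V, unitBall V) where
  toFun z := ⟨(1 + (z.1 : ℝ) * (stretchFactor ‖(z.2 : V)‖ - 1)) • (z.2 : V), by
    rw [Metric.mem_ball, dist_zero_right, norm_smul,
      Real.norm_of_nonneg (zero_le_one.trans (one_le_stretch _ _))]
    exact (mul_le_mul_of_nonneg_right (stretch_le _ _) (norm_nonneg _)).trans_lt
      (stretchFactor_mul_lt (mem_ball_zero_iff.1 z.2.2))⟩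
  continuous_toFun := by
    have := continuous_stretchFactor
    fun_prop

theorem norm_ballStretch (t : unitInterval) (x : unitBall V) :
    ‖(ballStretch V (t, x) : V)‖ = (1 + (t : ℝ) * (stretchFactor ‖(x : V)‖ - 1)) * ‖(x : V)‖ := by
  change ‖(1 + (t : ℝ) * (stretchFactor ‖(x : V)‖ - 1)) • (x : V)‖ = _
  rw [norm_smul, Real.norm_of_nonneg (zero_le_one.trans (one_le_stretch _ _))]

theorem ballStretch_mem_ballCollar (t : unitInterval) {x : unitBall V} (hx : x ∈ ballCollar V) :
    ballStretch V (t, x) ∈ ballCollar V := by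
  refine lt_of_lt_of_le (b := ‖(x : V)‖) hx ?_
  rw [norm_ballStretch]
  exact le_mul_of_one_le_left (norm_nonneg _) (one_le_stretch _ _)

theorem homotopyAt_ballStretch_zero : homotopyAt (ballStretch V) 0 = ContinuousMap.id _ := by
  ext x
  change (1 + (0 : ℝ) * _) • (x : V) = x
  simp

theorem ballStretch_one_mem_ballShell {x : unitBall V} (hx : x ∈ ballCollar V) :
    ballStretch V (1, x) ∈ ballShell V := by
  change 3 / 4 ≤ ‖(ballStretch V (1, x) : V)‖
  rw [norm_ballStretch, Set.Icc.coe_one, one_mul, add_sub_cancel]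
  exact le_stretchFactor_mul hx

theorem exists_mem_pairCycles_ballShell {k : ℕ} {c : SingChain k (unitBall V)}
    (hc : c ∈ pairCycles Set.univ (ballCollar V) k) :
    ∃ c' ∈ pairCycles Set.univ (ballShell V) k,
      c' - c ∈ pairBoundaries Set.univ (ballCollar V) k := by
  refine ⟨pushforward (homotopyAt (ballStretch V) 1) k c,
    pushforward_mem_pairCycles (fun _ _ => Set.mem_univ _)
      (fun x hx => ballStretch_one_mem_ballShell hx) hc, ?_⟩
  simpa only [homotopyAt_ballStretch_zero, pushforward_id] using
    pushforward_sub_mem_pairBoundaries (f := ballStretch V) (S' := Set.univ) (A' := ballCollar V)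
      (fun _ _ _ => trivial) (fun t x hx => ballStretch_mem_ballCollar t hx) hc

/-- The straight-line homotopy from a simplex of a convex set to the affine simplex whose vertices
are the images of the vertices under `ν`. -/
def straighten {K : Set V} (hK : Convex ℝ K) (ν : K → K) (n : ℕ) (σ : SingSimplex n K) :
    C(Prism n, K) where
  toFun z := ⟨(1 - z.1.2) • (σ ⟨z.1.1, z.2.1⟩ : V) +
      z.1.2 • (affineSimplex hK (ν ∘ σ ∘ stdVertices n) ⟨z.1.1, z.2.1⟩ : V),
    hK (σ _).2 (affineSimplex hK _ _).2 (sub_nonneg.2 z.2.2.2) z.2.2.1 (sub_add_cancel _ _)⟩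
  continuous_toFun := by
    have continuous_base : Continuous fun z : Prism n => (⟨z.1.1, z.2.1⟩ : StdSimplex n) := by
      fun_prop
    refine Continuous.subtype_mk (Continuous.add (Continuous.smul (by fun_prop) ?_)
      (Continuous.smul (by fun_prop) ?_)) _
    · exact continuous_subtype_val.comp (σ.continuous.comp continuous_base)
    · exact continuous_subtype_val.comp ((affineSimplex hK _).continuous.comp continuous_base)

theorem straighten_stdFace {K : Set V} (hK : Convex ℝ K) (ν : K → K) (n : ℕ)
    (σ : SingSimplex (n + 1) K) (i : Fin (n + 2)) :
    straighten hK ν n (σ.comp (stdFace n i)) =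
      (straighten hK ν (n + 1) σ).comp (prismFace n i) := by
  have affine_face : affineSimplex hK (ν ∘ (σ.comp (stdFace n i)) ∘ stdVertices n) =
      (affineSimplex hK (ν ∘ σ ∘ stdVertices (n + 1))).comp (stdFace n i) := by
    rw [affineSimplex_comp_stdFace, ContinuousMap.coe_comp, Function.comp_assoc,
      stdFace_comp_stdVertices]
    rfl
  ext z
  simp only [straighten, ContinuousMap.coe_mk, affine_face]
  rfl

theorem straighten_prismSlice_zero {K : Set V} (hK : Convex ℝ K) (ν : K → K) (n : ℕ)
    (σ : SingSimplex n K) :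
    (straighten hK ν n σ).comp (prismSlice n 0) = σ := by
  ext x
  change (1 - (0 : ℝ)) • (σ x : V) + (0 : ℝ) • _ = _
  simp

theorem straighten_prismSlice_one {K : Set V} (hK : Convex ℝ K) (ν : K → K) (n : ℕ)
    (σ : SingSimplex n K) :
    (straighten hK ν n σ).comp (prismSlice n 1) = affineSimplex hK (ν ∘ σ ∘ stdVertices n) := by
  ext x
  change (1 - (1 : ℝ)) • (σ x : V) + (1 : ℝ) • (affineSimplex hK _ x : V) = _
  simp

theorem dist_straighten_le {K : Set V} (hK : Convex ℝ K) {ν : K → K} {ε : ℝ}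
    (hν : ∀ x, dist (ν x) x ≤ ε) {n : ℕ} {σ : SingSimplex n K} {y : K} (hσ : ∀ x, dist (σ x) y ≤ ε)
    (z : Prism n) :
    dist (straighten hK ν n σ z) y ≤ 2 * ε := by
  have ε_nonneg : 0 ≤ ε := dist_nonneg.trans (hν y)
  have convex_closedBall_y : Convex ℝ (Metric.closedBall (y : V) (2 * ε)) := convex_closedBall _ _
  refine convex_closedBall_y (x := (σ ⟨z.1.1, z.2.1⟩ : V))
    (y := (affineSimplex hK (ν ∘ σ ∘ stdVertices n) ⟨z.1.1, z.2.1⟩ : V)) ?_ ?_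
    (sub_nonneg.2 z.2.2.2) z.2.2.1 (sub_add_cancel _ _)
  · exact (hσ _).trans (by linarith)
  · refine convex_closedBall_y.sum_mem (fun i _ => z.2.1.1 i) z.2.1.2 fun i _ => ?_
    refine (dist_triangle (ν (σ (stdVertices n i))) (σ (stdVertices n i)) y).trans ?_
    linarith [hν (σ (stdVertices n i)), hσ (stdVertices n i)]

theorem prismEnd_straighten_zero {K : Set V} (hK : Convex ℝ K) (ν : K → K) (n : ℕ)
    (c : SingChain n K) : prismEnd (straighten hK ν) 0 n c = c :=
  apply_eq_of_apply_single (prismEnd (straighten hK ν) 0 n) LinearMap.id (fun σ => by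
    rw [prismEnd_single, straighten_prismSlice_zero]
    rfl) c

theorem prismEnd_straighten_one_mem_span {K : Set V} (hK : Convex ℝ K) (ν : K → K) (n : ℕ)
    (c : SingChain n K) :
    prismEnd (straighten hK ν) 1 n c ∈ Submodule.span ℤ
      ((fun q => Finsupp.single (affineSimplex hK q) 1) ''
        {q : Fin (n + 1) → K | ∀ i, q i ∈ Set.range ν}) := by
  refine map_mem_of_supported (prismEnd (straighten hK ν) 1 n) _ (s := Set.univ) (fun σ _ => ?_)
    (Finsupp.supported_univ (R := ℤ) (M := ℤ) ▸ Submodule.mem_top)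
  rw [prismEnd_single, straighten_prismSlice_one]
  exact Submodule.subset_span ⟨_, fun i => ⟨_, rfl⟩, rfl⟩

theorem straighten_mem_ballCollar {ν : unitBall V → unitBall V} (hν : ∀ x, dist (ν x) x ≤ 1 / 16)
    {n : ℕ} {σ : SingSimplex n (unitBall V)} {y : unitBall V}
    (hσ : ∀ x, σ x ∈ Metric.ball y (1 / 16) ∩ ballShell V) (z : Prism n) :
    straighten (convex_unitBall V) ν n σ z ∈ ballCollar V := by
  set x := σ (stdVertices n 0)
  set w := straighten (convex_unitBall V) ν n σ z
  have dist_le : dist x w ≤ 3 / 16 := by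
    have dist_w : dist w y ≤ 2 * (1 / 16) :=
      dist_straighten_le (convex_unitBall V) hν (fun x => (hσ x).1.le) z
    have dist_x : dist x y < 1 / 16 := (hσ (stdVertices n 0)).1
    linarith [dist_triangle_right x w y]
  have norm_le : ‖(x : V)‖ ≤ ‖(w : V)‖ + 3 / 16 := by
    refine (norm_le_norm_add_norm_sub' _ (w : V)).trans ?_
    rw [← dist_eq_norm]
    exact add_le_add le_rfl dist_le
  have le_norm_x : 3 / 4 ≤ ‖(x : V)‖ := (hσ (stdVertices n 0)).2
  change 1 / 2 < ‖(w : V)‖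
  linarith

theorem prismOperator_straighten_mem_chainsWithin {ν : unitBall V → unitBall V}
    (hν : ∀ x, dist (ν x) x ≤ 1 / 16) {n : ℕ} {b : SingChain n (unitBall V)}
    (hb : b ∈ smallChains (fun y => Metric.ball y (1 / 16) ∩ ballShell V) n) :
    prismOperator (straighten (convex_unitBall V) ν) n b ∈ chainsWithin (ballCollar V) (n + 1) :=
  map_mem_of_supported _ _ (fun σ hσ => by
    obtain ⟨y, hy⟩ := hσ
    rw [prismOperator_single]
    exact pushforward_mem_chainsWithin_of_forall (straighten_mem_ballCollar hν hy) _) hb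

theorem exists_finite_approx {X : Type*} [PseudoMetricSpace X] {K : Set X} (hK : TotallyBounded K)
    {ε : ℝ} (hε : 0 < ε) :
    ∃ ν : K → K, (Set.range ν).Finite ∧ ∀ x, dist (ν x) x ≤ ε := by
  obtain ⟨t, t_subset, t_finite, K_subset⟩ := Metric.finite_approx_of_totallyBounded hK ε hε
  have exists_near : ∀ x : K, ∃ y : K, (y : X) ∈ t ∧ dist y x ≤ ε := fun x => by
    obtain ⟨y, hy, hxy⟩ := Set.mem_iUnion₂.1 (K_subset x.2)
    exact ⟨⟨y, t_subset hy⟩, hy, (dist_comm _ _).trans_le (Metric.mem_ball.1 hxy).le⟩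
  choose ν hνt hν using exists_near
  refine ⟨ν, Set.Finite.subset (t_finite.preimage Subtype.val_injective.injOn) ?_, hν⟩
  rintro _ ⟨x, rfl⟩
  exact hνt x

theorem totallyBounded_unitBall (V : Type u) [NormedAddCommGroup V] [NormedSpace ℝ V]
    [FiniteDimensional ℝ V] : TotallyBounded (unitBall V) :=
  have : ProperSpace V := FiniteDimensional.proper ℝ V
  (isCompact_closedBall (0 : V) 1).totallyBounded.subset Metric.ball_subset_closedBall

/-- After stretching, the boundary of a relative cycle lies in the shell; after subdivision its
simplices are small, so that straightening them to the finitely many vertices in the range of `ν`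
does not leave the collar. -/
theorem exists_fg_approx (V : Type u) [NormedAddCommGroup V] [NormedSpace ℝ V]
    [FiniteDimensional ℝ V] (k : ℕ) :
    ∃ N : Submodule ℤ (SingChain k (unitBall V)),
      N.FG ∧
      ∀ c ∈ pairCycles Set.univ (ballCollar V) k,
        ∃ c' ∈ N, c - c' ∈ pairBoundaries Set.univ (ballCollar V) k := by
  obtain ⟨ν, ν_finite, hν⟩ :=
    exists_finite_approx (totallyBounded_unitBall V) (ε := 1 / 16) (by norm_num)
  refine ⟨Submodule.span ℤ ((fun q => Finsupp.single (affineSimplex (convex_unitBall V) q) 1) ''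
    {q : Fin (k + 1) → unitBall V | ∀ i, q i ∈ Set.range ν}),
    Submodule.fg_span (Set.Finite.image _ (Set.Finite.pi' fun _ => ν_finite)), fun c hc => ?_⟩
  obtain ⟨c₁, c₁_cycle, stretched⟩ := exists_mem_pairCycles_ballShell hc
  obtain ⟨m, small_boundary⟩ := exists_subdivide_iterate_boundaryPred_mem_smallChains
    (U := fun y : unitBall V => Metric.ball y (1 / 16)) (fun _ => Metric.isOpen_ball)
    (fun x _ => Set.mem_iUnion.2 ⟨x, Metric.mem_ball_self (by norm_num)⟩) c₁_cycle.2
  set c₂ := (subdivide k)^[m] c₁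
  have subdivided : c₁ - c₂ ∈ pairBoundaries Set.univ (ballCollar V) k :=
    pairBoundaries_mono le_rfl (ballShell_subset_ballCollar V) k
      (sub_subdivide_iterate_mem_pairBoundaries c₁_cycle m)
  set F := straighten (convex_unitBall V) ν
  have straightened : prismEnd F 1 k c₂ - c₂ ∈ pairBoundaries Set.univ (ballCollar V) k := by
    simpa only [F, prismEnd_straighten_zero] using
      prismEnd_sub_mem_pairBoundaries (straighten_stdFace (convex_unitBall V) ν)
        (mem_chainsWithin_univ _)
        (prismOperator_straighten_mem_chainsWithin hν small_boundary)
  refine ⟨prismEnd F 1 k c₂, prismEnd_straighten_one_mem_span _ _ _ _, ?_⟩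
  convert sub_mem (sub_mem subdivided stretched) straightened using 1
  abel

end BallFG

/-! ### Deck transformations -/

section Deck

variable {X : Type u} [TopologicalSpace X] {E : Type v} [TopologicalSpace E]

theorem locallyPathConnectedSpace_of_isLocalHomeomorph [LocallyPathConnectedSpace X] {p : E → X}
    (h : IsLocalHomeomorph p) :
    LocallyPathConnectedSpace E := by
  choose f hf using h
  let _ : ChartedSpace X E :=
    { atlas := Set.range f
      chartAt := f
      mem_chart_source := fun x => (hf x).1
      chart_mem_atlas := fun x => ⟨x, rfl⟩ }
  exact ChartedSpace.locallyPathConnectedSpace X E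

theorem surjective_of_isCoveringMap [PathConnectedSpace X] [Nonempty E] {p : E → X}
    (h : IsCoveringMap p) :
    Function.Surjective p := by
  intro x
  obtain ⟨e⟩ := ‹Nonempty E›
  let γ : Path (p e) x := PathConnectedSpace.somePath _ _
  refine ⟨h.liftPath γ e γ.source 1, ?_⟩
  exact (congr_fun (h.liftPath_lifts γ e γ.source) 1).trans γ.target

variable {π : C(E, X)} {e₀ : E}

theorem IsDeck.apply_base (hπ : IsCoveringMap π) {g : FundamentalGroup X (π e₀)} {T : C(E, E)}
    (h : IsDeck π e₀ g T) :
    T e₀ = hπ.monodromy (FundamentalGroup.toPath g) ⟨e₀, rfl⟩ := by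
  obtain ⟨-, base_eq, Γ, rfl⟩ := h
  exact congrArg Subtype.val (hπ.monodromy_eq_of_map_eq (ex := ⟨e₀, rfl⟩) (ey := ⟨T e₀, base_eq⟩)
    (γ := Path.Homotopic.Quotient.mk ((Γ.map π.continuous).cast rfl base_eq.symm))
    (Path.Homotopic.Quotient.mk Γ) rfl).symm

theorem lift_eq_of_apply_eq [PreconnectedSpace E] (hπ : IsCoveringMap π) {T T' : C(E, E)}
    (h : ∀ x, π (T x) = π x) (h' : ∀ x, π (T' x) = π x) {e : E} (he : T e = T' e) :
    T = T' :=
  DFunLike.coe_injective <| hπ.eq_of_comp_eq T.continuous T'.continuous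
    (funext fun x => (h x).trans (h' x).symm) e he

theorem IsDeck.unique [PreconnectedSpace E] (hπ : IsCoveringMap π) {g : FundamentalGroup X (π e₀)}
    {T T' : C(E, E)} (h : IsDeck π e₀ g T) (h' : IsDeck π e₀ g T') :
    T = T' :=
  lift_eq_of_apply_eq hπ h.1 h'.1 ((IsDeck.apply_base hπ h).trans (IsDeck.apply_base hπ h').symm)

theorem IsDeck.deckClass_unique [SimplyConnectedSpace E] {g g' : FundamentalGroup X (π e₀)}
    {T : C(E, E)} (h : IsDeck π e₀ g T) (h' : IsDeck π e₀ g' T) :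
    g = g' := by
  obtain ⟨-, base_eq, Γ, rfl⟩ := h
  obtain ⟨-, -, Γ', rfl⟩ := h'
  have homotopic : Path.Homotopic.Quotient.mk Γ = Path.Homotopic.Quotient.mk Γ' :=
    Subsingleton.elim _ _
  exact congrArg (fun q : Path.Homotopic.Quotient e₀ (T e₀) => (q.map π).cast rfl base_eq.symm)
    homotopic

theorem exists_isDeck_apply_eq [SimplyConnectedSpace E] [LocallyPathConnectedSpace E]
    (hπ : IsCoveringMap π) {e e' : E} (h : π e' = π e) :
    ∃ g T, IsDeck π e₀ g T ∧ T e = e' := by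
  obtain ⟨T, ⟨apply_eq, comp_eq⟩, -⟩ := hπ.existsUnique_continuousMap_lifts π e e' h
  have lifts : ∀ x, π (T x) = π x := congrFun comp_eq
  exact ⟨_, T, ⟨lifts, lifts e₀, PathConnectedSpace.somePath _ _, rfl⟩, apply_eq⟩

theorem isDeck_of_map_eq {g : FundamentalGroup X (π e₀)} {T : C(E, E)}
    (hT : ∀ x, π (T x) = π x) {e : E} (he : T e₀ = e) (hπe : π e = π e₀) (Γ : Path e₀ e)
    (hΓ : (Path.Homotopic.Quotient.mk Γ).map π = (FundamentalGroup.toPath g).cast rfl hπe) :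
    IsDeck π e₀ g T := by
  subst he
  have cast_eq := congrArg (fun q => q.cast rfl hπe.symm) hΓ
  simp only [Path.Homotopic.Quotient.cast_cast, Path.Homotopic.Quotient.cast_rfl_rfl] at cast_eq
  exact ⟨hT, hπe, Γ, cast_eq.symm⟩

theorem exists_isDeck [SimplyConnectedSpace E] [LocallyPathConnectedSpace E] (hπ : IsCoveringMap π)
    (g : FundamentalGroup X (π e₀)) :
    ∃ T, IsDeck π e₀ g T := by
  set e₁ := hπ.monodromy (FundamentalGroup.toPath g) ⟨e₀, rfl⟩
  obtain ⟨T, ⟨apply_eq, comp_eq⟩, -⟩ := hπ.existsUnique_continuousMap_lifts π e₀ e₁.1 e₁.2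
  obtain ⟨Γ, hΓ⟩ : ∃ Γ, Path.Homotopic.Quotient.mk Γ =
      hπ.liftPathQuotient (FundamentalGroup.toPath g) ⟨e₀, rfl⟩ := Quotient.exists_rep _
  refine ⟨T, isDeck_of_map_eq (congrFun comp_eq) apply_eq e₁.2 Γ ?_⟩
  rw [hΓ]
  exact hπ.map_liftPathQuotient (FundamentalGroup.toPath g) ⟨e₀, rfl⟩

theorem IsDeck.eq_of_apply_eq [SimplyConnectedSpace E] (hπ : IsCoveringMap π)
    {g g' : FundamentalGroup X (π e₀)} {T T' : C(E, E)} (h : IsDeck π e₀ g T)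
    (h' : IsDeck π e₀ g' T') {e : E} (he : T e = T' e) :
    g = g' := by
  obtain rfl := lift_eq_of_apply_eq hπ h.1 h'.1 he
  exact h.deckClass_unique h'

theorem IsDeck.mul {g h : FundamentalGroup X (π e₀)} {T S : C(E, E)} (hT : IsDeck π e₀ g T)
    (hS : IsDeck π e₀ h S) :
    IsDeck π e₀ (g * h) (S.comp T) := by
  obtain ⟨T_lifts, T_base, Γ, rfl⟩ := hT
  obtain ⟨S_lifts, S_base, Δ, rfl⟩ := hS
  refine ⟨fun e => (S_lifts _).trans (T_lifts e), (S_lifts _).trans T_base,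
    Δ.trans (Γ.map S.continuous), ?_⟩
  rw [FundamentalGroup.mul_def]
  refine (Path.Homotopic.Quotient.mk_trans _ _).symm.trans (congrArg _ ?_)
  ext t
  simp only [Path.trans_apply, Path.cast_coe, Path.map_coe, Function.comp_apply]
  split_ifs
  · rfl
  · exact (S_lifts _).symm

end Deck

/-! ### Finite CW complexes -/

section CW

open Topology Metric

/-- The domain of the characteristic maps of Mathlib's CW complexes: the closed unit ball for the
supremum norm. -/
abbrev ClosedUnitBall (k : ℕ) : Set (Fin k → ℝ) := closedBall 0 1

variable {X : Type u} [TopologicalSpace X] [CWComplex (Set.univ : Set X)]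

/-- The set of `k`-cells of a space with a fixed CW structure. -/
abbrev Cell (X : Type u) [TopologicalSpace X] [CWComplex (Set.univ : Set X)] (k : ℕ) : Type u :=
  RelCWComplex.cell (Set.univ : Set X) k

instance finite_cell [CWComplex.Finite (Set.univ : Set X)] (k : ℕ) : Finite (Cell X k) :=
  RelCWComplex.FiniteType.finite_cell k

/-- The characteristic map of a cell, as a continuous map on the closed ball. -/
def charMap {k : ℕ} (e : Cell X k) : C(ClosedUnitBall k, X) :=
  ⟨fun x => RelCWComplex.map k e x, (RelCWComplex.continuousOn k e).domRestrict⟩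

theorem eq_of_charMap_eq {k : ℕ} {e e' : Cell X k} {x y : ClosedUnitBall k}
    (h : charMap e x = charMap e' y) (hx : ‖(x : Fin k → ℝ)‖ < 1) (hy : ‖(y : Fin k → ℝ)‖ < 1) :
    e = e' ∧ x = y := by
  have x_mem : (x : Fin k → ℝ) ∈ ball (0 : Fin k → ℝ) 1 := mem_ball_zero_iff.2 hx
  have y_mem : (y : Fin k → ℝ) ∈ ball (0 : Fin k → ℝ) 1 := mem_ball_zero_iff.2 hy
  obtain rfl : e = e' := by
    by_contra cells_ne
    have disjoint := RelCWComplex.disjoint_openCell_of_ne (C := (Set.univ : Set X)) (n := k)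
      (m := k) (i := e) (j := e') (by simpa using cells_ne)
    exact disjoint.le_bot ⟨⟨x, x_mem, rfl⟩, ⟨y, y_mem, h.symm⟩⟩
  have injOn := (RelCWComplex.map k e).injOn
  rw [RelCWComplex.source_eq] at injOn
  exact ⟨rfl, Subtype.ext (injOn x_mem y_mem h)⟩

variable [T2Space X]

/-- The `(k - 1)`-skeleton, the union of the cells of dimension less than `k`. -/
abbrev skel (X : Type u) [TopologicalSpace X] [CWComplex (Set.univ : Set X)] [T2Space X] (k : ℕ) :
    Set X :=
  CWComplex.skeletonLT (Set.univ : Set X) (k : ℕ∞)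

theorem isClosed_skel (k : ℕ) : IsClosed (skel X k) := RelCWComplex.Subcomplex.closed _

theorem skel_subset_succ (k : ℕ) : skel X k ⊆ skel X (k + 1) :=
  RelCWComplex.skeletonLT_mono (by exact_mod_cast Nat.le_succ k)

theorem charMap_mem_skel_succ {k : ℕ} (e : Cell X k) (x : ClosedUnitBall k) :
    charMap e x ∈ skel X (k + 1) :=
  RelCWComplex.closedCell_subset_skeletonLT k e ⟨x, x.2, rfl⟩

theorem charMap_mem_skel_iff {k : ℕ} (e : Cell X k) (x : ClosedUnitBall k) :
    charMap e x ∈ skel X k ↔ ‖(x : Fin k → ℝ)‖ = 1 := by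
  constructor
  · intro h
    by_contra norm_ne
    have norm_lt := lt_of_le_of_ne (mem_closedBall_zero_iff.1 x.2) norm_ne
    have disjoint := RelCWComplex.disjoint_skeletonLT_openCell (C := (Set.univ : Set X))
      (n := (k : ℕ∞)) (m := k) (j := e) le_rfl
    exact disjoint.le_bot ⟨h, ⟨x, mem_ball_zero_iff.2 norm_lt, rfl⟩⟩
  · intro h
    exact RelCWComplex.cellFrontier_subset_skeletonLT k e ⟨x, mem_sphere_zero_iff_norm.2 h, rfl⟩

theorem mem_skel_succ {k : ℕ} {x : X} (h : x ∈ skel X (k + 1)) :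
    x ∈ skel X k ∨ ∃ (e : Cell X k) (y : ClosedUnitBall k), charMap e y = x := by
  have mem_skeletonLT :
      x ∈ (CWComplex.skeletonLT (Set.univ : Set X) ((k : ℕ∞) + 1) : Set X) := by
    exact_mod_cast h
  rw [← RelCWComplex.skeletonLT_union_iUnion_closedCell_eq_skeletonLT_succ] at mem_skeletonLT
  rcases mem_skeletonLT with mem_skel | mem_cells
  · exact Or.inl mem_skel
  · obtain ⟨e, y, hy, rfl⟩ := Set.mem_iUnion.1 mem_cells
    exact Or.inr ⟨e, ⟨y, hy⟩, rfl⟩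

instance compactSpace_closedUnitBall (k : ℕ) : CompactSpace (ClosedUnitBall k) :=
  isCompact_iff_compactSpace.1 (isCompact_closedBall 0 1)

section Finite

variable (X) [CWComplex.Finite (Set.univ : Set X)]

/-- The union of all characteristic maps, which presents a finite CW complex as a quotient of a
finite disjoint union of balls. -/
def allCells : (Σ c : (Σ n, Cell X n), ClosedUnitBall c.1) → X := fun z => charMap z.1.2 z.2

theorem isQuotientMap_allCells : IsQuotientMap (allCells X) := by
  have : Finite (Σ n, Cell X n) := RelCWComplex.finite_cells_of_finite
  have continuous_allCells : Continuous (allCells X) :=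
    continuous_sigma fun c => (charMap c.2).continuous
  refine continuous_allCells.isClosedMap.isQuotientMap continuous_allCells fun x => ?_
  have x_mem : x ∈ ⋃ (n : ℕ) (j : Cell X n), RelCWComplex.closedCell n j := by
    rw [CWComplex.union]
    trivial
  obtain ⟨n, x_mem⟩ := Set.mem_iUnion.1 x_mem
  obtain ⟨e, y, hy, rfl⟩ := Set.mem_iUnion.1 x_mem
  exact ⟨⟨⟨n, e⟩, ⟨y, hy⟩⟩, rfl⟩

theorem compactSpace_of_finite : CompactSpace X := by
  have : Finite (Σ n, Cell X n) := RelCWComplex.finite_cells_of_finite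
  exact (isQuotientMap_allCells X).surjective.compactSpace (isQuotientMap_allCells X).continuous

theorem locallyPathConnectedSpace_of_finite : LocallyPathConnectedSpace X := by
  have : ∀ c : (Σ n, Cell X n), LocallyPathConnectedSpace (ClosedUnitBall c.1) := fun c =>
    (convex_closedBall (0 : Fin c.1 → ℝ) 1).locallyPathConnectedSpace
  exact (isQuotientMap_allCells X).locallyPathConnectedSpace

variable (k : ℕ)

/-- The attachment of the `k`-cells, which presents the `k`-skeleton as a quotient of the disjoint
union of the preceding skeleton and one closed ball for each `k`-cell. -/
def attach : skel X k ⊕ (Σ _ : Cell X k, ClosedUnitBall k) → skel X (k + 1) :=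
  Sum.elim (fun x => ⟨x, skel_subset_succ k x.2⟩)
    fun z => ⟨charMap z.1 z.2, charMap_mem_skel_succ _ _⟩

theorem isQuotientMap_attach : IsQuotientMap (attach X k) := by
  have := compactSpace_of_finite X
  have : CompactSpace (skel X k) := isCompact_iff_compactSpace.1 (isClosed_skel k).isCompact
  have continuous_attach : Continuous (attach X k) :=
    Continuous.sumElim (by fun_prop)
      (continuous_sigma fun e => (charMap e).continuous.subtype_mk _)
  refine continuous_attach.isClosedMap.isQuotientMap continuous_attach ?_
  rintro ⟨x, hx⟩
  rcases mem_skel_succ hx with h | ⟨e, y, rfl⟩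
  · exact ⟨Sum.inl ⟨x, h⟩, rfl⟩
  · exact ⟨Sum.inr ⟨e, y⟩, rfl⟩

end Finite


theorem norm_closedUnitBall_le {k : ℕ} (x : ClosedUnitBall k) : ‖(x : Fin k → ℝ)‖ ≤ 1 :=
  mem_closedBall_zero_iff.1 x.2

/-- The factor by which a closed ball is expanded at distance `r` from the centre. It takes every
`r ≥ 1 / 2` to `1`, and it is `1` at `r = 1`. -/
def expandFactor (r : ℝ) : ℝ := (max r (1 / 2))⁻¹

theorem max_half_pos (r : ℝ) : 0 < max r (1 / 2) := lt_max_of_lt_right (by norm_num)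

theorem continuous_expandFactor : Continuous expandFactor :=
  (continuous_id.max continuous_const).inv₀ fun r => (max_half_pos r).ne'

theorem one_le_expandFactor {r : ℝ} (h : r ≤ 1) : 1 ≤ expandFactor r :=
  (one_le_inv₀ (max_half_pos r)).2 (max_le h (by norm_num))

theorem expandFactor_mul_le (r : ℝ) : expandFactor r * r ≤ 1 :=
  (inv_mul_le_iff₀ (max_half_pos r)).2 (by simp)

theorem expandFactor_mul_of_half_le {r : ℝ} (h : 1 / 2 ≤ r) : expandFactor r * r = 1 := by
  rw [expandFactor, max_eq_left h, inv_mul_cancel₀ (by linarith)]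

theorem one_le_expandCoeff (t : unitInterval) {r : ℝ} (h : r ≤ 1) :
    1 ≤ 1 + (t : ℝ) * (expandFactor r - 1) :=
  le_add_of_nonneg_right (mul_nonneg t.2.1 (sub_nonneg.2 (one_le_expandFactor h)))

theorem expandCoeff_le (t : unitInterval) {r : ℝ} (h : r ≤ 1) :
    1 + (t : ℝ) * (expandFactor r - 1) ≤ expandFactor r := by
  linarith [mul_le_of_le_one_left (sub_nonneg.2 (one_le_expandFactor h)) t.2.2]

theorem norm_expandCoeff_smul {k : ℕ} (x : ClosedUnitBall k) (t : unitInterval) :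
    ‖(1 + (t : ℝ) * (expandFactor ‖(x : Fin k → ℝ)‖ - 1)) • (x : Fin k → ℝ)‖ =
      (1 + (t : ℝ) * (expandFactor ‖(x : Fin k → ℝ)‖ - 1)) * ‖(x : Fin k → ℝ)‖ := by
  rw [norm_smul,
    Real.norm_of_nonneg (zero_le_one.trans (one_le_expandCoeff t (norm_closedUnitBall_le x)))]

/-- The homotopy of the closed ball, constant on the boundary, that moves the points outside the
ball of radius `1 / 2` to the boundary. -/
def expand (k : ℕ) : C(ClosedUnitBall k × unitInterval, ClosedUnitBall k) where
  toFun z :=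
    ⟨(1 + (z.2 : ℝ) * (expandFactor ‖(z.1 : Fin k → ℝ)‖ - 1)) • (z.1 : Fin k → ℝ), by
      rw [mem_closedBall_zero_iff, norm_expandCoeff_smul]
      exact (mul_le_mul_of_nonneg_right (expandCoeff_le z.2 (norm_closedUnitBall_le z.1))
        (norm_nonneg _)).trans (expandFactor_mul_le _)⟩
  continuous_toFun := by
    have := continuous_expandFactor
    fun_prop

theorem norm_expand {k : ℕ} (x : ClosedUnitBall k) (t : unitInterval) :
    ‖(expand k (x, t) : Fin k → ℝ)‖ =
      (1 + (t : ℝ) * (expandFactor ‖(x : Fin k → ℝ)‖ - 1)) * ‖(x : Fin k → ℝ)‖ :=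
  norm_expandCoeff_smul x t

theorem norm_le_norm_expand {k : ℕ} (x : ClosedUnitBall k) (t : unitInterval) :
    ‖(x : Fin k → ℝ)‖ ≤ ‖(expand k (x, t) : Fin k → ℝ)‖ := by
  rw [norm_expand]
  exact le_mul_of_one_le_left (norm_nonneg _) (one_le_expandCoeff t (norm_closedUnitBall_le x))

theorem expand_zero {k : ℕ} (x : ClosedUnitBall k) : expand k (x, 0) = x := by
  apply Subtype.ext
  change (1 + (0 : ℝ) * _) • (x : Fin k → ℝ) = x
  rw [zero_mul, add_zero, one_smul]

theorem expand_of_norm_eq_one {k : ℕ} {x : ClosedUnitBall k} (h : ‖(x : Fin k → ℝ)‖ = 1)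
    (t : unitInterval) :
    expand k (x, t) = x := by
  have factor_eq : expandFactor 1 = 1 := by
    simpa using expandFactor_mul_of_half_le (r := 1) (by norm_num)
  apply Subtype.ext
  change (1 + (t : ℝ) * (expandFactor ‖(x : Fin k → ℝ)‖ - 1)) • (x : Fin k → ℝ) = x
  rw [h, factor_eq, sub_self, mul_zero, add_zero, one_smul]

theorem norm_expand_one {k : ℕ} {x : ClosedUnitBall k} (h : 1 / 2 < ‖(x : Fin k → ℝ)‖) :
    ‖(expand k (x, 1) : Fin k → ℝ)‖ = 1 := by
  rw [norm_expand, Set.Icc.coe_one, one_mul, add_sub_cancel, expandFactor_mul_of_half_le h.le]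

/-- The union of the half-size closed cells of dimension `k`, whose complement in the `k`-skeleton
deforms into the preceding skeleton. -/
def halfCells (X : Type u) [TopologicalSpace X] [CWComplex (Set.univ : Set X)] (k : ℕ) : Set X :=
  ⋃ e : Cell X k, charMap e '' {y | ‖(y : Fin k → ℝ)‖ ≤ 1 / 2}

theorem isClosed_halfCells [CWComplex.Finite (Set.univ : Set X)] (k : ℕ) :
    IsClosed (halfCells X k) := by
  refine isClosed_iUnion_of_finite fun e => ?_
  refine (IsCompact.image (IsClosed.isCompact ?_) (charMap e).continuous).isClosed
  exact isClosed_le (by fun_prop) continuous_const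

theorem charMap_mem_halfCells_iff {k : ℕ} (e : Cell X k) (y : ClosedUnitBall k) :
    charMap e y ∈ halfCells X k ↔ ‖(y : Fin k → ℝ)‖ ≤ 1 / 2 := by
  constructor
  · intro h
    obtain ⟨e', w, norm_w_le, charMap_w⟩ := Set.mem_iUnion.1 h
    have norm_w_lt : ‖(w : Fin k → ℝ)‖ < 1 := lt_of_le_of_lt norm_w_le (by norm_num)
    have norm_y_lt : ‖(y : Fin k → ℝ)‖ < 1 := by
      refine lt_of_le_of_ne (norm_closedUnitBall_le y) fun norm_y_eq => norm_w_lt.ne ?_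
      rwa [← charMap_mem_skel_iff e y, ← charMap_w, charMap_mem_skel_iff] at norm_y_eq
    rwa [← (eq_of_charMap_eq charMap_w norm_w_lt norm_y_lt).2]
  · intro h
    exact Set.mem_iUnion.2 ⟨e, y, h, rfl⟩

theorem notMem_halfCells_of_mem_skel {k : ℕ} {x : X} (h : x ∈ skel X k) : x ∉ halfCells X k := by
  intro hx
  obtain ⟨e, w, norm_w_le, rfl⟩ := Set.mem_iUnion.1 hx
  rw [charMap_mem_skel_iff] at h
  norm_num [h] at norm_w_le

variable (X) in
/-- The homotopy `skelStretch` before the balls are attached: it is constant on the skeleton and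
stretches each ball. -/
def stretchBeforeAttach (k : ℕ) :
    C(skel X k ⊕ (Σ _ : Cell X k, ClosedUnitBall k), C(unitInterval, X)) where
  toFun := Sum.elim (fun x => ContinuousMap.const _ (x : X))
    fun z => ((charMap z.1).comp (expand k)).curry z.2
  continuous_toFun := by
    refine Continuous.sumElim ?_ (continuous_sigma fun e => ?_)
    · exact (ContinuousMap.curry ⟨fun z : skel X k × unitInterval => (z.1 : X), by
        fun_prop⟩).continuous
    · exact (ContinuousMap.curry ((charMap e).comp (expand k))).continuous

theorem stretchBeforeAttach_inr_of_mem_skel {k : ℕ} {e : Cell X k} {y : ClosedUnitBall k}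
    (hy : charMap e y ∈ skel X k) :
    stretchBeforeAttach X k (Sum.inr ⟨e, y⟩) = ContinuousMap.const _ (charMap e y) := by
  ext t
  change charMap e (expand k (y, t)) = charMap e y
  rw [expand_of_norm_eq_one ((charMap_mem_skel_iff e y).1 hy)]

variable (X) in
theorem stretchBeforeAttach_factorsThrough_attach (k : ℕ) :
    Function.FactorsThrough (stretchBeforeAttach X k) (attach X k) := by
  rintro (x | ⟨e, y⟩) (x' | ⟨e', y'⟩) h <;> have point_eq := congrArg Subtype.val h
  · exact congrArg (ContinuousMap.const unitInterval) point_eq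
  · change (x : X) = charMap e' y' at point_eq
    rw [stretchBeforeAttach_inr_of_mem_skel (point_eq ▸ x.2), ← point_eq]
    rfl
  · change charMap e y = (x' : X) at point_eq
    rw [stretchBeforeAttach_inr_of_mem_skel (point_eq ▸ x'.2), point_eq]
    rfl
  · change charMap e y = charMap e' y' at point_eq
    by_cases hy : charMap e y ∈ skel X k
    · rw [stretchBeforeAttach_inr_of_mem_skel hy,
        stretchBeforeAttach_inr_of_mem_skel (point_eq ▸ hy), point_eq]
    · have hy' := point_eq ▸ hy
      rw [charMap_mem_skel_iff] at hy hy'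
      obtain ⟨rfl, rfl⟩ := eq_of_charMap_eq point_eq (lt_of_le_of_ne (norm_closedUnitBall_le y) hy)
        (lt_of_le_of_ne (norm_closedUnitBall_le y') hy')
      rfl

variable (X) [CWComplex.Finite (Set.univ : Set X)]

/-- The homotopy of a skeleton that stretches the cells of top dimension by `expand`. At time `1`
it has pushed everything outside the half-size cells into the preceding skeleton. -/
def skelStretch (k : ℕ) : C(unitInterval × skel X (k + 1), X) :=
  let attachMap : C(_, _) := ⟨attach X k, (isQuotientMap_attach X k).continuous⟩
  have isQuotientMap_attachMap : IsQuotientMap attachMap := isQuotientMap_attach X k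
  (isQuotientMap_attachMap.lift (stretchBeforeAttach X k)
    (stretchBeforeAttach_factorsThrough_attach X k)).uncurry.comp ContinuousMap.prodSwap

variable {X} {k : ℕ} (t : unitInterval) {x : X}

theorem skelStretch_attach (z : skel X k ⊕ (Σ _ : Cell X k, ClosedUnitBall k)) :
    skelStretch X k (t, attach X k z) = stretchBeforeAttach X k z t := by
  let attachMap : C(_, _) := ⟨attach X k, (isQuotientMap_attach X k).continuous⟩
  have isQuotientMap_attachMap : IsQuotientMap attachMap := isQuotientMap_attach X k
  exact DFunLike.congr_fun (DFunLike.congr_fun (isQuotientMap_attachMap.lift_comp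
    (stretchBeforeAttach X k) (stretchBeforeAttach_factorsThrough_attach X k)) z) t

theorem skelStretch_of_mem_skel (hx : x ∈ skel X k) :
    skelStretch X k (t, ⟨x, skel_subset_succ k hx⟩) = x :=
  skelStretch_attach t (Sum.inl ⟨x, hx⟩)

theorem skelStretch_charMap (e : Cell X k) (y : ClosedUnitBall k) :
    skelStretch X k (t, ⟨charMap e y, charMap_mem_skel_succ e y⟩) = charMap e (expand k (y, t)) :=
  skelStretch_attach t (Sum.inr ⟨e, y⟩)

theorem skelStretch_zero (x : skel X (k + 1)) : skelStretch X k (0, x) = x := by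
  obtain ⟨x, hx⟩ := x
  rcases mem_skel_succ hx with h | ⟨e, y, rfl⟩
  · exact skelStretch_of_mem_skel 0 h
  · rw [skelStretch_charMap, expand_zero]

theorem skelStretch_mem_skel_succ (hx : x ∈ skel X (k + 1)) :
    skelStretch X k (t, ⟨x, hx⟩) ∈ skel X (k + 1) := by
  rcases mem_skel_succ hx with h | ⟨e, y, rfl⟩
  · rwa [skelStretch_of_mem_skel t h]
  · rw [skelStretch_charMap]
    exact charMap_mem_skel_succ e _

theorem skelStretch_notMem_halfCells (hx : x ∈ skel X (k + 1)) (hx' : x ∉ halfCells X k) :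
    skelStretch X k (t, ⟨x, hx⟩) ∉ halfCells X k := by
  rcases mem_skel_succ hx with h | ⟨e, y, rfl⟩
  · rwa [skelStretch_of_mem_skel t h]
  · rw [skelStretch_charMap]
    rw [charMap_mem_halfCells_iff, not_le] at hx' ⊢
    exact hx'.trans_le (norm_le_norm_expand y t)

theorem skelStretch_one_mem_skel (hx : x ∈ skel X (k + 1)) (hx' : x ∉ halfCells X k) :
    skelStretch X k (1, ⟨x, hx⟩) ∈ skel X k := by
  rcases mem_skel_succ hx with h | ⟨e, y, rfl⟩
  · rwa [skelStretch_of_mem_skel 1 h]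
  · rw [charMap_mem_halfCells_iff, not_le] at hx'
    rw [skelStretch_charMap, charMap_mem_skel_iff, norm_expand_one hx']

end CW

/-! ### Excision for a family of disjoint charts -/

section Excision

variable {E : Type u} [TopologicalSpace E] {B : Type v} [TopologicalSpace B] {ι : Type w}

/-- The sum of the push-forwards of a family of chains along a family of maps. It identifies the
chains of disjoint copies of `B` with chains of `E`. -/
def pushforwardFamily (ψ : ι → C(B, E)) (n : ℕ) : (ι →₀ SingChain n B) →ₗ[ℤ] SingChain n E :=
  Finsupp.lsum ℤ fun i => pushforward (ψ i) n

theorem pushforwardFamily_single (ψ : ι → C(B, E)) (n : ℕ) (i : ι) (c : SingChain n B) :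
    pushforwardFamily ψ n (Finsupp.single i c) = pushforward (ψ i) n c := by
  simp [pushforwardFamily]

theorem pushforwardFamily_comm (ψ : ι → C(B, E)) {n m : ℕ} (f : SingChain n B →ₗ[ℤ] SingChain m B)
    (f' : SingChain n E →ₗ[ℤ] SingChain m E)
    (h : ∀ i c, f' (pushforward (ψ i) n c) = pushforward (ψ i) m (f c)) (z : ι →₀ SingChain n B) :
    f' (pushforwardFamily ψ n z) = pushforwardFamily ψ m (Finsupp.mapRange.linearMap f z) := by
  have comp_eq :
      f' ∘ₗ pushforwardFamily ψ n = pushforwardFamily ψ m ∘ₗ Finsupp.mapRange.linearMap f :=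
    Finsupp.lhom_ext fun i c => by simp [pushforwardFamily_single, h]
  exact LinearMap.congr_fun comp_eq z

theorem subdivide_iterate_pushforwardFamily (ψ : ι → C(B, E)) (n m : ℕ)
    (z : ι →₀ SingChain n B) :
    (subdivide n)^[m] (pushforwardFamily ψ n z) =
      pushforwardFamily ψ n (Finsupp.mapRange.linearMap (subdivide n ^ m) z) := by
  rw [← Module.End.coe_pow]
  refine pushforwardFamily_comm ψ _ _ (fun i c => ?_) z
  rw [Module.End.coe_pow, Module.End.coe_pow]
  exact (Function.Semiconj.iterate_right (f := pushforward (ψ i) n)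
    (fun c => (subdivide_pushforward _ _ c).symm) m c).symm

variable {ψ : ι → C(B, E)}

theorem pushforwardFamily_apply (hψ : ∀ i j x y, ψ i x = ψ j y → i = j ∧ x = y) {n : ℕ}
    (z : ι →₀ SingChain n B) (i : ι) (τ : SingSimplex n B) :
    pushforwardFamily ψ n z ((ψ i).comp τ) = z i τ := by
  classical
  induction z using Finsupp.induction_linear with
  | zero => simp
  | add x y hx hy => simp [map_add, hx, hy]
  | single j c =>
    rw [pushforwardFamily_single]
    induction c using Finsupp.induction_linear with
    | zero => simp
    | add x y hx hy => simp [map_add, hx, hy]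
    | single ρ a =>
      rw [pushforward_single]
      have comp_eq_comp_iff : (ψ j).comp ρ = (ψ i).comp τ ↔ j = i ∧ ρ = τ := by
        constructor
        · intro h
          have eq_at := fun x => hψ _ _ _ _ (DFunLike.congr_fun h x)
          exact ⟨(eq_at (Classical.arbitrary _)).1, ContinuousMap.ext fun x => (eq_at x).2⟩
        · rintro ⟨rfl, rfl⟩
          rfl
      by_cases h : j = i
      · subst h
        simp [Finsupp.single_apply, comp_eq_comp_iff]
      · simp [comp_eq_comp_iff, h]

theorem pushforwardFamily_mem_chainsWithin (hψ : ∀ i j x y, ψ i x = ψ j y → i = j ∧ x = y) {n : ℕ}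
    {z : ι →₀ SingChain n B} {S : Set E} (hz : pushforwardFamily ψ n z ∈ chainsWithin S n) (i : ι) :
    z i ∈ chainsWithin (ψ i ⁻¹' S) n := by
  intro τ hτ x
  refine hz (a := (ψ i).comp τ) ?_ x
  rw [Finset.mem_coe, Finsupp.mem_support_iff] at hτ ⊢
  rwa [pushforwardFamily_apply hψ]

theorem exists_pushforwardFamily_eq {U : Set E}
    (hlift : ∀ (n : ℕ) (σ : SingSimplex n E), (∀ x, σ x ∈ U) → ∃ i τ, σ = (ψ i).comp τ) {n : ℕ}
    {c : SingChain n E} (hc : c ∈ chainsWithin U n) :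
    ∃ z, pushforwardFamily ψ n z = c :=
  map_mem_of_supported LinearMap.id (LinearMap.range (pushforwardFamily ψ n)) (fun σ hσ => by
    obtain ⟨i, τ, rfl⟩ := hlift n σ hσ
    refine ⟨Finsupp.single i (Finsupp.single τ 1), ?_⟩
    rw [pushforwardFamily_single, pushforward_single, LinearMap.id_apply]) hc

theorem exists_add_of_mem_smallChains {O : Bool → Set E} {n : ℕ} {c : SingChain n E}
    (hc : c ∈ smallChains O n) :
    ∃ a ∈ chainsWithin (O true) n, ∃ b ∈ chainsWithin (O false) n, a + b = c := by
  rw [← Submodule.mem_sup, chainsWithin, chainsWithin, ← Finsupp.supported_union]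
  refine Finsupp.supported_mono ?_ hc
  rintro σ ⟨_ | _, h⟩
  · exact Or.inr h
  · exact Or.inl h

theorem boundary_subdivide_iterate (k m : ℕ) (c : SingChain (k + 1) E) :
    boundary k ((subdivide (k + 1))^[m] c) = (subdivide k)^[m] (boundary k c) :=
  Function.Semiconj.iterate_right (f := boundary k) (boundary_subdivide k) m c

theorem subdivide_iterate_mem_chainsWithin {S : Set E} {k : ℕ} {c : SingChain k E}
    (hc : c ∈ chainsWithin S k) (m : ℕ) :
    (subdivide k)^[m] c ∈ chainsWithin S k := by
  induction m with
  | zero => exact hc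
  | succ m ih =>
    rw [Function.iterate_succ_apply']
    exact subdivide_mem_chainsWithin ih

/-- The maps `ψ i` embed disjoint copies of `B` as the pieces of `Y \ A`, and the subset `W` of `B`
corresponds to the subset `V` of `Y`. That the pieces carry the right topology is expressed by the
lifting of singular simplices; both `V` and `Y \ A` are open in `Y`, as excision requires. -/
structure IsChartFamily (ψ : ι → C(B, E)) (W : Set B) (Y A V : Set E) : Prop where
  inj : ∀ i j x y, ψ i x = ψ j y → i = j ∧ x = y
  mem_iff : ∀ i x, ψ i x ∈ V ↔ x ∈ W
  lift : ∀ (n : ℕ) (σ : SingSimplex n E), (∀ x, σ x ∈ Y \ A) → ∃ i τ, σ = (ψ i).comp τ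
  subset : A ⊆ V
  exists_isOpen_inter_eq : ∃ O, IsOpen O ∧ O ∩ Y = V
  exists_isOpen_inter_eq_diff : ∃ O, IsOpen O ∧ O ∩ Y = Y \ A

variable {W : Set B} {Y A V : Set E}

theorem IsChartFamily.apply_mem_chainsWithin (h : IsChartFamily ψ W Y A V) {n : ℕ}
    {z : ι →₀ SingChain n B} (hz : pushforwardFamily ψ n z ∈ chainsWithin V n) (i : ι) :
    z i ∈ chainsWithin W n := by
  have preimage_eq : ψ i ⁻¹' V = W := Set.ext (h.mem_iff i)
  exact preimage_eq ▸ pushforwardFamily_mem_chainsWithin h.inj hz i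

theorem IsChartFamily.exists_subdivide_iterate (h : IsChartFamily ψ W Y A V) {n : ℕ}
    {c : SingChain n E} (hc : c ∈ chainsWithin Y n) :
    ∃ m, ∃ z, ∃ b ∈ chainsWithin V n, pushforwardFamily ψ n z + b = (subdivide n)^[m] c := by
  obtain ⟨O, isOpen_O, O_inter⟩ := h.exists_isOpen_inter_eq
  obtain ⟨P, isOpen_P, P_inter⟩ := h.exists_isOpen_inter_eq_diff
  let U : Bool → Set E := fun b => if b then P else O
  have isOpen_U : ∀ b, IsOpen (U b) := by
    rintro (_ | _)
    exacts [isOpen_O, isOpen_P]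
  have subset_iUnion : Y ⊆ ⋃ b, U b := fun y hy => by
    by_cases hA : y ∈ A
    · have mem_O : y ∈ O ∩ Y := O_inter.symm ▸ h.subset hA
      exact Set.mem_iUnion.2 ⟨false, mem_O.1⟩
    · have mem_P : y ∈ P ∩ Y := P_inter.symm ▸ ⟨hy, hA⟩
      exact Set.mem_iUnion.2 ⟨true, mem_P.1⟩
  obtain ⟨m, hm⟩ := exists_subdivide_iterate_mem_smallChains isOpen_U subset_iUnion hc
  obtain ⟨a, ha, b, hb, add_eq⟩ := exists_add_of_mem_smallChains hm
  obtain ⟨z, rfl⟩ := exists_pushforwardFamily_eq h.lift (P_inter ▸ ha)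
  exact ⟨m, z, b, O_inter ▸ hb, add_eq⟩

/-- The push-forwards along the maps `ψ i` identify the direct sum of copies of the relative
homology group `H_k(B, W)`, one for each index, with `H_k(Y, A)`. This is expressed on the level of
cycles: the first field is injectivity, the second surjectivity. -/
structure IsHomologyDecomposition (ψ : ι → C(B, E)) (W : Set B) (Y A : Set E) (k : ℕ) : Prop where
  mem_pairBoundaries {z : ι →₀ SingChain k B} : (∀ i, z i ∈ pairCycles Set.univ W k) →
    pushforwardFamily ψ k z ∈ pairBoundaries Y A k → ∀ i, z i ∈ pairBoundaries Set.univ W k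
  exists_sub_mem {c : SingChain k E} : c ∈ pairCycles Y A k →
    ∃ z : ι →₀ SingChain k B, (∀ i, z i ∈ pairCycles Set.univ W k) ∧
      c - pushforwardFamily ψ k z ∈ pairBoundaries Y A k

theorem IsChartFamily.mem_pairBoundaries_of_pushforwardFamily (h : IsChartFamily ψ W Y A V) {k : ℕ}
    {z : ι →₀ SingChain k B} (hz : ∀ i, z i ∈ pairCycles Set.univ W k)
    (hb : pushforwardFamily ψ k z ∈ pairBoundaries Y V k) (i : ι) :
    z i ∈ pairBoundaries Set.univ W k := by
  obtain ⟨b, hb, a, ha, z_eq⟩ := mem_pairBoundaries.1 hb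
  obtain ⟨m, y, b', hb', b_eq⟩ := h.exists_subdivide_iterate hb
  have push_eq : pushforwardFamily ψ k (Finsupp.mapRange.linearMap (subdivide k ^ m) z -
      Finsupp.mapRange.linearMap (boundary k) y) = boundary k b' + (subdivide k)^[m] a := by
    rw [map_sub, ← subdivide_iterate_pushforwardFamily, ← z_eq, ← pushforwardFamily_comm ψ
      (boundary k) (boundary k) (fun i c => boundary_pushforward _ _ _), iterate_map_add,
      ← boundary_subdivide_iterate, ← b_eq, map_add]
    abel
  have diff_mem := h.apply_mem_chainsWithin
    (push_eq ▸ add_mem (boundary_mem_chainsWithin hb') (subdivide_iterate_mem_chainsWithin ha m)) i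
  rw [Finsupp.sub_apply, Finsupp.mapRange.linearMap_apply, Finsupp.mapRange.linearMap_apply,
    Finsupp.mapRange_apply, Finsupp.mapRange_apply, Module.End.coe_pow] at diff_mem
  have subdivided_mem : (subdivide k)^[m] (z i) ∈ pairBoundaries Set.univ W k :=
    mem_pairBoundaries.2 ⟨y i, mem_chainsWithin_univ _, _, diff_mem, add_sub_cancel _ _⟩
  simpa only [sub_add_cancel] using
    add_mem (sub_subdivide_iterate_mem_pairBoundaries (hz i) m) subdivided_mem

theorem IsChartFamily.exists_sub_pushforwardFamily_mem (h : IsChartFamily ψ W Y A V) {k : ℕ}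
    {c : SingChain k E} (hc : c ∈ pairCycles Y V k) :
    ∃ z : ι →₀ SingChain k B,
      (∀ i, z i ∈ pairCycles Set.univ W k) ∧
      c - pushforwardFamily ψ k z ∈ pairBoundaries Y V k := by
  obtain ⟨m, z, b, hb, push_add⟩ := h.exists_subdivide_iterate hc.1
  have push_eq : pushforwardFamily ψ k z = (subdivide k)^[m] c - b := eq_sub_of_add_eq push_add
  refine ⟨z, fun i => ⟨mem_chainsWithin_univ _, ?_⟩, ?_⟩
  · have boundary_mem : boundaryPred k (pushforwardFamily ψ k z) ∈ chainsWithin V (k - 1) := by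
      rw [push_eq, map_sub]
      exact sub_mem (subdivide_iterate_mem_pairCycles hc m).2 (boundaryPred_mem_chainsWithin hb)
    rw [pushforwardFamily_comm ψ (boundaryPred k) (boundaryPred k)
      (fun i c => boundaryPred_pushforward _ _ _)] at boundary_mem
    simpa using h.apply_mem_chainsWithin boundary_mem i
  · rw [push_eq, sub_sub_eq_add_sub, add_sub_right_comm]
    exact add_mem (sub_subdivide_iterate_mem_pairBoundaries hc m)
      (mem_pairBoundaries.2 ⟨0, zero_mem _, b, hb, by simp⟩)

theorem IsChartFamily.isHomologyDecomposition (h : IsChartFamily ψ W Y A V) (k : ℕ) :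
    IsHomologyDecomposition ψ W Y V k :=
  ⟨h.mem_pairBoundaries_of_pushforwardFamily, h.exists_sub_pushforwardFamily_mem⟩

end Excision

/-! ### Deformations of collars -/

section Deformation

variable {E : Type u} [TopologicalSpace E] {B : Type v} [TopologicalSpace B] {ι : Type w}
  {Y A V : Set E} {f : C(unitInterval × Y, E)} {k : ℕ}

/-- The homotopy `f` starts with the inclusion of `Y`, preserves `Y`, `A` and `V`, and at time `1`
has pushed the collar `V` of `A` in `Y` into `A`. -/
structure IsCollarDeformation (f : C(unitInterval × Y, E)) (A V : Set E) : Prop where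
  subset : A ⊆ V
  collar_subset : V ⊆ Y
  homotopyAt_zero : homotopyAt f 0 = incl Y
  mem : ∀ z, f z ∈ Y
  mem_of_mem : ∀ t (x : Y), (x : E) ∈ A → f (t, x) ∈ A
  mem_collar : ∀ t (x : Y), (x : E) ∈ V → f (t, x) ∈ V
  one_mem : ∀ x : Y, (x : E) ∈ V → f (1, x) ∈ A

theorem IsCollarDeformation.pushforward_sub_mem (h : IsCollarDeformation f A V) {S : Set E}
    (hS : ∀ t (x : Y), (x : E) ∈ S → f (t, x) ∈ S) {c : SingChain k Y}
    (hc : c ∈ pairCycles Set.univ (incl Y ⁻¹' S) k) :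
    pushforward (homotopyAt f 1) k c - pushforward (incl Y) k c ∈ pairBoundaries Y S k :=
  h.homotopyAt_zero ▸ pushforward_sub_mem_pairBoundaries (fun _ _ _ => h.mem _) hS hc

theorem IsCollarDeformation.mem_pairBoundaries_of_collar (h : IsCollarDeformation f A V)
    {c : SingChain k E} (hc : c ∈ pairCycles Y A k) (hc' : c ∈ pairBoundaries Y V k) :
    c ∈ pairBoundaries Y A k := by
  have injective : Function.Injective (incl Y) := Subtype.val_injective
  have exists_eq {n : ℕ} {d : SingChain n E} (hd : d ∈ chainsWithin Y n) :
      ∃ d', pushforward (incl Y) n d' = d :=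
    exists_pushforward_eq Topology.IsInducing.subtypeVal
      ((Subtype.range_val : Set.range (incl Y) = Y).symm ▸ hd)
  obtain ⟨b, hb, a, ha, add_eq⟩ := mem_pairBoundaries.1 hc'
  obtain ⟨c, rfl⟩ := exists_eq hc.1
  obtain ⟨b, rfl⟩ := exists_eq hb
  obtain ⟨a, rfl⟩ := exists_eq (chainsWithin_mono h.collar_subset _ ha)
  have boundary_mem := (mem_pairCycles.1 hc).2
  rw [boundaryPred_pushforward] at boundary_mem
  have moved_sub_mem := h.pushforward_sub_mem h.mem_of_mem
    ⟨mem_chainsWithin_univ c, mem_chainsWithin_of_pushforward injective boundary_mem⟩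
  obtain rfl : boundary k b + a = c := pushforward_injective injective k
    (by rw [map_add, ← boundary_pushforward, add_eq])
  have moved_mem : pushforward (homotopyAt f 1) k (boundary k b + a) ∈ pairBoundaries Y A k :=
    mem_pairBoundaries.2
      ⟨_, pushforward_mem_chainsWithin_of_forall (fun x => h.mem (1, x)) b,
        _, pushforward_mem_chainsWithin (f := homotopyAt f 1) h.one_mem
          (mem_chainsWithin_of_pushforward injective ha),
        by rw [map_add, boundary_pushforward]⟩
  simpa only [sub_sub_cancel] using sub_mem moved_mem moved_sub_mem

theorem pushforwardFamily_mem {ψ : ι → C(B, E)} {N : Submodule ℤ (SingChain k E)}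
    {z : ι →₀ SingChain k B} (h : ∀ i, pushforward (ψ i) k (z i) ∈ N) :
    pushforwardFamily ψ k z ∈ N := by
  rw [pushforwardFamily, Finsupp.lsum_apply]
  exact Submodule.sum_mem _ fun i _ => h i

theorem pushforwardFamily_sub_mem {ψ ψ' : ι → C(B, E)} {N : Submodule ℤ (SingChain k E)}
    {z : ι →₀ SingChain k B} (h : ∀ i, pushforward (ψ' i) k (z i) - pushforward (ψ i) k (z i) ∈ N) :
    pushforwardFamily ψ' k z - pushforwardFamily ψ k z ∈ N := by
  rw [pushforwardFamily, pushforwardFamily, Finsupp.lsum_apply, Finsupp.lsum_apply, Finsupp.sum,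
    Finsupp.sum, ← Finset.sum_sub_distrib]
  exact Submodule.sum_mem _ fun i _ => h i

theorem IsHomologyDecomposition.of_isCollarDeformation {W : Set B} (h : IsCollarDeformation f A V)
    {χ : ι → C(B, Y)} (hχ : ∀ i, ∀ x ∈ W, (χ i x : E) ∈ V) {T : ι → C(E, E)}
    (hTY : ∀ i, Set.MapsTo (T i) Y Y) (hTV : ∀ i, Set.MapsTo (T i) V V)
    (hTA : ∀ i, Set.MapsTo (T i) A A)
    (hd : IsHomologyDecomposition (fun i => (T i).comp ((incl Y).comp (χ i))) W Y V k) :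
    IsHomologyDecomposition (fun i => (T i).comp ((homotopyAt f 1).comp (χ i))) W Y A k := by
  have moved_sub_mem {z : ι →₀ SingChain k B} (hz : ∀ i, z i ∈ pairCycles Set.univ W k) :
      pushforwardFamily (fun i => (T i).comp ((homotopyAt f 1).comp (χ i))) k z -
        pushforwardFamily (fun i => (T i).comp ((incl Y).comp (χ i))) k z ∈
          pairBoundaries Y V k :=
    pushforwardFamily_sub_mem fun i => by
      simpa only [map_sub, pushforward_comp] using
        pushforward_mem_pairBoundaries (hTY i) (hTV i) (h.pushforward_sub_mem h.mem_collar
          (pushforward_mem_pairCycles (f := χ i) (A' := incl Y ⁻¹' V) (Set.mapsTo_univ _ _) (hχ i)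
            (hz i)))
  refine ⟨fun hz hb => hd.mem_pairBoundaries hz ?_, fun hc => ?_⟩
  · simpa only [sub_sub_cancel] using
      sub_mem (pairBoundaries_mono subset_rfl h.subset k hb) (moved_sub_mem hz)
  · obtain ⟨z, hz, sub_mem_collar⟩ := hd.exists_sub_mem (pairCycles_mono subset_rfl h.subset k hc)
    refine ⟨z, hz, h.mem_pairBoundaries_of_collar (sub_mem hc ?_) ?_⟩
    · exact pushforwardFamily_mem fun i => pushforward_mem_pairCycles
        (f := (T i).comp ((homotopyAt f 1).comp (χ i))) (fun _ _ => hTY i (h.mem _))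
        (fun x hx => hTA i (h.one_mem _ (hχ i x hx))) (hz i)
    · simpa only [sub_sub_sub_cancel_right] using sub_mem sub_mem_collar (moved_sub_mem hz)

end Deformation

/-! ### The cells of a covering -/

section LiftedCells

variable {X : Type u} [TopologicalSpace X] {E : Type v} [TopologicalSpace E]

theorem exists_lift_of_convex [PathConnectedSpace X] [Nonempty E] {π : C(E, X)}
    (hπ : IsCoveringMap π) {V : Type w} [NormedAddCommGroup V] [NormedSpace ℝ V] {C : Set V}
    (hC : Convex ℝ C) (nonempty : C.Nonempty) (f : C(C, X)) :
    ∃ Φ : C(C, E), ∀ x, π (Φ x) = f x := by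
  have : LocallyPathConnectedSpace C := hC.locallyPathConnectedSpace
  have : ContractibleSpace C := hC.contractibleSpace nonempty
  obtain ⟨x₀, hx₀⟩ := nonempty
  obtain ⟨e₁, he₁⟩ := surjective_of_isCoveringMap hπ (f ⟨x₀, hx₀⟩)
  obtain ⟨Φ, ⟨-, comp_eq⟩, -⟩ := hπ.existsUnique_continuousMap_lifts f ⟨x₀, hx₀⟩ e₁ he₁
  exact ⟨Φ, congrFun comp_eq⟩

theorem exists_deck_comp_eq [SimplyConnectedSpace E] [LocallyPathConnectedSpace E] {π : C(E, X)}
    {e₀ : E} (hπ : IsCoveringMap π)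
    {T : FundamentalGroup X (π e₀) → C(E, E)} (hT : ∀ g, IsDeck π e₀ g (T g)) {Z : Type*}
    [TopologicalSpace Z] [ConnectedSpace Z] {σ τ : C(Z, E)} (h : ∀ z, π (τ z) = π (σ z)) :
    ∃ g, σ = (T g).comp τ := by
  obtain ⟨z₀⟩ : Nonempty Z := inferInstance
  obtain ⟨g, S, hS, apply_eq⟩ := exists_isDeck_apply_eq (e₀ := e₀) hπ (h z₀).symm
  obtain rfl := hS.unique hπ (hT g)
  exact ⟨g, DFunLike.coe_injective (hπ.eq_of_comp_eq σ.continuous (ContinuousMap.continuous _)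
    (funext fun z => ((hS.1 _).trans (h z)).symm) z₀ apply_eq.symm)⟩

variable [Topology.CWComplex (Set.univ : Set X)]

/-- The inclusion of the open ball in the closed ball. -/
def openBallInclusion (k : ℕ) : C(unitBall (Fin k → ℝ), ClosedUnitBall k) :=
  ⟨fun x => ⟨x, Metric.ball_subset_closedBall x.2⟩, by fun_prop⟩

theorem norm_openBallInclusion_lt {k : ℕ} (x : unitBall (Fin k → ℝ)) :
    ‖(openBallInclusion k x : Fin k → ℝ)‖ < 1 :=
  mem_ball_zero_iff.1 x.2

theorem openBallInclusion_injective (k : ℕ) : Function.Injective (openBallInclusion k) :=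
  fun _ _ h => Subtype.ext (congrArg (fun z : ClosedUnitBall k => (z : Fin k → ℝ)) h)

theorem continuous_of_continuous_charMap {Z : Type*} [TopologicalSpace Z] {k : ℕ} {e : Cell X k}
    {y : Z → Fin k → ℝ} (hy : ∀ z, ‖y z‖ < 1)
    (h : Continuous fun z => Topology.RelCWComplex.map k e (y z)) :
    Continuous y := by
  have mem_source (z : Z) : y z ∈ (Topology.RelCWComplex.map k e).source := by
    rw [Topology.RelCWComplex.source_eq]
    exact mem_ball_zero_iff.2 (hy z)
  have continuous_symm := (Topology.RelCWComplex.continuousOn_symm k e).comp_continuous h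
    fun z => PartialEquiv.map_source _ (mem_source z)
  exact continuous_symm.congr fun z => PartialEquiv.left_inv _ (mem_source z)

variable [T2Space X]

theorem norm_lt_one_of_charMap_notMem_skel {k : ℕ} {e : Cell X k} {y : ClosedUnitBall k}
    (h : charMap e y ∉ skel X k) : ‖(y : Fin k → ℝ)‖ < 1 :=
  (norm_closedUnitBall_le y).lt_of_ne fun norm_eq => h ((charMap_mem_skel_iff e y).2 norm_eq)

/-- The part of the preimage of a skeleton outside the half-size cells, which deforms into the
preimage of the preceding skeleton. -/
def liftedCollar (π : C(E, X)) (k : ℕ) : Set E :=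
  liftedSkeleta π (k + 1) \ π ⁻¹' halfCells X k

theorem liftedSkeleta_subset_succ (π : C(E, X)) (k : ℕ) :
    liftedSkeleta π k ⊆ liftedSkeleta π (k + 1) :=
  Set.preimage_mono (skel_subset_succ k)

theorem liftedSkeleta_subset_collar (π : C(E, X)) (k : ℕ) : liftedSkeleta π k ⊆ liftedCollar π k :=
  fun _ hx => ⟨liftedSkeleta_subset_succ π k hx, notMem_halfCells_of_mem_skel hx⟩

theorem IsDeck.mapsTo_liftedCollar {π : C(E, X)} {e₀ : E} {g : FundamentalGroup X (π e₀)}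
    {T : C(E, E)} (h : IsDeck π e₀ g T) (k : ℕ) :
    Set.MapsTo T (liftedCollar π k) (liftedCollar π k) := fun x hx => by
  refine ⟨h.mapsTo _ hx.1, ?_⟩
  rw [Set.mem_preimage, h.1]
  exact hx.2

theorem mem_liftedCollar_iff {π : C(E, X)} {k : ℕ} {e : Cell X k} {y : ClosedUnitBall k} {x : E}
    (h : π x = charMap e y) :
    x ∈ liftedCollar π k ↔ 1 / 2 < ‖(y : Fin k → ℝ)‖ := by
  rw [liftedCollar, Set.mem_sdiff, liftedSkeleta, Set.mem_preimage, Set.mem_preimage, h,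
    charMap_mem_halfCells_iff, not_le]
  exact and_iff_right (charMap_mem_skel_succ e y)

variable [Topology.CWComplex.Finite (Set.univ : Set X)]

theorem exists_forall_mem_range_charMap {Z : Type*} [TopologicalSpace Z] [ConnectedSpace Z] {k : ℕ}
    (f : C(Z, X)) (h : ∀ z, f z ∈ skel X (k + 1)) (h' : ∀ z, f z ∉ skel X k) :
    ∃ e : Cell X k, ∀ z, f z ∈ Set.range (charMap e) := by
  choose e y hy using fun z => (mem_skel_succ (h z)).resolve_left (h' z)
  have norm_lt {z : Z} {c : Cell X k} {w : ClosedUnitBall k} (hw : charMap c w = f z) :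
      ‖(w : Fin k → ℝ)‖ < 1 := norm_lt_one_of_charMap_notMem_skel (hw ▸ h' z)
  let _ : TopologicalSpace (Cell X k) := ⊥
  have : DiscreteTopology (Cell X k) := ⟨rfl⟩
  have preimage_eq (s : Set (Cell X k)) : e ⁻¹' s = ⋃ c ∈ s, f ⁻¹' Set.range (charMap c) := by
    ext z
    simp only [Set.mem_preimage, Set.mem_iUnion, Set.mem_range, exists_prop]
    constructor
    · exact fun hz => ⟨e z, hz, y z, hy z⟩
    · rintro ⟨c, hc, w, hw⟩
      obtain ⟨rfl, -⟩ := eq_of_charMap_eq (hw.trans (hy z).symm) (norm_lt hw) (norm_lt (hy z))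
      exact hc
  have continuous_e : Continuous e := continuous_iff_isClosed.2 fun s _ => by
    rw [preimage_eq]
    exact s.toFinite.isClosed_biUnion fun c _ =>
      (isCompact_range (charMap c).continuous).isClosed.preimage f.continuous
  obtain ⟨z₀⟩ : Nonempty Z := inferInstance
  refine ⟨e z₀, fun z => ⟨y z, ?_⟩⟩
  rw [← PreconnectedSpace.constant (x := z) inferInstance continuous_e]
  exact hy z

theorem exists_factor_charMap {Z : Type*} [TopologicalSpace Z] [ConnectedSpace Z] {k : ℕ}
    (f : C(Z, X)) (h : ∀ z, f z ∈ skel X (k + 1)) (h' : ∀ z, f z ∉ skel X k) :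
    ∃ (e : Cell X k) (τ : C(Z, unitBall (Fin k → ℝ))),
      ∀ z, charMap e (openBallInclusion k (τ z)) = f z := by
  obtain ⟨e, mem_range⟩ := exists_forall_mem_range_charMap f h h'
  choose y hy using mem_range
  have norm_lt (z : Z) : ‖(y z : Fin k → ℝ)‖ < 1 :=
    norm_lt_one_of_charMap_notMem_skel (e := e) (hy z ▸ h' z)
  have continuous_y : Continuous fun z => (y z : Fin k → ℝ) :=
    continuous_of_continuous_charMap norm_lt (f.continuous.congr fun z => (hy z).symm)
  exact ⟨e, ⟨fun z => ⟨y z, mem_ball_zero_iff.2 (norm_lt z)⟩, continuous_y.subtype_mk _⟩, hy⟩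

variable {π : C(E, X)}

/-- The homotopy `skelStretch` composed with the covering map. -/
def stretchOfLifted (π : C(E, X)) (k : ℕ) : C(unitInterval × liftedSkeleta π (k + 1), X) :=
  ⟨fun z => skelStretch X k (z.1, ⟨π z.2, z.2.2⟩), by fun_prop⟩

/-- The lift to the covering, starting at the inclusion, of the homotopy `skelStretch`. -/
def liftedStretch (hπ : IsCoveringMap π) (k : ℕ) :
    C(unitInterval × liftedSkeleta π (k + 1), E) :=
  hπ.liftHomotopy (stretchOfLifted π k) (incl _) fun _ => skelStretch_zero _

theorem map_liftedStretch (hπ : IsCoveringMap π) {k : ℕ} (t : unitInterval)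
    (x : liftedSkeleta π (k + 1)) :
    π (liftedStretch hπ k (t, x)) = skelStretch X k (t, ⟨π x, x.2⟩) :=
  congrFun (hπ.liftHomotopy_lifts (stretchOfLifted π k) (incl _) _) (t, x)

theorem homotopyAt_liftedStretch_zero (hπ : IsCoveringMap π) (k : ℕ) :
    homotopyAt (liftedStretch hπ k) 0 = incl _ :=
  ContinuousMap.ext
    (hπ.liftHomotopy_zero (stretchOfLifted π k) (incl _) fun _ => skelStretch_zero _)

theorem isCollarDeformation_liftedStretch (hπ : IsCoveringMap π) (k : ℕ) :
    IsCollarDeformation (liftedStretch hπ k) (liftedSkeleta π k) (liftedCollar π k) := by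
  have mem (z : unitInterval × liftedSkeleta π (k + 1)) :
      π (liftedStretch hπ k z) ∈ skel X (k + 1) :=
    map_liftedStretch hπ z.1 z.2 ▸ skelStretch_mem_skel_succ z.1 z.2.2
  refine ⟨liftedSkeleta_subset_collar π k, Set.sdiff_subset,
    homotopyAt_liftedStretch_zero hπ k, mem, fun t x hx => ?_,
    fun t x hx => ⟨mem _, ?_⟩, fun x hx => ?_⟩
  · have fixed := map_liftedStretch hπ t x
    rw [skelStretch_of_mem_skel t hx] at fixed
    exact Set.mem_preimage.2 (fixed ▸ hx)
  · rw [Set.mem_preimage, map_liftedStretch]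
    exact skelStretch_notMem_halfCells t x.2 hx.2
  · rw [liftedSkeleta, Set.mem_preimage, map_liftedStretch]
    exact skelStretch_one_mem_skel x.2 hx.2

variable [SimplyConnectedSpace E] [LocallyPathConnectedSpace E]

theorem isChartFamily_lift (hπ : IsCoveringMap π) {e₀ : E} {k : ℕ}
    {Φ : Cell X k → C(unitBall (Fin k → ℝ), E)}
    (hΦ : ∀ e x, π (Φ e x) = charMap e (openBallInclusion k x))
    {T : FundamentalGroup X (π e₀) → C(E, E)} (hT : ∀ g, IsDeck π e₀ g (T g)) :
    IsChartFamily (fun i : Cell X k × FundamentalGroup X (π e₀) => (T i.2).comp (Φ i.1))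
      (ballCollar (Fin k → ℝ)) (liftedSkeleta π (k + 1)) (liftedSkeleta π k)
      (liftedCollar π k) where
  inj := by
    rintro ⟨e, g⟩ ⟨e', g'⟩ x y (h : T g (Φ e x) = T g' (Φ e' y))
    have charMap_eq := congrArg π h
    rw [(hT g).1, (hT g').1, hΦ, hΦ] at charMap_eq
    obtain ⟨rfl, eq⟩ := eq_of_charMap_eq charMap_eq (norm_openBallInclusion_lt x)
      (norm_openBallInclusion_lt y)
    obtain rfl := openBallInclusion_injective k eq
    exact ⟨by rw [(hT g).eq_of_apply_eq hπ (hT g') h], rfl⟩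
  mem_iff := fun ⟨e, g⟩ x => mem_liftedCollar_iff (((hT g).1 _).trans (hΦ e x))
  lift := by
    intro n σ hσ
    obtain ⟨e, τ, hτ⟩ := exists_factor_charMap (π.comp σ) (fun z => (hσ z).1) (fun z => (hσ z).2)
    obtain ⟨g, hg⟩ := exists_deck_comp_eq hπ hT (σ := σ) (τ := (Φ e).comp τ)
      fun x => (hΦ e _).trans (hτ x)
    exact ⟨(e, g), τ, hg⟩
  subset := liftedSkeleta_subset_collar π k
  exists_isOpen_inter_eq := ⟨(π ⁻¹' halfCells X k)ᶜ,
    ((isClosed_halfCells k).preimage π.continuous).isOpen_compl, by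
      rw [Set.inter_comm, ← Set.sdiff_eq, liftedCollar]⟩
  exists_isOpen_inter_eq_diff := ⟨(liftedSkeleta π k)ᶜ,
    ((isClosed_skel k).preimage π.continuous).isOpen_compl, by
      rw [Set.inter_comm, ← Set.sdiff_eq]⟩

theorem exists_cell_charts [PathConnectedSpace X] (hπ : IsCoveringMap π) (e₀ : E) (k : ℕ) :
    ∃ θ : Cell X k → C(unitBall (Fin k → ℝ), E),
      (∀ e x, θ e x ∈ liftedSkeleta π (k + 1)) ∧
      (∀ e, ∀ x ∈ ballCollar (Fin k → ℝ), θ e x ∈ liftedSkeleta π k) ∧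
      ∀ T : FundamentalGroup X (π e₀) → C(E, E), (∀ g, IsDeck π e₀ g (T g)) →
        IsHomologyDecomposition
          (fun i : Cell X k × FundamentalGroup X (π e₀) => (T i.2).comp (θ i.1))
          (ballCollar (Fin k → ℝ)) (liftedSkeleta π (k + 1)) (liftedSkeleta π k) k := by
  choose Φ hΦ using fun e : Cell X k =>
    exists_lift_of_convex hπ (convex_unitBall (Fin k → ℝ)) ⟨0, by simp⟩
      ((charMap e).comp (openBallInclusion k))
  let χ (e : Cell X k) : C(unitBall (Fin k → ℝ), liftedSkeleta π (k + 1)) :=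
    ⟨fun x => ⟨Φ e x, by
      rw [liftedSkeleta, Set.mem_preimage, hΦ]
      exact charMap_mem_skel_succ e _⟩, by fun_prop⟩
  have collar (e : Cell X k) : ∀ x ∈ ballCollar (Fin k → ℝ), (χ e x : E) ∈ liftedCollar π k :=
    fun x hx => (mem_liftedCollar_iff (hΦ e x)).2 hx
  have deformation := isCollarDeformation_liftedStretch hπ k
  refine ⟨fun e => (homotopyAt (liftedStretch hπ k) 1).comp (χ e), fun e x => deformation.mem _,
    fun e x hx => deformation.one_mem _ (collar e x hx), fun T hT => ?_⟩
  have decomposition := (isChartFamily_lift (Φ := fun e => (incl _).comp (χ e)) hπ hΦ hT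
    ).isHomologyDecomposition k
  exact IsHomologyDecomposition.of_isCollarDeformation
    (χ := fun i : Cell X k × FundamentalGroup X (π e₀) => χ i.1) (T := fun i => T i.2) deformation
    (fun i => collar i.1) (fun i => (hT i.2).mapsTo _)
    (fun i => (hT i.2).mapsTo_liftedCollar k) (fun i => (hT i.2).mapsTo k) decomposition

end LiftedCells

/-! ### Cellular chains in terms of concrete singular chains -/

section Transfer

variable {E : Type v} [TopologicalSpace E]

theorem singChainsEquiv_mem_chainsWithin {A : Set E} {k : ℕ} {c : (singChains E).X k} :
    singChainsEquiv k E c ∈ chainsWithin A k ↔ c ∈ chainsIn A k := by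
  constructor
  · intro h
    obtain ⟨b, pushforward_b⟩ := exists_pushforward_eq (f := incl A)
      Topology.IsInducing.subtypeVal ((Subtype.range_val : Set.range (incl A) = A).symm ▸ h)
    refine ⟨(singChainsEquiv k A).symm b, (singChainsEquiv k E).injective ?_⟩
    rw [singChainsEquiv_push, AddEquiv.apply_symm_apply, pushforward_b]
  · rintro ⟨y, rfl⟩
    rw [singChainsEquiv_push]
    exact pushforward_mem_chainsWithin_of_forall (fun x => x.2) _

theorem singChainsEquiv_mem_pairCycles {F : ℕ → Set E} {k : ℕ} {c : (singChains E).X k} :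
    singChainsEquiv k E c ∈ pairCycles (F (k + 1)) (F k) k ↔ c ∈ relCycles F k := by
  rw [mem_relCycles, mem_pairCycles, singChainsEquiv_mem_chainsWithin]
  refine and_congr_right fun _ => ?_
  have bd_eq_zero (j : ℕ) (hj : j + 1 ≠ k) : bd E k j c = 0 :=
    congrArg (fun m => m.hom c) ((singChains E).shape k j hj)
  cases k with
  | zero =>
    refine iff_of_true (by simp [boundaryPred]) fun j => ?_
    rw [bd_eq_zero j (Nat.succ_ne_zero j)]
    exact zero_mem _
  | succ k =>
    change boundary k (singChainsEquiv (k + 1) E c) ∈ chainsWithin _ k ↔ _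
    rw [← singChainsEquiv_bd, singChainsEquiv_mem_chainsWithin]
    refine ⟨fun h j => ?_, fun h => h k⟩
    by_cases hj : j = k
    · exact hj ▸ h
    · rw [bd_eq_zero j (by omega)]
      exact zero_mem _

theorem singChainsEquiv_mem_pairBoundaries {F : ℕ → Set E} {k : ℕ} {c : (singChains E).X k} :
    singChainsEquiv k E c ∈ pairBoundaries (F (k + 1)) (F k) k ↔ c ∈ relBoundaries F k := by
  rw [mem_pairBoundaries, relBoundaries, AddSubgroup.mem_sup]
  constructor
  · rintro ⟨b, hb, a, ha, h⟩
    refine ⟨_, ⟨(singChainsEquiv (k + 1) E).symm b, singChainsEquiv_mem_chainsWithin.1 ?_, rfl⟩,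
      (singChainsEquiv k E).symm a, singChainsEquiv_mem_chainsWithin.1 ?_,
        (singChainsEquiv k E).injective ?_⟩
    · rwa [AddEquiv.apply_symm_apply]
    · rwa [AddEquiv.apply_symm_apply]
    · rw [map_add, singChainsEquiv_bd, AddEquiv.apply_symm_apply, AddEquiv.apply_symm_apply, h]
  · rintro ⟨_, ⟨b, hb, rfl⟩, a, ha, rfl⟩
    exact ⟨_, singChainsEquiv_mem_chainsWithin.2 hb, _, singChainsEquiv_mem_chainsWithin.2 ha, by
      rw [map_add, singChainsEquiv_bd]⟩

/-- The class in the cellular chains of a relative cycle, given as a concrete singular chain. -/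
def cellClass (F : ℕ → Set E) (k : ℕ) : pairCycles (F (k + 1)) (F k) k →+ CellChains F k :=
  (QuotientAddGroup.mk' _).comp
    (((singChainsEquiv k E).symm.toAddMonoidHom.comp
      (pairCycles (F (k + 1)) (F k) k).subtype.toAddMonoidHom).codRestrict (relCycles F k) fun c =>
        singChainsEquiv_mem_pairCycles.1
          (((singChainsEquiv k E).apply_symm_apply (c : SingChain k E)).symm ▸ c.2))

theorem cellClass_eq_zero {F : ℕ → Set E} {k : ℕ} {c : pairCycles (F (k + 1)) (F k) k} :
    cellClass F k c = 0 ↔ (c : SingChain k E) ∈ pairBoundaries (F (k + 1)) (F k) k := by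
  refine (QuotientAddGroup.eq_zero_iff _).trans ?_
  rw [AddSubgroup.mem_addSubgroupOf, ← singChainsEquiv_mem_pairBoundaries]
  change singChainsEquiv k E ((singChainsEquiv k E).symm (c : SingChain k E)) ∈ _ ↔ _
  rw [AddEquiv.apply_symm_apply]

theorem cellClass_surjective (F : ℕ → Set E) (k : ℕ) : Function.Surjective (cellClass F k) := by
  intro x
  obtain ⟨c, rfl⟩ := QuotientAddGroup.mk_surjective x
  refine ⟨⟨singChainsEquiv k E c, singChainsEquiv_mem_pairCycles.2 c.2⟩, ?_⟩
  exact congrArg (QuotientAddGroup.mk (s := (relBoundaries F k).addSubgroupOf (relCycles F k)))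
    (Subtype.ext ((singChainsEquiv k E).symm_apply_apply (c : (singChains E).X k)))

theorem cellMap_cellClass {F : ℕ → Set E} {T : C(E, E)} (hT : ∀ j, Set.MapsTo T (F j) (F j)) {k : ℕ}
    (c : pairCycles (F (k + 1)) (F k) k) :
    cellMap T hT k (cellClass F k c) = cellClass F k (pairCyclesMap (hT _) (hT _) k c) := by
  refine congrArg (QuotientAddGroup.mk (s := (relBoundaries F k).addSubgroupOf (relCycles F k)))
    (Subtype.ext ((singChainsEquiv k E).injective ?_))
  refine (singChainsEquiv_push T k _).trans ?_
  change pushforward T k (singChainsEquiv k E ((singChainsEquiv k E).symm (c : SingChain k E))) =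
    singChainsEquiv k E ((singChainsEquiv k E).symm _)
  rw [AddEquiv.apply_symm_apply, AddEquiv.apply_symm_apply]
  rfl

theorem cellMap_comp {F : ℕ → Set E} {S T : C(E, E)} (hS : ∀ j, Set.MapsTo S (F j) (F j))
    (hT : ∀ j, Set.MapsTo T (F j) (F j)) (hST : ∀ j, Set.MapsTo (S.comp T) (F j) (F j)) (k : ℕ)
    (c : CellChains F k) :
    cellMap (S.comp T) hST k c = cellMap S hS k (cellMap T hT k c) := by
  obtain ⟨c, rfl⟩ := cellClass_surjective F k c
  rw [cellMap_cellClass, cellMap_cellClass, cellMap_cellClass]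
  congr 1
  exact Subtype.ext (pushforward_comp T S k c)

end Transfer

/-! ### The cellular chains of the universal covering -/

section Charts

variable {B : Type u} [TopologicalSpace B] {E : Type v} [TopologicalSpace E] {W : Set B}
  {F : ℕ → Set E} {k : ℕ}

/-- The `k`-th singular homology of the pair formed by a space and its subset `W`. -/
abbrev PairHomology (W : Set B) (k : ℕ) : Type u :=
  pairCycles Set.univ W k ⧸ (pairBoundaries Set.univ W k).submoduleOf (pairCycles Set.univ W k)

/-- The homomorphism from the homology of a pair to the cellular chains of a filtration `F` induced
by a map of pairs to `(F (k + 1), F k)`. -/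
def chartClass (θ : C(B, E)) (hθ : Set.MapsTo θ Set.univ (F (k + 1)))
    (hW : Set.MapsTo θ W (F k)) : PairHomology W k →+ CellChains F k :=
  (Submodule.liftQ _
    ((cellClass F k).comp (pairCyclesMap hθ hW k).toAddMonoidHom).toIntLinearMap fun _ hc =>
      cellClass_eq_zero.2 (pushforward_mem_pairBoundaries hθ hW hc)).toAddMonoidHom

theorem chartClass_mk {θ : C(B, E)} (hθ : Set.MapsTo θ Set.univ (F (k + 1)))
    (hW : Set.MapsTo θ W (F k)) (c : pairCycles Set.univ W k) :
    chartClass θ hθ hW (Submodule.Quotient.mk c) = cellClass F k (pairCyclesMap hθ hW k c) :=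
  rfl

theorem cellMap_comp_chartClass {θ : C(B, E)} (hθ : Set.MapsTo θ Set.univ (F (k + 1)))
    (hW : Set.MapsTo θ W (F k)) {T : C(E, E)} (hT : ∀ j, Set.MapsTo T (F j) (F j)) :
    (cellMap T hT k).comp (chartClass θ hθ hW) =
      chartClass (T.comp θ) ((hT _).comp hθ) ((hT _).comp hW) := by
  refine AddMonoidHom.ext fun x => ?_
  obtain ⟨c, rfl⟩ := Submodule.Quotient.mk_surjective _ x
  rw [AddMonoidHom.comp_apply, chartClass_mk, chartClass_mk, cellMap_cellClass]
  exact congrArg _ (Subtype.ext (pushforward_comp θ T k c).symm)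

variable {ι : Type w} {ψ : ι → C(B, E)} (hψ : ∀ i, Set.MapsTo (ψ i) Set.univ (F (k + 1)))
  (hW : ∀ i, Set.MapsTo (ψ i) W (F k))

theorem liftAddHom_chartClass (z : ι →₀ pairCycles Set.univ W k) :
    Finsupp.liftAddHom (fun i => chartClass (ψ i) (hψ i) (hW i))
        (z.mapRange (Submodule.mkQ _) (map_zero _)) =
      cellClass F k ⟨pushforwardFamily ψ k (z.mapRange Subtype.val rfl),
        pushforwardFamily_mem fun i => pushforward_mem_pairCycles (hψ i) (hW i) (z i).2⟩ := by
  classical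
  have coe_sum : ((z.sum fun i c => pairCyclesMap (hψ i) (hW i) k c :
      pairCycles (F (k + 1)) (F k) k) : SingChain k E) =
        pushforwardFamily ψ k (z.mapRange Subtype.val rfl) := by
    rw [pushforwardFamily, Finsupp.lsum_apply,
      Finsupp.sum_mapRange_index fun i => map_zero (pushforward (ψ i) k)]
    exact AddSubmonoidClass.coe_finsetSum _ _
  rw [Finsupp.liftAddHom_apply, Finsupp.sum_mapRange_index fun _ => map_zero _]
  exact (map_finsuppSum (cellClass F k) z _).symm.trans (congrArg _ (Subtype.ext coe_sum))

theorem exists_mapRange_val_eq {z : ι →₀ SingChain k B} (hz : ∀ i, z i ∈ pairCycles Set.univ W k) :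
    ∃ z' : ι →₀ pairCycles (Set.univ : Set B) W k, z'.mapRange Subtype.val rfl = z :=
  ⟨Finsupp.onFinset z.support (fun i => ⟨z i, hz i⟩) fun _ hi =>
    Finsupp.mem_support_iff.2 fun hzi => hi (Subtype.ext hzi), Finsupp.ext fun _ => rfl⟩

theorem IsHomologyDecomposition.bijective_liftAddHom
    (h : IsHomologyDecomposition ψ W (F (k + 1)) (F k) k) :
    Function.Bijective (Finsupp.liftAddHom fun i => chartClass (ψ i) (hψ i) (hW i)) := by
  constructor
  · rw [injective_iff_map_eq_zero]
    intro x hx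
    obtain ⟨z, rfl⟩ := Finsupp.mapRange_surjective _ (map_zero _)
      (Submodule.mkQ_surjective _) x
    rw [liftAddHom_chartClass, cellClass_eq_zero] at hx
    ext i
    exact (Submodule.Quotient.mk_eq_zero _).2 (h.mem_pairBoundaries (fun i => (z i).2) hx i)
  · intro y
    obtain ⟨c, rfl⟩ := cellClass_surjective F k y
    obtain ⟨z, hz, sub_mem⟩ := h.exists_sub_mem c.2
    obtain ⟨z, rfl⟩ := exists_mapRange_val_eq hz
    refine ⟨z.mapRange (Submodule.mkQ _) (map_zero _), ?_⟩
    rw [liftAddHom_chartClass, eq_comm, ← sub_eq_zero, ← map_sub, cellClass_eq_zero]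
    exact sub_mem

end Charts

section Structure

/-- The homology of the open ball relative to its collar, which plays the part of
`H_k(D^k, S^(k-1))`. -/
abbrev BallHomology (k : ℕ) : Type :=
  PairHomology (ballCollar (Fin k → ℝ)) k

instance ballHomology_finite (k : ℕ) : Module.Finite ℤ (BallHomology k) := by
  obtain ⟨N, fg, approx⟩ := exists_fg_approx (Fin k → ℝ) k
  set B := pairBoundaries Set.univ (ballCollar (Fin k → ℝ)) k
  have : Module.Finite ℤ (N.map B.mkQ) := Module.Finite.iff_fg.2 (fg.map _)
  let toQuotient : BallHomology k →ₗ[ℤ] N.map B.mkQ := Submodule.liftQ _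
    ((B.mkQ ∘ₗ Submodule.subtype _).codRestrict (N.map B.mkQ) fun c => by
      obtain ⟨c', hc', sub_mem⟩ := approx c c.2
      exact ⟨c', hc', ((Submodule.Quotient.eq B).2 sub_mem).symm⟩)
    fun _ hc => Subtype.ext ((Submodule.Quotient.mk_eq_zero B).2 hc)
  refine Module.Finite.of_injective toQuotient ?_
  rw [← LinearMap.ker_eq_bot, LinearMap.ker_eq_bot']
  intro x hx
  obtain ⟨c, rfl⟩ := Submodule.Quotient.mk_surjective _ x
  exact (Submodule.Quotient.mk_eq_zero _).2
    ((Submodule.Quotient.mk_eq_zero B).1 (congrArg Subtype.val hx))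

variable {X : Type u} [TopologicalSpace X] [T2Space X] [Topology.CWComplex (Set.univ : Set X)]
  {E : Type v} [TopologicalSpace E]

/-- A decomposition of the cellular `k`-chains of a covering as the direct sum of the translates,
by a family of deck transformations, of copies of `H` indexed by `I`: the chains are the module
over the deck group induced from the abelian group `I →₀ H`. -/
structure DeckBasis (π : C(E, X)) (e₀ : E) (k : ℕ) (I H : Type*) [AddCommGroup H] where
  /-- The deck transformation of a class. -/
  deck : FundamentalGroup X (π e₀) → C(E, E)
  isDeck : ∀ g, IsDeck π e₀ g (deck g)
  /-- The copy of `H` with a given index. -/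
  gen : I → H →+ CellChains (liftedSkeleta π) k
  bijective : Function.Bijective (Finsupp.liftAddHom fun i : I × FundamentalGroup X (π e₀) =>
    (cellMap (deck i.2) (isDeck i.2).mapsTo k).comp (gen i.1))

variable [Topology.CWComplex.Finite (Set.univ : Set X)] [SimplyConnectedSpace E]
  [LocallyPathConnectedSpace E] [PathConnectedSpace X]

theorem nonempty_deckBasis {π : C(E, X)} (hπ : IsCoveringMap π) (e₀ : E) (k : ℕ) :
    Nonempty (DeckBasis π e₀ k (Cell X k) (BallHomology k)) := by
  obtain ⟨θ, mem, mem_of_collar, decomposition⟩ := exists_cell_charts hπ e₀ k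
  choose T hT using fun g : FundamentalGroup X (π e₀) => exists_isDeck hπ g
  have comp_eq := funext fun i : Cell X k × FundamentalGroup X (π e₀) =>
    cellMap_comp_chartClass (fun x _ => mem i.1 x) (mem_of_collar i.1) (hT i.2).mapsTo
  refine ⟨⟨T, hT, fun e => chartClass (θ e) (fun x _ => mem e x) (mem_of_collar e), ?_⟩⟩
  rw [comp_eq]
  exact (decomposition T hT).bijective_liftAddHom _ _

end Structure

/-! ### Ranks of homology modules -/

section Ranks

open Module

theorem finrank_quotient_add_finrank_of_rank_lt_aleph0 {L M : Type*} [CommRing L] [IsDomain L]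
    [AddCommGroup M] [Module L M] (h : Module.rank L M < Cardinal.aleph0) (N : Submodule L M) :
    finrank L (M ⧸ N) + finrank L N = finrank L M := by
  have rank_add := HasRankNullity.rank_quotient_add_rank N
  have toNat_eq := congrArg Cardinal.toNat rank_add
  rwa [Cardinal.toNat_add ((le_self_add.trans rank_add.le).trans_lt h)
    ((le_add_self.trans rank_add.le).trans_lt h)] at toNat_eq

theorem finrank_homology_add {L : Type w} [CommRing L] [IsDomain L]
    (S : ShortComplex (ModuleCat.{max w v} L)) [Module.Finite L S.X₂] :
    finrank L S.homology + finrank L (LinearMap.range S.f.hom) +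
      finrank L (LinearMap.range S.g.hom) = finrank L S.X₂ := by
  have boundaries : finrank L (LinearMap.range S.moduleCatToCycles) =
      finrank L (LinearMap.range S.f.hom) := by
    have map_range : (LinearMap.range S.moduleCatToCycles).map (LinearMap.ker S.g.hom).subtype =
        LinearMap.range S.f.hom := (LinearMap.range_comp _ _).symm
    rw [← map_range]
    exact (Submodule.equivMapOfInjective _ (Submodule.injective_subtype _) _).finrank_eq
  have rank_cycles_lt : Module.rank L (LinearMap.ker S.g.hom) < Cardinal.aleph0 :=
    (Submodule.rank_le _).trans_lt (rank_lt_aleph0 L S.X₂)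
  calc finrank L S.homology + finrank L (LinearMap.range S.f.hom) +
        finrank L (LinearMap.range S.g.hom)
      = finrank L (LinearMap.ker S.g.hom ⧸ LinearMap.range S.moduleCatToCycles) +
          finrank L (LinearMap.range S.moduleCatToCycles) +
            finrank L (S.X₂ ⧸ LinearMap.ker S.g.hom) := by
        rw [S.g.hom.quotKerEquivRange.finrank_eq, boundaries]
        exact congrArg (· + _ + _) S.moduleCatHomologyIso.toLinearEquiv.finrank_eq
    _ = finrank L S.X₂ := by
        rw [finrank_quotient_add_finrank_of_rank_lt_aleph0 rank_cycles_lt, add_comm,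
          finrank_quotient_add_finrank_of_rank_lt_aleph0 (rank_lt_aleph0 L S.X₂)]

theorem finrank_chainComplex_homology_add {L : Type w} [CommRing L] [IsDomain L]
    (C : ChainComplex (ModuleCat.{max w v} L) ℕ) (k : ℕ) [Module.Finite L (C.X k)] :
    finrank L (C.homology k) + finrank L (LinearMap.range (C.d (k + 1) k).hom) +
      finrank L (LinearMap.range (C.d k (k - 1)).hom) = finrank L (C.X k) := by
  have : Module.Finite L (C.sc' (k + 1) k (k - 1)).X₂ := ‹Module.Finite L (C.X k)›
  have next_eq : (ComplexShape.down ℕ).next k = k - 1 := by cases k <;> simp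
  have homology_eq := (ShortComplex.homologyMapIso
    (C.isoSc' (k + 1) k (k - 1) (by simp) next_eq)).toLinearEquiv.finrank_eq
  exact (congrArg (· + _ + _) homology_eq).trans (finrank_homology_add _)

theorem range_eq_localized'_of_isBaseChange {L K : Type*} [CommRing L] [Field K] [Algebra L K]
    [IsDomain L] [IsFractionRing L K] {M N M' N' : Type*} [AddCommGroup M] [AddCommGroup N]
    [AddCommGroup M'] [AddCommGroup N'] [Module L M] [Module L N] [Module L M'] [Module L N']
    [Module K M'] [Module K N'] [IsScalarTower L K M'] [IsScalarTower L K N'] {iM : M →ₗ[L] M'}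
    {iN : N →ₗ[L] N'} [IsLocalizedModule (nonZeroDivisors L) iN] (hM : IsBaseChange K iM)
    {d : M →ₗ[L] N} {d' : M' →ₗ[K] N'} (h : ∀ x, d' (iM x) = iN (d x)) :
    LinearMap.range d' = (LinearMap.range d).localized' K (nonZeroDivisors L) iN := by
  rw [Submodule.localized'_eq_span]
  refine le_antisymm ?_ (Submodule.span_le.2 ?_)
  · rintro _ ⟨x, rfl⟩
    induction x using hM.inductionOn with
    | zero => exact map_zero d' ▸ zero_mem _
    | tmul m => exact h m ▸ Submodule.subset_span ⟨_, ⟨m, rfl⟩, rfl⟩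
    | smul s x hx => exact map_smul d' s x ▸ Submodule.smul_mem _ s hx
    | add x y hx hy => exact map_add d' x y ▸ add_mem hx hy
  · rintro _ ⟨_, ⟨m, rfl⟩, rfl⟩
    exact ⟨iM m, h m⟩

theorem finrank_range_eq_of_isFractionRing {L K : Type*} [CommRing L] [IsDomain L] [Field K]
    [Algebra L K] [IsFractionRing L K] {M N M' N' : Type*} [AddCommGroup M] [AddCommGroup N]
    [AddCommGroup M'] [AddCommGroup N'] [Module L M] [Module L N] [Module L M'] [Module L N']
    [Module K M'] [Module K N'] [IsScalarTower L K M'] [IsScalarTower L K N'] {iM : M →ₗ[L] M'}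
    {iN : N →ₗ[L] N'} (hM : IsBaseChange K iM) (hN : IsBaseChange K iN) {d : M →ₗ[L] N}
    {d' : M' →ₗ[K] N'} (h : ∀ x, d' (iM x) = iN (d x)) :
    finrank K (LinearMap.range d') = finrank L (LinearMap.range d) := by
  have : IsLocalizedModule (nonZeroDivisors L) iN :=
    (isLocalizedModule_iff_isBaseChange (nonZeroDivisors L) K iN).2 hN
  rw [range_eq_localized'_of_isBaseChange hM h,
    IsLocalization.finrank_eq K (nonZeroDivisors L) le_rfl]
  exact IsLocalizedModule.finrank_eq (nonZeroDivisors L)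
    (Submodule.toLocalized' K (nonZeroDivisors L) iN (LinearMap.range d)) le_rfl

end Ranks

/-! ### Minors -/

section Minors

open Module Matrix

theorem exists_linearIndependent_cols {K m n : Type*} [Field K] [Finite m] [Fintype n]
    (A : Matrix m n K) {s : ℕ} (hs : A.rank = s) :
    ∃ c : Fin s → n, LinearIndependent K fun i => A.col (c i) := by
  subst hs
  rw [rank_eq_finrank_span_cols]
  obtain ⟨f, mem_range, -, linearIndependent⟩ :=
    Submodule.exists_fun_fin_finrank_span_eq K (Set.range A.col)
  choose c hc using mem_range
  exact ⟨c, by simpa only [hc] using linearIndependent⟩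

theorem exists_det_submatrix_ne_zero {K m n : Type*} [Field K] [Finite m] [Fintype n]
    (A : Matrix m n K) :
    ∃ (r : Fin A.rank → m) (c : Fin A.rank → n), (A.submatrix r c).det ≠ 0 := by
  have := Fintype.ofFinite m
  obtain ⟨c, independent_cols⟩ := exists_linearIndependent_cols A rfl
  have rank_eq : (A.submatrix id c)ᵀ.rank = A.rank := by
    have independent_rows : LinearIndependent K (A.submatrix id c)ᵀ.row := independent_cols
    rw [independent_rows.rank_matrix, Fintype.card_fin]
  obtain ⟨r, hr⟩ := exists_linearIndependent_cols (A.submatrix id c)ᵀ rank_eq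
  have independent_rows : LinearIndependent K (A.submatrix r c).row := hr
  rw [linearIndependent_rows_iff_isUnit, isUnit_iff_isUnit_det] at independent_rows
  exact ⟨r, c, independent_rows.ne_zero⟩

theorem rank_map_le_rank_map {S K K' m n : Type*} [CommRing S] [Field K] [Field K'] [Finite m]
    [Fintype n] {A : Matrix m n S} {f : S →+* K} {f' : S →+* K'}
    (h : ∀ s ≤ Fintype.card n, ∀ (r : Fin s → m) (c : Fin s → n),
      f' (A.submatrix r c).det ≠ 0 → f (A.submatrix r c).det ≠ 0) :
    (A.map f').rank ≤ (A.map f).rank := by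
  obtain ⟨r, c, det_ne_zero⟩ := exists_det_submatrix_ne_zero (A.map f')
  have minor_ne_zero : f (A.submatrix r c).det ≠ 0 := h _ (rank_le_card_width _) r c (by
    rw [RingHom.map_det]
    exact det_ne_zero)
  rw [RingHom.map_det] at minor_ne_zero
  calc (A.map f').rank = ((A.map f).submatrix r c).rank :=
        ((rank_of_det_ne_zero minor_ne_zero).trans (Fintype.card_fin _)).symm
    _ ≤ (A.map f).rank := rank_submatrix_le _ r c

end Minors

/-! ### Change of coefficients -/

section BaseChange

variable {X : Type u} [TopologicalSpace X] [T2Space X] [Topology.CWComplex (Set.univ : Set X)]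
  {E : Type v} [TopologicalSpace E] {π : C(E, X)} {e₀ : E} {l : ℕ}
  {S K : Type w} [CommRing S] [CommRing K] [Algebra S K]

/-- The extension of scalars to an algebra `K` of a matrix representation. -/
abbrev extendRep {G : Type*} [Group G] (K : Type w) [CommRing K] [Algebra S K]
    (σ : G →* Matrix.GeneralLinearGroup (Fin l) S) :
    G →* Matrix.GeneralLinearGroup (Fin l) K :=
  (Matrix.GeneralLinearGroup.map (algebraMap S K)).comp σ

/-- The map of free modules of rank `l` which applies the structure map of an algebra to each
coordinate: the base-change map on the coefficients of twisted chains. -/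
def coordMap (S K : Type w) [CommRing S] [CommRing K] [Algebra S K] (l : ℕ) :
    (Fin l → S) →ₗ[S] (Fin l → K) :=
  (Algebra.linearMap S K).compLeft (Fin l)

theorem coordMap_mulVec {G : Type*} [Group G] (σ : G →* Matrix.GeneralLinearGroup (Fin l) S) (g : G)
    (v : Fin l → S) :
    coordMap S K l ((σ g : Matrix (Fin l) (Fin l) S).mulVec v) =
      (extendRep K σ g : Matrix (Fin l) (Fin l) K).mulVec (coordMap S K l v) := by
  ext i
  exact RingHom.map_mulVec (algebraMap S K) _ _ i

theorem linearMap_ext_coordMap {N : Type*} [AddCommGroup N] [Module K N] {A B : (Fin l → K) →ₗ[K] N}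
    (h : ∀ v, A (coordMap S K l v) = B (coordMap S K l v)) :
    A = B := by
  refine LinearMap.pi_ext' fun i => LinearMap.ext_ring ?_
  have single_eq : coordMap S K l (Pi.single i 1) = Pi.single i 1 := by
    ext j
    by_cases hj : j = i
    · subst hj
      simp [coordMap]
    · simp [coordMap, hj]
  change A (Pi.single i 1) = B (Pi.single i 1)
  rw [← single_eq, h]

variable (σ : FundamentalGroup X (π e₀) →* Matrix.GeneralLinearGroup (Fin l) S)

theorem mk_tmul_cellMap (k : ℕ) {g : FundamentalGroup X (π e₀)} {T : C(E, E)} (hT : IsDeck π e₀ g T)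
    (v : Fin l → S) (c : CellChains (liftedSkeleta π) k) :
    (twistedRel π e₀ σ k).mkQ (v ⊗ₜ[ℤ] cellMap T hT.mapsTo k c) =
      (twistedRel π e₀ σ k).mkQ ((σ g : Matrix (Fin l) (Fin l) S).mulVec v ⊗ₜ[ℤ] c) :=
  (Submodule.Quotient.eq _).2 (Submodule.subset_span ⟨g, T, hT, v, c, rfl⟩)

variable (K)

/-- The map of twisted chains which extends the scalars of the coefficients. -/
def twistedExtend (k : ℕ) : TwistedChains π e₀ σ k →ₗ[S] TwistedChains π e₀ (extendRep K σ) k :=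
  (twistedRel π e₀ σ k).liftQ (((twistedRel π e₀ (extendRep K σ) k).mkQ.restrictScalars S) ∘ₗ
    AlgebraTensorModule.map (coordMap S K l) LinearMap.id) (by
    refine Submodule.span_le.2 ?_
    rintro _ ⟨g, T, hT, v, c, rfl⟩
    rw [SetLike.mem_coe, LinearMap.mem_ker, map_sub, sub_eq_zero]
    refine (mk_tmul_cellMap (extendRep K σ) k hT (coordMap S K l v) c).trans ?_
    rw [← coordMap_mulVec]
    rfl)

theorem twistedChains_induction {k : ℕ} {p : TwistedChains π e₀ σ k → Prop}
    (tmul : ∀ v c, p ((twistedRel π e₀ σ k).mkQ (v ⊗ₜ c)))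
    (add : ∀ x y, p x → p y → p (x + y))
    (x : TwistedChains π e₀ σ k) :
    p x := by
  obtain ⟨x, rfl⟩ := Submodule.Quotient.mk_surjective _ x
  induction x using TensorProduct.induction_on with
  | zero => simpa using tmul 0 0
  | tmul v c => exact tmul v c
  | add x y hx hy => exact add _ _ hx hy

theorem twistedD_twistedExtend (k : ℕ) (x : TwistedChains π e₀ σ (k + 1)) :
    twistedD π e₀ (extendRep K σ) k (twistedExtend K σ (k + 1) x) =
      twistedExtend K σ k (twistedD π e₀ σ k x) := by
  induction x using twistedChains_induction with
  | tmul v c => rfl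
  | add x y hx hy => simp only [map_add, hx, hy]

/-- The map `v ⊗ c ↦ ∑ vᵢ ⊗ [eᵢ ⊗ c]` to the extension of scalars of the twisted chains. It descends
to the inverse of the base-change map of twisted chains. -/
def untwist (k : ℕ) :
    ((Fin l → K) ⊗[ℤ] CellChains (liftedSkeleta π) k) →ₗ[K] K ⊗[S] TwistedChains π e₀ σ k :=
  AlgebraTensorModule.lift (∑ i : Fin l, (LinearMap.proj i : (Fin l → K) →ₗ[K] K).smulRight
    ((((TensorProduct.mk S K (TwistedChains π e₀ σ k) 1).restrictScalars ℤ) ∘ₗ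
      ((twistedRel π e₀ σ k).mkQ.restrictScalars ℤ)) ∘ₗ
        TensorProduct.mk ℤ (Fin l → S) (CellChains (liftedSkeleta π) k) (Pi.single i 1)))

theorem untwist_tmul (k : ℕ) (v : Fin l → K) (c : CellChains (liftedSkeleta π) k) :
    untwist K σ k (v ⊗ₜ c) =
      ∑ i, v i • ((1 : K) ⊗ₜ[S] (twistedRel π e₀ σ k).mkQ ((Pi.single i 1 : Fin l → S) ⊗ₜ c)) := by
  simp only [untwist, AlgebraTensorModule.lift_apply, LinearMap.coe_sum, Finset.sum_apply,
    lift.tmul, LinearMap.coe_restrictScalars]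
  rfl

theorem untwist_coordMap (k : ℕ) (v : Fin l → S) (c : CellChains (liftedSkeleta π) k) :
    untwist K σ k (coordMap S K l v ⊗ₜ c) =
      (1 : K) ⊗ₜ[S] (twistedRel π e₀ σ k).mkQ (v ⊗ₜ[ℤ] c) := by
  rw [untwist_tmul]
  conv_rhs => rw [pi_eq_sum_univ' v]
  rw [sum_tmul, map_sum, tmul_sum]
  refine Finset.sum_congr rfl fun i _ => ?_
  rw [← smul_tmul', map_smul, tmul_smul, coordMap]
  exact algebraMap_smul K (v i) _

theorem twistedRel_le_ker_untwist (k : ℕ) :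
    twistedRel π e₀ (extendRep K σ) k ≤ LinearMap.ker (untwist K σ k) := by
  refine Submodule.span_le.2 ?_
  rintro _ ⟨g, T, hT, v, c, rfl⟩
  rw [SetLike.mem_coe, LinearMap.mem_ker, map_sub, sub_eq_zero]
  have comp_eq : untwist K σ k ∘ₗ (AlgebraTensorModule.mk ℤ K (Fin l → K) _).flip
      (cellMap T hT.mapsTo k c) =
        (untwist K σ k ∘ₗ (AlgebraTensorModule.mk ℤ K (Fin l → K) _).flip c) ∘ₗ
          (extendRep K σ g : Matrix (Fin l) (Fin l) K).mulVecLin := by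
    refine linearMap_ext_coordMap (S := S) fun w => ?_
    change untwist K σ k (coordMap S K l w ⊗ₜ cellMap T hT.mapsTo k c) =
      untwist K σ k ((extendRep K σ g : Matrix (Fin l) (Fin l) K).mulVec _ ⊗ₜ c)
    rw [← coordMap_mulVec, untwist_coordMap, untwist_coordMap, mk_tmul_cellMap σ k hT]
  exact LinearMap.congr_fun comp_eq v

theorem linearMap_ext_twistedExtend {k : ℕ} {N : Type*} [AddCommGroup N] [Module K N]
    {A B : TwistedChains π e₀ (extendRep K σ) k →ₗ[K] N}
    (h : ∀ x, A (twistedExtend K σ k x) = B (twistedExtend K σ k x)) :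
    A = B := by
  refine Submodule.linearMap_qext _ (AlgebraTensorModule.ext fun v c => ?_)
  have comp_eq : (A ∘ₗ Submodule.mkQ _) ∘ₗ (AlgebraTensorModule.mk ℤ K (Fin l → K) _).flip c =
      (B ∘ₗ Submodule.mkQ _) ∘ₗ (AlgebraTensorModule.mk ℤ K (Fin l → K) _).flip c :=
    linearMap_ext_coordMap (S := S) fun w => h (Submodule.mkQ _ (w ⊗ₜ c))
  exact LinearMap.congr_fun comp_eq v

theorem isBaseChange_twistedExtend (k : ℕ) :
    IsBaseChange K (twistedExtend (e₀ := e₀) K σ k) := by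
  let extend : K ⊗[S] TwistedChains π e₀ σ k →ₗ[K] TwistedChains π e₀ (extendRep K σ) k :=
    LinearMap.liftBaseChange K (twistedExtend K σ k)
  let inverse : TwistedChains π e₀ (extendRep K σ) k →ₗ[K] K ⊗[S] TwistedChains π e₀ σ k :=
    Submodule.liftQ _ (untwist K σ k) (twistedRel_le_ker_untwist K σ k)
  have extend_tmul (a : K) (x : TwistedChains π e₀ σ k) :
      extend (a ⊗ₜ x) = a • twistedExtend K σ k x := LinearMap.liftBaseChange_tmul ..
  have inverse_twistedExtend (x : TwistedChains π e₀ σ k) :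
      inverse (twistedExtend K σ k x) = 1 ⊗ₜ x := by
    induction x using twistedChains_induction with
    | tmul v c => exact untwist_coordMap K σ k v c
    | add x y hx hy => rw [map_add, map_add, hx, hy, tmul_add]
  refine IsBaseChange.of_equiv (LinearEquiv.ofLinearMap extend inverse ?_ ?_) fun x => ?_
  · refine linearMap_ext_twistedExtend K σ fun x => ?_
    rw [LinearMap.comp_apply, inverse_twistedExtend, extend_tmul, one_smul, LinearMap.id_apply]
  · refine AlgebraTensorModule.ext fun a x => ?_
    rw [LinearMap.comp_apply, extend_tmul, map_smul, inverse_twistedExtend, smul_tmul',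
      smul_eq_mul, mul_one, LinearMap.id_apply]
  · exact (extend_tmul 1 x).trans (one_smul K _)

end BaseChange

/-! ### Twisted chains as free modules -/

section DeckBasis

variable {X : Type u} [TopologicalSpace X] [T2Space X] [Topology.CWComplex (Set.univ : Set X)]
  {E : Type v} [TopologicalSpace E] {π : C(E, X)} {e₀ : E} {k l : ℕ} {I H : Type*}
  [AddCommGroup H]

namespace DeckBasis

/-- The action of the fundamental group on the cellular chains. It is a right action. -/
def act (b : DeckBasis π e₀ k I H) (g : FundamentalGroup X (π e₀)) :
    CellChains (liftedSkeleta π) k →+ CellChains (liftedSkeleta π) k :=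
  cellMap (b.deck g) (b.isDeck g).mapsTo k

theorem act_act [SimplyConnectedSpace E] (b : DeckBasis π e₀ k I H) (hπ : IsCoveringMap π)
    (g h : FundamentalGroup X (π e₀)) (c : CellChains (liftedSkeleta π) k) :
    b.act g (b.act h c) = b.act (h * g) c := by
  have isDeck_comp := (b.isDeck h).mul (b.isDeck g)
  have deck_comp := isDeck_comp.unique hπ (b.isDeck (h * g))
  rw [act, act, ← cellMap_comp _ _ isDeck_comp.mapsTo, act]
  congr 2

/-- The identification of the cellular chains with finitely supported families in `H`. -/
def equiv (b : DeckBasis π e₀ k I H) :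
    ((I × FundamentalGroup X (π e₀)) →₀ H) ≃+ CellChains (liftedSkeleta π) k :=
  AddEquiv.ofBijective _ b.bijective

theorem equiv_single (b : DeckBasis π e₀ k I H) (i : I) (g : FundamentalGroup X (π e₀)) (h : H) :
    b.equiv (Finsupp.single (i, g) h) = b.act g (b.gen i h) :=
  Finsupp.liftAddHom_apply_single _ _ _

theorem addHom_ext (b : DeckBasis π e₀ k I H) {M : Type*} [AddCommGroup M]
    {f f' : CellChains (liftedSkeleta π) k →+ M}
    (h : ∀ g i x, f (b.act g (b.gen i x)) = f' (b.act g (b.gen i x))) : f = f' := by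
  have comp_eq : f.comp b.equiv.toAddMonoidHom = f'.comp b.equiv.toAddMonoidHom :=
    Finsupp.addHom_ext fun i x => by
      have f_eq := h i.2 i.1 x
      rw [← equiv_single] at f_eq
      exact f_eq
  refine AddMonoidHom.ext fun c => ?_
  obtain ⟨z, rfl⟩ := b.equiv.surjective c
  exact DFunLike.congr_fun comp_eq z

variable {S : Type w} [CommRing S]
  (σ : FundamentalGroup X (π e₀) →* Matrix.GeneralLinearGroup (Fin l) S)

open Classical in
/-- The coordinates of a twisted chain: the translate by `g` of a generator, with coefficient `v`,
contributes `σ g v`. -/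
def coord (b : DeckBasis π e₀ k I H) :
    ((Fin l → S) ⊗[ℤ] CellChains (liftedSkeleta π) k) →ₗ[S] (I →₀ ((Fin l → S) ⊗[ℤ] H)) :=
  (Finsupp.lsum S fun i : I × FundamentalGroup X (π e₀) =>
    Finsupp.lsingle i.1 ∘ₗ AlgebraTensorModule.map
      (σ i.2 : Matrix (Fin l) (Fin l) S).mulVecLin LinearMap.id) ∘ₗ
    (TensorProduct.finsuppRight ℤ S (Fin l → S) H (I × FundamentalGroup X (π e₀))).toLinearMap ∘ₗ
      AlgebraTensorModule.map LinearMap.id b.equiv.symm.toAddMonoidHom.toIntLinearMap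

theorem coord_tmul_act_gen (b : DeckBasis π e₀ k I H) (v : Fin l → S)
    (g : FundamentalGroup X (π e₀)) (i : I) (x : H) :
    b.coord σ (v ⊗ₜ b.act g (b.gen i x)) =
      Finsupp.single i ((σ g : Matrix (Fin l) (Fin l) S).mulVec v ⊗ₜ x) := by
  classical
  rw [← equiv_single, coord, LinearMap.comp_apply, LinearMap.comp_apply]
  change Finsupp.lsum S _ (TensorProduct.finsuppRight ℤ S (Fin l → S) H _
    (v ⊗ₜ b.equiv.symm (b.equiv _))) = _
  rw [AddEquiv.symm_apply_apply, TensorProduct.finsuppRight_tmul_single]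
  exact Finsupp.lsum_single ..

theorem coord_tmul_act [SimplyConnectedSpace E] (b : DeckBasis π e₀ k I H) (hπ : IsCoveringMap π)
    (v : Fin l → S) (g : FundamentalGroup X (π e₀)) (c : CellChains (liftedSkeleta π) k) :
    b.coord σ (v ⊗ₜ b.act g c) =
      b.coord σ ((σ g : Matrix (Fin l) (Fin l) S).mulVec v ⊗ₜ c) := by
  have comp_eq : ((b.coord σ).toAddMonoidHom.comp
      (TensorProduct.mk ℤ (Fin l → S) _ v).toAddMonoidHom).comp (b.act g) =
        (b.coord σ).toAddMonoidHom.comp (TensorProduct.mk ℤ (Fin l → S) _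
          ((σ g : Matrix (Fin l) (Fin l) S).mulVec v)).toAddMonoidHom := by
    refine b.addHom_ext fun g' i x => ?_
    change b.coord σ (v ⊗ₜ b.act g (b.act g' (b.gen i x))) = b.coord σ (_ ⊗ₜ b.act g' (b.gen i x))
    rw [b.act_act hπ, coord_tmul_act_gen, coord_tmul_act_gen, map_mul, Matrix.mulVec_mulVec,
      Units.val_mul]
  exact DFunLike.congr_fun comp_eq c

theorem twistedRel_le_ker_coord [SimplyConnectedSpace E] (b : DeckBasis π e₀ k I H)
    (hπ : IsCoveringMap π) :
    twistedRel π e₀ σ k ≤ LinearMap.ker (b.coord σ) := by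
  refine Submodule.span_le.2 ?_
  rintro _ ⟨g, T, hT, v, c, rfl⟩
  obtain rfl := hT.unique hπ (b.isDeck g)
  rw [SetLike.mem_coe, LinearMap.mem_ker, map_sub, sub_eq_zero]
  exact b.coord_tmul_act σ hπ v g c

/-- The twisted chain with given coordinates. -/
def ofCoord (b : DeckBasis π e₀ k I H) :
    (I →₀ ((Fin l → S) ⊗[ℤ] H)) →ₗ[S] TwistedChains π e₀ σ k :=
  Finsupp.lsum S fun i => (twistedRel π e₀ σ k).mkQ ∘ₗ
    AlgebraTensorModule.map LinearMap.id ((b.act 1).comp (b.gen i)).toIntLinearMap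

theorem ofCoord_single (b : DeckBasis π e₀ k I H) (i : I) (v : Fin l → S) (x : H) :
    b.ofCoord σ (Finsupp.single i (v ⊗ₜ x)) =
      (twistedRel π e₀ σ k).mkQ (v ⊗ₜ b.act 1 (b.gen i x)) :=
  Finsupp.lsum_single ..

theorem ofCoord_coord [SimplyConnectedSpace E] (b : DeckBasis π e₀ k I H) (hπ : IsCoveringMap π)
    (v : Fin l → S) (c : CellChains (liftedSkeleta π) k) :
    b.ofCoord σ (b.coord σ (v ⊗ₜ c)) = (twistedRel π e₀ σ k).mkQ (v ⊗ₜ c) := by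
  have comp_eq : ((b.ofCoord σ).comp (b.coord σ)).toAddMonoidHom.comp
      (TensorProduct.mk ℤ (Fin l → S) _ v).toAddMonoidHom =
        (twistedRel π e₀ σ k).mkQ.toAddMonoidHom.comp
          (TensorProduct.mk ℤ (Fin l → S) _ v).toAddMonoidHom := by
    refine b.addHom_ext fun g i x => ?_
    change b.ofCoord σ (b.coord σ (v ⊗ₜ b.act g (b.gen i x))) =
      (twistedRel π e₀ σ k).mkQ (v ⊗ₜ b.act g (b.gen i x))
    rw [coord_tmul_act_gen, ofCoord_single, ← mk_tmul_cellMap σ k (b.isDeck g), ← act, b.act_act hπ,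
      one_mul]
  exact DFunLike.congr_fun comp_eq c

/-- The twisted chains are the free extension of scalars of the generators. -/
def twistedChainsEquiv [SimplyConnectedSpace E] (b : DeckBasis π e₀ k I H)
    (hπ : IsCoveringMap π) : TwistedChains π e₀ σ k ≃ₗ[S] (I →₀ ((Fin l → S) ⊗[ℤ] H)) :=
  LinearEquiv.ofLinearMap
    ((twistedRel π e₀ σ k).liftQ (b.coord σ) (b.twistedRel_le_ker_coord σ hπ)) (b.ofCoord σ)
    (Finsupp.lhom_ext' fun i => AlgebraTensorModule.ext fun v x => by
      change (twistedRel π e₀ σ k).liftQ (b.coord σ) (b.twistedRel_le_ker_coord σ hπ)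
        (b.ofCoord σ (Finsupp.single i (v ⊗ₜ x))) = Finsupp.single i (v ⊗ₜ x)
      rw [ofCoord_single, Submodule.mkQ_apply, Submodule.liftQ_apply, coord_tmul_act_gen, map_one,
        Units.val_one, Matrix.one_mulVec])
    (Submodule.linearMap_qext _ (AlgebraTensorModule.ext fun v c => b.ofCoord_coord σ hπ v c))

end DeckBasis

end DeckBasis

section FiniteTwisted

variable {X : Type u} [TopologicalSpace X] [T2Space X] [Topology.CWComplex (Set.univ : Set X)]
  [Topology.CWComplex.Finite (Set.univ : Set X)] [PathConnectedSpace X]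
  {E : Type v} [TopologicalSpace E] [SimplyConnectedSpace E] [LocallyPathConnectedSpace E]
  {π : C(E, X)} {e₀ : E} {l : ℕ} {S : Type w} [CommRing S]

theorem twistedChains_finite (hπ : IsCoveringMap π)
    (σ : FundamentalGroup X (π e₀) →* Matrix.GeneralLinearGroup (Fin l) S) (k : ℕ) :
    Module.Finite S (TwistedChains π e₀ σ k) := by
  obtain ⟨b⟩ := nonempty_deckBasis hπ e₀ k
  have : Module.Finite S ((Fin l → S) ⊗[ℤ] BallHomology k) :=
    Module.Finite.equiv (AlgebraTensorModule.cancelBaseChange ℤ S S (Fin l → S) (BallHomology k))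
  exact Module.Finite.equiv (b.twistedChainsEquiv σ hπ).symm

theorem twistedChains_free (F : Type*) [Field F] [Algebra F S] (hπ : IsCoveringMap π)
    (σ : FundamentalGroup X (π e₀) →* Matrix.GeneralLinearGroup (Fin l) S) (k : ℕ) :
    Module.Free S (TwistedChains π e₀ σ k) := by
  obtain ⟨b⟩ := nonempty_deckBasis hπ e₀ k
  have : Module.Free S ((Fin l → S) ⊗[ℤ] BallHomology k) :=
    Module.Free.of_equiv
      (AlgebraTensorModule.cancelBaseChange ℤ F S (Fin l → S) (BallHomology k))
  exact Module.Free.of_equiv (b.twistedChainsEquiv σ hπ).symm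

end FiniteTwisted

/-! ### Semicontinuity of the twisted Betti numbers -/

section Minors

open Module

theorem finrank_range_eq_rank_map {S K : Type*} [CommRing S] [Field K] [Algebra S K]
    {M N M' N' m n : Type*} [AddCommGroup M] [AddCommGroup N] [AddCommGroup M'] [AddCommGroup N']
    [Module S M] [Module S N] [Module S M'] [Module S N'] [Module K M'] [Module K N']
    [IsScalarTower S K M'] [IsScalarTower S K N'] {iM : M →ₗ[S] M'} {iN : N →ₗ[S] N'}
    (hM : IsBaseChange K iM) (hN : IsBaseChange K iN) {d : M →ₗ[S] N} {d' : M' →ₗ[K] N'}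
    (hd : ∀ x, d' (iM x) = iN (d x)) [Finite m] [Fintype n] [DecidableEq n] (b : Basis n S M)
    (c : Basis m S N) :
    finrank K (LinearMap.range d') = ((LinearMap.toMatrix b c d).map (algebraMap S K)).rank := by
  have toMatrix_baseChange : (LinearMap.toMatrix b c d).map (algebraMap S K) =
      LinearMap.toMatrix (hM.basis b) (hN.basis c) d' := by
    ext i j
    rw [Matrix.map_apply, LinearMap.toMatrix_apply, LinearMap.toMatrix_apply, hM.basis_apply, hd,
      hN.basis_repr_comp_apply]
  rw [toMatrix_baseChange, Matrix.rank_eq_finrank_range_toLin _ (hN.basis c) (hM.basis b),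
    Matrix.toLin_toMatrix]

/-- The finite set is that of the minors of a matrix of `d`. -/
theorem exists_finrank_range_le {S : Type*} [CommRing S] {M N : Type*} [AddCommGroup M]
    [AddCommGroup N] [Module S M] [Module S N] [Module.Free S M] [Module.Finite S M]
    [Module.Free S N] [Module.Finite S N] (d : M →ₗ[S] N) :
    ∃ s : Set S, s.Finite ∧
      ∀ {K K' : Type w} [Field K] [Field K'] [Algebra S K] [Algebra S K']
        {M₁ N₁ M₂ N₂ : Type (max v w)} [AddCommGroup M₁] [AddCommGroup N₁] [AddCommGroup M₂]
        [AddCommGroup N₂] [Module S M₁] [Module S N₁] [Module S M₂] [Module S N₂] [Module K M₁]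
        [Module K N₁] [Module K' M₂] [Module K' N₂] [IsScalarTower S K M₁] [IsScalarTower S K N₁]
        [IsScalarTower S K' M₂] [IsScalarTower S K' N₂] {iM : M →ₗ[S] M₁} {iN : N →ₗ[S] N₁}
        {jM : M →ₗ[S] M₂} {jN : N →ₗ[S] N₂} {d₁ : M₁ →ₗ[K] N₁} {d₂ : M₂ →ₗ[K'] N₂},
        IsBaseChange K iM → IsBaseChange K iN → IsBaseChange K' jM → IsBaseChange K' jN →
        (∀ x, d₁ (iM x) = iN (d x)) → (∀ x, d₂ (jM x) = jN (d x)) →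
        (∀ m ∈ s, algebraMap S K m = 0 → algebraMap S K' m = 0) →
        finrank K' (LinearMap.range d₂) ≤ finrank K (LinearMap.range d₁) := by
  classical
  let b := Free.chooseBasis S M
  let c := Free.chooseBasis S N
  let A := LinearMap.toMatrix b c d
  refine ⟨⋃ t ∈ Set.Iic (Fintype.card (Free.ChooseBasisIndex S M)),
    Set.range fun rc : (Fin t → Free.ChooseBasisIndex S N) × (Fin t → Free.ChooseBasisIndex S M) =>
      (A.submatrix rc.1 rc.2).det, (Set.finite_Iic _).biUnion fun t _ => Set.finite_range _, ?_⟩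
  intro K K' _ _ _ _ M₁ N₁ M₂ N₂ _ _ _ _ _ _ _ _ _ _ _ _ _ _ _ _ iM iN jM jN d₁ d₂ hiM hiN hjM hjN
    hd₁ hd₂ vanish
  rw [finrank_range_eq_rank_map hiM hiN hd₁ b c, finrank_range_eq_rank_map hjM hjN hd₂ b c]
  exact rank_map_le_rank_map fun t ht rows cols minor_ne minor_eq =>
    minor_ne (vanish _ (Set.mem_biUnion ht ⟨(rows, cols), rfl⟩) minor_eq)

end Minors

section TwistedRank

open Module

variable {X : Type u} [TopologicalSpace X] [T2Space X] [Topology.CWComplex (Set.univ : Set X)]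
  {E : Type v} [TopologicalSpace E] {π : C(E, X)} {e₀ : E} {l : ℕ} {S : Type w} [CommRing S]
  (σ : FundamentalGroup X (π e₀) →* Matrix.GeneralLinearGroup (Fin l) S) (k : ℕ)

/-- The differential of the twisted chain complex out of degree `k`. In degree zero it is the zero
map to the chains of degree `0 - 1 = 0`. -/
def twistedOut : TwistedChains π e₀ σ k →ₗ[S] TwistedChains π e₀ σ (k - 1) :=
  ((twistedComplex π e₀ σ).d k (k - 1)).hom

theorem twistedComplex_d :
    (twistedComplex π e₀ σ).d (k + 1) k = ModuleCat.ofHom (twistedD π e₀ σ k) :=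
  ChainComplex.of_d (fun k => ModuleCat.of S (TwistedChains π e₀ σ k))
    (fun k => ModuleCat.ofHom (twistedD π e₀ σ k)) k

theorem twistedOut_zero : twistedOut σ 0 = 0 :=
  congrArg ModuleCat.Hom.hom ((twistedComplex π e₀ σ).shape 0 0 (by simp))

theorem twistedOut_succ : twistedOut σ (k + 1) = twistedD π e₀ σ k :=
  congrArg ModuleCat.Hom.hom (twistedComplex_d σ k)

theorem twistedOut_twistedExtend (K : Type w) [CommRing K] [Algebra S K]
    (x : TwistedChains π e₀ σ k) :
    twistedOut (extendRep K σ) k (twistedExtend K σ k x) =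
      twistedExtend K σ (k - 1) (twistedOut σ k x) := by
  cases k with
  | zero =>
    rw [twistedOut_zero, twistedOut_zero, LinearMap.zero_apply, LinearMap.zero_apply, map_zero]
  | succ k =>
    rw [twistedOut_succ, twistedOut_succ]
    exact twistedD_twistedExtend K σ k x

variable [Topology.CWComplex.Finite (Set.univ : Set X)] [PathConnectedSpace X]
  [SimplyConnectedSpace E] [LocallyPathConnectedSpace E]

theorem twistedRank_add (hπ : IsCoveringMap π) [IsDomain S] :
    twistedRank π e₀ σ k + finrank S (LinearMap.range (twistedD π e₀ σ k)) +
      finrank S (LinearMap.range (twistedOut σ k)) = finrank S (TwistedChains π e₀ σ k) := by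
  have finite_chains : Module.Finite S ((twistedComplex π e₀ σ).X k) := twistedChains_finite hπ σ k
  have homology_add := finrank_chainComplex_homology_add (twistedComplex π e₀ σ) k
  rw [twistedComplex_d] at homology_add
  exact homology_add

theorem twistedRank_extendRep_of_isFractionRing (hπ : IsCoveringMap π) [IsDomain S] (K : Type w)
    [Field K] [Algebra S K] [IsFractionRing S K] :
    twistedRank π e₀ (extendRep K σ) k = twistedRank π e₀ σ k := by
  have baseChange := isBaseChange_twistedExtend K σ
  have faithful : FaithfulSMul S K :=
    (faithfulSMul_iff_algebraMap_injective S K).2 (IsFractionRing.injective S K)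
  have rank_add := twistedRank_add σ k hπ
  have rank_extend_add := twistedRank_add (extendRep K σ) k hπ
  rw [finrank_range_eq_of_isFractionRing (baseChange _) (baseChange _)
      (twistedD_twistedExtend K σ k),
    finrank_range_eq_of_isFractionRing (baseChange _) (baseChange _)
      (twistedOut_twistedExtend σ k K),
    (baseChange k).finrank_eq, ← rank_add] at rank_extend_add
  omega

theorem finrank_twistedChains_extendRep [Nontrivial S] (F : Type*) [Field F] [Algebra F S]
    (hπ : IsCoveringMap π) (K : Type w) [Field K] [Algebra S K] :
    finrank K (TwistedChains π e₀ (extendRep K σ) k) = finrank S (TwistedChains π e₀ σ k) := by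
  have free_chains := twistedChains_free F hπ σ k
  rw [← (isBaseChange_twistedExtend K σ k).equiv.finrank_eq, finrank_baseChange]

/-- Vanishing minors of the differentials lower their ranks and so enlarge the homology. -/
theorem exists_twistedRank_le (F : Type*) [Field F] [Algebra F S] [Nontrivial S]
    (hπ : IsCoveringMap π) :
    ∃ s : Set S, s.Finite ∧ ∀ (K K' : Type w) [Field K] [Field K'] (f : S →+* K) (f' : S →+* K'),
      (∀ m ∈ s, f m = 0 → f' m = 0) →
      twistedRank π e₀ ((Matrix.GeneralLinearGroup.map f).comp σ) k ≤
        twistedRank π e₀ ((Matrix.GeneralLinearGroup.map f').comp σ) k := by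
  have free_chains := twistedChains_free F hπ σ
  have finite_chains := twistedChains_finite hπ σ
  obtain ⟨s, hs, rank_in_le⟩ := exists_finrank_range_le.{v, w} (twistedD π e₀ σ k)
  obtain ⟨t, ht, rank_out_le⟩ := exists_finrank_range_le.{v, w} (twistedOut σ k)
  refine ⟨s ∪ t, hs.union ht, fun K K' _ _ f f' vanish => ?_⟩
  let _ := f.toAlgebra
  let _ := f'.toAlgebra
  change twistedRank π e₀ (extendRep K σ) k ≤ twistedRank π e₀ (extendRep K' σ) k
  have baseChange := isBaseChange_twistedExtend (e₀ := e₀) K σ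
  have baseChange' := isBaseChange_twistedExtend (e₀ := e₀) K' σ
  have in_le := rank_in_le (baseChange _) (baseChange _) (baseChange' _) (baseChange' _)
    (twistedD_twistedExtend K σ k) (twistedD_twistedExtend K' σ k) fun m hm => vanish m (Or.inl hm)
  have out_le := rank_out_le (baseChange _) (baseChange _) (baseChange' _) (baseChange' _)
    (twistedOut_twistedExtend σ k K) (twistedOut_twistedExtend σ k K')
    fun m hm => vanish m (Or.inr hm)
  have rank_add := twistedRank_add (extendRep K σ) k hπ
  have rank_add' := twistedRank_add (extendRep K' σ) k hπ
  rw [finrank_twistedChains_extendRep σ k F hπ] at rank_add rank_add'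
  omega

theorem twistedRank_map_eq_of_injective (F : Type*) [Field F] [Algebra F S] [Nontrivial S]
    (hπ : IsCoveringMap π) {K K' : Type w} [Field K] [Field K'] {f : S →+* K} {f' : S →+* K'}
    (hf : Function.Injective f) (hf' : Function.Injective f') :
    twistedRank π e₀ ((Matrix.GeneralLinearGroup.map f).comp σ) k =
      twistedRank π e₀ ((Matrix.GeneralLinearGroup.map f').comp σ) k := by
  obtain ⟨s, -, twistedRank_le⟩ := exists_twistedRank_le σ k F hπ
  refine (twistedRank_le K K' f f' fun m _ hm => ?_).antisymm
    (twistedRank_le K' K f' f fun m _ hm => ?_)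
  · rw [(map_eq_zero_iff f hf).1 hm, map_zero]
  · rw [(map_eq_zero_iff f' hf').1 hm, map_zero]

end TwistedRank

/-! ### Group rings -/

section Novikov

theorem toNovikov_coeff {R : Type w} [CommRing R] {A : AddSubgroup ℝ} (x : AddMonoidAlgebra R A)
    (a : A) :
    (toNovikov R A x : HahnSeries Aᵒᵈ R).coeff (OrderDual.toDual a) = x.coeff a := by
  induction x using AddMonoidAlgebra.induction_linear with
  | zero => simp
  | add x y hx hy => simp [hx, hy]
  | single b r =>
    rw [toNovikov, AddMonoidAlgebra.lift_single, AddMonoidAlgebra.coeff_single]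
    change r • (HahnSeries.single (OrderDual.toDual b) (1 : R)).coeff (OrderDual.toDual a) = _
    rw [HahnSeries.coeff_single, Finsupp.single_apply]
    obtain rfl | hab := eq_or_ne a b <;> simp [*, Ne.symm]

theorem toNovikov_injective (R : Type w) [CommRing R] (A : AddSubgroup ℝ) :
    Function.Injective (toNovikov R A) := fun x y hxy => by
  ext a
  rw [← toNovikov_coeff, ← toNovikov_coeff, hxy]

end Novikov

section GroupRing

open scoped AlgebraMonoidAlgebra nonZeroDivisors

theorem isLocalization_addMonoidAlgebra {R S A : Type*} [CommRing R] [CommRing S] [Algebra R S]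
    [AddCommMonoid A] (M : Submonoid R) [IsLocalization M S] :
    IsLocalization (Algebra.algebraMapSubmonoid (AddMonoidAlgebra R A) M)
      (AddMonoidAlgebra S A) :=
  (Algebra.isLocalization_iff_isPushout M S).2 inferInstance

theorem exists_extend_mapRingHom {R A K : Type*} (F : Type*) [CommRing R] [IsDomain R] [Field F]
    [Algebra R F] [IsFractionRing R F] [AddCommMonoid A] [Field K] (f : AddMonoidAlgebra R A →+* K)
    (hf : Function.Injective f) :
    ∃ g : AddMonoidAlgebra F A →+* K, Function.Injective g ∧
      g.comp (AddMonoidAlgebra.mapRingHom A (algebraMap R F)) = f := by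
  have localization := isLocalization_addMonoidAlgebra (S := F) (A := A) R⁰
  have isUnit_map (y : Algebra.algebraMapSubmonoid (AddMonoidAlgebra R A) R⁰) : IsUnit (f y) := by
    obtain ⟨_, r, hr, rfl⟩ := y
    refine isUnit_iff_ne_zero.2 fun h => nonZeroDivisors.ne_zero hr ?_
    simpa using congrArg (fun z : AddMonoidAlgebra R A => z.coeff 0)
      (hf (h.trans (map_zero f).symm))
  have mapRingHom_injective :
      Function.Injective (algebraMap (AddMonoidAlgebra R A) (AddMonoidAlgebra F A)) :=
    AddMonoidAlgebra.map_injective (algebraMap R F).toAddMonoidHom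
      (IsFractionRing.injective R F)
  exact ⟨IsLocalization.lift isUnit_map,
    (IsLocalization.lift_injective_iff isUnit_map).2
      fun x y => mapRingHom_injective.eq_iff.trans hf.eq_iff.symm,
    IsLocalization.lift_comp isUnit_map⟩

theorem mapDomain_eq_zero_of_mapDomain_eq_zero {F A B C : Type*} [Semiring F] {f : A → B}
    {g : A → C} {x : AddMonoidAlgebra F A}
    (factors : ∀ a ∈ x.coeff.support, ∀ b ∈ x.coeff.support, f a = f b → g a = g b)
    (hx : AddMonoidAlgebra.mapDomain f x = 0) :
    AddMonoidAlgebra.mapDomain g x = 0 := by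
  obtain x_eq_zero | ⟨a₀, -⟩ := x.coeff.support.eq_empty_or_nonempty
  · rw [Finsupp.support_eq_empty, AddMonoidAlgebra.coeff_eq_zero] at x_eq_zero
    rw [x_eq_zero, AddMonoidAlgebra.mapDomain_zero]
  let r : B → C :=
    Function.extend (fun a : x.coeff.support => f a) (fun a => g a) fun _ => g a₀
  have hr (a : A) (ha : a ∈ x.coeff.support) : g a = (r ∘ f) a :=
    (Function.FactorsThrough.extend_apply
      (fun (a b : x.coeff.support) hab => factors a a.2 b b.2 hab) (fun _ => g a₀) ⟨a, ha⟩).symm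
  have mapDomain_factors : AddMonoidAlgebra.mapDomain g x =
      AddMonoidAlgebra.mapDomain r (AddMonoidAlgebra.mapDomain f x) := by
    apply AddMonoidAlgebra.coeff_injective
    rw [AddMonoidAlgebra.coeff_mapDomain, AddMonoidAlgebra.coeff_mapDomain,
      AddMonoidAlgebra.coeff_mapDomain, ← Finsupp.mapDomain_comp]
    exact Finsupp.mapDomain_congr hr
  rw [mapDomain_factors, hx, AddMonoidAlgebra.mapDomain_zero]

end GroupRing

section FieldCoefficients

variable {G : Type u} [Group G] {R : Type w} [CommRing R] {l : ℕ} {A : Type v} [AddCommGroup A]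
  (ρ : G →* Matrix.GeneralLinearGroup (Fin l) R) (p : Additive G →+ A) (F : Type w) [Field F]
  [Algebra R F]

/-- The representation `ρ ⊗ p` with the coefficients of the group ring extended from `R` to a field
`F`, in practice the fraction field of `R`: over an algebra over a field the twisted chains are
free. -/
abbrev fieldTwistRep : G →* Matrix.GeneralLinearGroup (Fin l) (AddMonoidAlgebra F A) :=
  (Matrix.GeneralLinearGroup.map (AddMonoidAlgebra.mapRingHom A (algebraMap R F))).comp
    (twistRep ρ p)

theorem fieldTwistRep_comp {B : Type*} [AddCommGroup B] (f : A →+ B) :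
    fieldTwistRep ρ (f.comp p) F =
      (Matrix.GeneralLinearGroup.map (AddMonoidAlgebra.mapDomainRingHom F f)).comp
        (fieldTwistRep ρ p F) := by
  ext g i j : 3
  change AddMonoidAlgebra.mapRingHom B (algebraMap R F) (AddMonoidAlgebra.single _ _) =
    AddMonoidAlgebra.mapDomain f
      (AddMonoidAlgebra.mapRingHom A (algebraMap R F) (AddMonoidAlgebra.single _ _))
  rw [AddMonoidAlgebra.mapRingHom_single, AddMonoidAlgebra.mapRingHom_single,
    AddMonoidAlgebra.mapDomain_single]
  rfl

theorem map_comp_fieldTwistRep {K : Type*} [CommRing K] (f : AddMonoidAlgebra F A →+* K) :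
    (Matrix.GeneralLinearGroup.map f).comp (fieldTwistRep ρ p F) =
      (Matrix.GeneralLinearGroup.map
        (f.comp (AddMonoidAlgebra.mapRingHom A (algebraMap R F)))).comp (twistRep ρ p) := by
  rw [Matrix.GeneralLinearGroup.map_comp, MonoidHom.comp_assoc]

end FieldCoefficients

section Specialization

variable (F : Type w) [Field F] {M : Type v} [AddCommGroup M]

/-- The homomorphism from `F[M]` to the fraction field of `F[ξ(M)]` induced by `ξ : M → ℝ`. Its
kernel records the linear relations between the values of `ξ` and nothing else about `ξ`. -/
def specialization (ξ : M →+ ℝ) :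
    AddMonoidAlgebra F M →+* FractionRing (AddMonoidAlgebra F ξ.range) :=
  (algebraMap _ _).comp (AddMonoidAlgebra.mapDomainRingHom F ξ.rangeRestrict)

theorem specialization_eq_zero_iff {ξ : M →+ ℝ} {x : AddMonoidAlgebra F M} :
    specialization F ξ x = 0 ↔ AddMonoidAlgebra.mapDomain ξ.rangeRestrict x = 0 :=
  map_eq_zero_iff (algebraMap (AddMonoidAlgebra F ξ.range) _) (IsFractionRing.injective _ _)

theorem specialization_injective {ξ : M →+ ℝ} (hξ : Function.Injective ξ) :
    Function.Injective (specialization F ξ) :=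
  (IsFractionRing.injective _ _).comp
    (AddMonoidAlgebra.mapDomain_injective (ξ.rangeRestrict_injective_iff.2 hξ))

open scoped Pointwise in
theorem specialization_eq_zero_of_specialization_eq_zero {ξ η : M →+ ℝ} {x : AddMonoidAlgebra F M}
    (h : ∀ d ∈ (x.coeff.support : Set M) - x.coeff.support, ξ d = 0 → η d = 0)
    (hx : specialization F ξ x = 0) : specialization F η x = 0 := by
  rw [specialization_eq_zero_iff] at hx ⊢
  refine mapDomain_eq_zero_of_mapDomain_eq_zero (fun a ha b hb hab => Subtype.ext ?_) hx
  have map_sub_eq_zero := h (a - b) (Set.sub_mem_sub ha hb)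
  rw [map_sub, map_sub, sub_eq_zero, sub_eq_zero] at map_sub_eq_zero
  exact map_sub_eq_zero (congrArg Subtype.val hab)

end Specialization

/-! ### Betti numbers of specialisations -/

section Betti

variable {X : Type u} [TopologicalSpace X] [T2Space X] [Topology.CWComplex (Set.univ : Set X)]
  [Topology.CWComplex.Finite (Set.univ : Set X)] [PathConnectedSpace X]
  {E : Type v} [TopologicalSpace E] [SimplyConnectedSpace E] [LocallyPathConnectedSpace E]
  {π : C(E, X)} {e₀ : E} {R : Type w} [CommRing R] [IsDomain R] {l : ℕ}
  (ρ : FundamentalGroup X (π e₀) →* Matrix.GeneralLinearGroup (Fin l) R)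
  (F : Type w) [Field F] [Algebra R F] [IsFractionRing R F] (hπ : IsCoveringMap π)

include hπ in
theorem exists_twistedRank_eq_fieldTwistRep {A : Type*} [AddCommGroup A]
    (p : Additive (FundamentalGroup X (π e₀)) →+ A) {L : Type w} [CommRing L] [IsDomain L]
    {i : AddMonoidAlgebra R A →+* L} (hi : Function.Injective i) (k : ℕ) :
    ∃ (K : Type w) (_ : Field K) (f : AddMonoidAlgebra F A →+* K), Function.Injective f ∧
      twistedRank π e₀ ((Matrix.GeneralLinearGroup.map i).comp (twistRep ρ p)) k =
        twistedRank π e₀ ((Matrix.GeneralLinearGroup.map f).comp (fieldTwistRep ρ p F)) k := by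
  obtain ⟨f, hf, f_extends⟩ := exists_extend_mapRingHom F
    ((algebraMap L (FractionRing L)).comp i) ((IsFractionRing.injective L _).comp hi)
  refine ⟨FractionRing L, inferInstance, f, hf, ?_⟩
  rw [← twistedRank_extendRep_of_isFractionRing _ k hπ (FractionRing L), map_comp_fieldTwistRep,
    f_extends, extendRep, Matrix.GeneralLinearGroup.map_comp, MonoidHom.comp_assoc]

variable {n : ℕ} (φ : Additive (FundamentalGroup X (π e₀)) →+ (Fin n → ℤ)) (ξ : (Fin n → ℤ) →+ ℝ)
  (k : ℕ)

include hπ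

theorem novikovBetti_eq_twistedRank_specialization :
    novikovBetti π e₀ ρ (ξ.comp φ) k =
      twistedRank π e₀
        ((Matrix.GeneralLinearGroup.map (specialization F ξ)).comp (fieldTwistRep ρ φ F)) k := by
  let A := (ξ.comp φ).range
  let p := (ξ.comp φ).rangeRestrict
  let j : A →+ ξ.range := AddSubgroup.inclusion fun _ ⟨g, hg⟩ => ⟨φ g, hg⟩
  obtain ⟨K, _, f, hf, novikov_eq⟩ :=
    exists_twistedRank_eq_fieldTwistRep ρ F hπ p (toNovikov_injective R A) k
  let g : AddMonoidAlgebra F A →+* FractionRing (AddMonoidAlgebra F ξ.range) :=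
    (algebraMap _ _).comp (AddMonoidAlgebra.mapDomainRingHom F j)
  have hg : Function.Injective g := (IsFractionRing.injective (AddMonoidAlgebra F ξ.range) _).comp
    (AddMonoidAlgebra.mapDomain_injective (AddSubgroup.inclusion_injective _))
  have rep_eq : (Matrix.GeneralLinearGroup.map g).comp (fieldTwistRep ρ p F) =
      (Matrix.GeneralLinearGroup.map (specialization F ξ)).comp (fieldTwistRep ρ φ F) := by
    rw [Matrix.GeneralLinearGroup.map_comp, specialization, Matrix.GeneralLinearGroup.map_comp,
      MonoidHom.comp_assoc, MonoidHom.comp_assoc, ← fieldTwistRep_comp, ← fieldTwistRep_comp]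
    rfl
  rw [← rep_eq, ← twistedRank_map_eq_of_injective (fieldTwistRep ρ p F) k F hπ hf hg, ← novikov_eq]
  rfl

theorem novikovBetti_eq_genericBetti (hξ : Function.Injective ξ) :
    novikovBetti π e₀ ρ (ξ.comp φ) k = genericBetti π e₀ ρ φ k := by
  obtain ⟨K, _, f, hf, generic_eq⟩ := exists_twistedRank_eq_fieldTwistRep ρ (FractionRing R) hπ φ
    (IsFractionRing.injective (AddMonoidAlgebra R (Fin n → ℤ))
      (FractionRing (AddMonoidAlgebra R (Fin n → ℤ)))) k
  rw [novikovBetti_eq_twistedRank_specialization ρ (FractionRing R) hπ φ ξ k,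
    ← twistedRank_map_eq_of_injective _ k (FractionRing R) hπ hf (specialization_injective _ hξ)]
  exact generic_eq.symm

open scoped Pointwise in
theorem exists_finite_novikovBetti_le :
    ∃ D : Set (Fin n → ℤ), D.Finite ∧ ∀ ξ η : (Fin n → ℤ) →+ ℝ,
      (∀ d ∈ D, ξ d = 0 → η d = 0) →
      novikovBetti π e₀ ρ (ξ.comp φ) k ≤ novikovBetti π e₀ ρ (η.comp φ) k := by
  let F := FractionRing R
  obtain ⟨s, hs, twistedRank_le⟩ := exists_twistedRank_le (fieldTwistRep ρ φ F) k F hπ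
  refine ⟨⋃ x ∈ s, (x.coeff.support : Set (Fin n → ℤ)) - x.coeff.support,
    hs.biUnion fun x _ => x.coeff.support.finite_toSet.sub x.coeff.support.finite_toSet,
    fun ξ η kernel_le => ?_⟩
  rw [novikovBetti_eq_twistedRank_specialization ρ F hπ,
    novikovBetti_eq_twistedRank_specialization ρ F hπ]
  exact twistedRank_le _ _ _ _ fun x hx => specialization_eq_zero_of_specialization_eq_zero F
    fun d hd => kernel_le d (Set.mem_biUnion hx hd)

end Betti

/-! ### Full subgroups -/

section Annihilator

variable {M : Type u} [AddCommGroup M]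

/-- The homomorphisms to `ℤ` that vanish on a set. -/
def annihilator (D : Set M) : AddSubgroup (M →+ ℤ) where
  carrier := {h | ∀ d ∈ D, h d = 0}
  zero_mem' _ _ := rfl
  add_mem' hx hy d hd := by rw [AddMonoidHom.add_apply, hx d hd, hy d hd, add_zero]
  neg_mem' hx d hd := by rw [AddMonoidHom.neg_apply, hx d hd, neg_zero]

/-- The elements annihilated by every real homomorphism that vanishes on `D`: the preimage of the
real span of `D` in `M ⊗ ℝ`. -/
def realClosure (D : Set M) : Submodule ℤ M :=
  ⨅ ξ : {ξ : M →+ ℝ // ∀ d ∈ D, ξ d = 0}, LinearMap.ker ξ.1.toIntLinearMap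

theorem mem_realClosure {D : Set M} {x : M} :
    x ∈ realClosure D ↔ ∀ ξ : M →+ ℝ, (∀ d ∈ D, ξ d = 0) → ξ x = 0 := by
  simp only [realClosure, Submodule.mem_iInf, LinearMap.mem_ker, Subtype.forall,
    AddMonoidHom.coe_toIntLinearMap]

theorem isTorsionFree_quotient_realClosure (D : Set M) :
    Module.IsTorsionFree ℤ (M ⧸ realClosure D) := by
  refine Module.isTorsionFree_iff_smul_eq_zero.2 fun m y hy => or_iff_not_imp_left.2 fun hm => ?_
  obtain ⟨x, rfl⟩ := Submodule.Quotient.mk_surjective _ y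
  rw [← Submodule.Quotient.mk_smul, Submodule.Quotient.mk_eq_zero, mem_realClosure] at hy
  refine (Submodule.Quotient.mk_eq_zero _).2 (mem_realClosure.2 fun ξ hξ => ?_)
  have smul_eq_zero_of_closure := hy ξ hξ
  rw [map_zsmul] at smul_eq_zero_of_closure
  exact (smul_eq_zero.1 smul_eq_zero_of_closure).resolve_left hm

variable [Module.Finite ℤ M]

/-- `b` lifts a basis of the free group `M ⧸ realClosure D`, and `h` is the dual basis. -/
theorem exists_dual_system (D : Set M) :
    ∃ (ι : Type u) (_ : Fintype ι) (b : ι → M) (h : ι → M →+ ℤ), (∀ i, h i ∈ annihilator D) ∧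
      ∀ ξ : M →+ ℝ, (∀ d ∈ D, ξ d = 0) → ∀ x, ξ x = ∑ i, ξ (b i) * h i x := by
  let N := realClosure D
  have torsionFree : Module.IsTorsionFree ℤ (M ⧸ N) := isTorsionFree_quotient_realClosure D
  have free : Module.Free ℤ (M ⧸ N) := Module.free_of_finite_type_torsion_free'
  let c := Module.Free.chooseBasis ℤ (M ⧸ N)
  choose b hb using fun i => Submodule.Quotient.mk_surjective N (c i)
  refine ⟨Module.Free.ChooseBasisIndex ℤ (M ⧸ N), inferInstance, b,
    fun i => ((c.coord i).comp N.mkQ).toAddMonoidHom, fun i d hd => ?_, fun ξ hξ x => ?_⟩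
  · have mkQ_eq_zero : N.mkQ d = 0 :=
      (Submodule.Quotient.mk_eq_zero N).2 (mem_realClosure.2 fun ξ hξ => hξ d hd)
    change c.coord _ (N.mkQ d) = 0
    rw [mkQ_eq_zero, map_zero]
  · have sub_mem : x - ∑ i, c.coord i (N.mkQ x) • b i ∈ N := by
      rw [← Submodule.Quotient.mk_eq_zero, Submodule.Quotient.mk_sub, sub_eq_zero]
      refine (c.sum_repr (N.mkQ x)).symm.trans ?_
      rw [← Submodule.mkQ_apply, map_sum]
      exact Finset.sum_congr rfl fun i _ => by rw [map_smul, ← hb]; rfl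
    have map_eq := mem_realClosure.1 sub_mem ξ hξ
    rw [map_sub, sub_eq_zero, map_sum] at map_eq
    rw [map_eq]
    exact Finset.sum_congr rfl fun i _ => by rw [map_zsmul, zsmul_eq_mul, mul_comm]; rfl

theorem isFull_annihilator (D : Set M) : IsFull (annihilator D) := by
  obtain ⟨ι, _, b, h, hh, expand⟩ := exists_dual_system D
  let proj : (M →+ ℤ) →+ (M →+ ℤ) :=
    { toFun := fun g => ∑ i, g (b i) • h i
      map_zero' := by simp
      map_add' := fun g g' => by
        simp only [AddMonoidHom.add_apply, add_smul, Finset.sum_add_distrib] }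
  have proj_mem (g : M →+ ℤ) : proj g ∈ annihilator D := sum_mem fun i _ => zsmul_mem (hh i) _
  have proj_eq_self {g : M →+ ℤ} (hg : g ∈ annihilator D) : proj g = g := by
    refine AddMonoidHom.ext fun x => ?_
    have cast_expand := expand ((Int.castAddHom ℝ).comp g) (fun d hd => by simp [hg d hd]) x
    simp only [AddMonoidHom.coe_comp, Function.comp_apply, Int.coe_castAddHom] at cast_expand
    change (∑ i, g (b i) • h i) x = g x
    rw [AddMonoidHom.finsetSum_apply]
    exact_mod_cast cast_expand.symm
  refine ⟨proj.ker, AddSubgroup.disjoint_def.2 fun hg hg' => (proj_eq_self hg).symm.trans hg',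
    codisjoint_iff.2 (eq_top_iff.2 fun g _ => ?_)⟩
  refine AddSubgroup.mem_sup.2 ⟨proj g, proj_mem g, g - proj g, ?_, add_sub_cancel _ _⟩
  rw [AddMonoidHom.mem_ker, map_sub, proj_eq_self (proj_mem g), sub_self]

end Annihilator

section FullSubgroups

variable {n : ℕ}

theorem mem_realSpan_annihilator {D : Set (Fin n → ℤ)} {ξ : (Fin n → ℤ) →+ ℝ} :
    ξ ∈ realSpan (annihilator D) ↔ ∀ d ∈ D, ξ d = 0 := by
  constructor
  · intro hξ d hd
    induction hξ using Submodule.span_induction with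
    | mem x hx =>
      obtain ⟨h, hh, rfl⟩ := hx
      change ((h d : ℤ) : ℝ) = 0
      rw [hh d hd, Int.cast_zero]
    | zero => rfl
    | add x y _ _ hx hy => rw [AddMonoidHom.add_apply, hx, hy, add_zero]
    | smul a x _ hx => rw [AddMonoidHom.smul_apply, hx, smul_zero]
  · intro hξ
    obtain ⟨ι, _, b, h, hh, expand⟩ := exists_dual_system D
    have eq_sum : ξ = ∑ i, ξ (b i) • (Int.castAddHom ℝ).comp (h i) := by
      refine AddMonoidHom.ext fun x => ?_
      rw [expand ξ hξ x, AddMonoidHom.finsetSum_apply]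
      rfl
    rw [eq_sum]
    exact Submodule.sum_mem _ fun i _ =>
      Submodule.smul_mem _ _ (Submodule.subset_span ⟨h i, hh i, rfl⟩)

theorem exists_injective_addMonoidHom_real (n : ℕ) :
    ∃ ξ : (Fin n → ℤ) →+ ℝ, Function.Injective ξ := by
  have le_rank : (n : Cardinal) ≤ Module.rank ℚ ℝ := by
    rw [Real.rank_rat_real]
    exact Cardinal.natCast_lt_aleph0.le.trans Cardinal.aleph0_le_continuum
  obtain ⟨f, hf⟩ := Module.le_rank_iff_exists_linearMap.1 le_rank
  exact ⟨f.toAddMonoidHom.comp ((Int.castAddHom ℚ).compLeft (Fin n)),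
    hf.comp (Function.Injective.comp_left Int.cast_injective)⟩

theorem eq_zero_of_annihilator_eq_top {D : Set (Fin n → ℤ)} (hD : annihilator D = ⊤)
    {d : Fin n → ℤ} (hd : d ∈ D) : d = 0 := by
  ext i
  have eval_mem : Pi.evalAddMonoidHom (fun _ : Fin n => ℤ) i ∈ annihilator D :=
    hD ▸ AddSubgroup.mem_top _
  exact eval_mem d hd

/-- The full subgroups are the annihilators of the sets of those elements of `D` that are killed by
some `ξ` satisfying `P`. -/
theorem exists_full_subgroups {D : Set (Fin n → ℤ)} (hD : D.Finite)
    {P : ((Fin n → ℤ) →+ ℝ) → Prop}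
    (hP : ∀ ξ η : (Fin n → ℤ) →+ ℝ, (∀ d ∈ D, ξ d = 0 → η d = 0) → P ξ → P η)
    (not_of_injective : ∀ ξ : (Fin n → ℤ) →+ ℝ, Function.Injective ξ → ¬ P ξ) :
    ∃ (N : ℕ) (H : Fin N → AddSubgroup ((Fin n → ℤ) →+ ℤ)),
      (∀ i, IsFull (H i) ∧ H i ≠ ⊤) ∧ ∀ ξ, P ξ ↔ ∃ i, ξ ∈ realSpan (H i) := by
  let A (ξ : (Fin n → ℤ) →+ ℝ) := annihilator {d ∈ D | ξ d = 0}
  have mem_realSpan_iff (ξ η : (Fin n → ℤ) →+ ℝ) :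
      η ∈ realSpan (A ξ) ↔ ∀ d ∈ D, ξ d = 0 → η d = 0 := by
    simp only [A, mem_realSpan_annihilator, Set.mem_ofPred_eq, and_imp]
  have finite_annihilators : (A '' {ξ | P ξ}).Finite :=
    (hD.finite_subsets.image annihilator).subset <| by
      rintro _ ⟨ξ, -, rfl⟩
      exact ⟨_, Set.sep_subset _ _, rfl⟩
  have isFull_and_ne_top : ∀ B ∈ A '' {ξ | P ξ}, IsFull B ∧ B ≠ ⊤ := by
    rintro _ ⟨ξ, hξ, rfl⟩
    refine ⟨isFull_annihilator _, fun eq_top => ?_⟩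
    obtain ⟨η, hη⟩ := exists_injective_addMonoidHom_real n
    refine not_of_injective η hη (hP ξ η (fun d hd hd0 => ?_) hξ)
    rw [eq_zero_of_annihilator_eq_top eq_top ⟨hd, hd0⟩, map_zero]
  obtain ⟨N, H, -, range_eq⟩ := finite_annihilators.fin_param
  rw [← range_eq, Set.forall_mem_range] at isFull_and_ne_top
  refine ⟨N, H, isFull_and_ne_top, fun ξ => ?_⟩
  rw [← Set.exists_range_iff (p := fun B => ξ ∈ realSpan B), range_eq, Set.exists_mem_image]
  refine ⟨fun hξ => ⟨ξ, hξ, (mem_realSpan_iff ξ ξ).2 fun _ _ => id⟩, ?_⟩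
  rintro ⟨η, hη, mem⟩
  exact hP η ξ ((mem_realSpan_iff η ξ).1 mem) hη

end FullSubgroups

end TwistedNovikov

end

theorem mainTheorem9_general
    {X : Type u} [TopologicalSpace X] [T2Space X] [ConnectedSpace X]
    [Topology.CWComplex (Set.univ : Set X)] [Topology.CWComplex.Finite (Set.univ : Set X)]
    {E : Type v} [TopologicalSpace E] [SimplyConnectedSpace E]
    (π : C(E, X)) (hπ : IsCoveringMap π) (e₀ : E)
    {R : Type w} [CommRing R] [IsDomain R] {l : ℕ}
    (ρ : FundamentalGroup X (π e₀) →* Matrix.GeneralLinearGroup (Fin l) R)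
    {n : ℕ} (φ : Additive (FundamentalGroup X (π e₀)) →+ (Fin n → ℤ)) (k q : ℕ) (hq : 0 < q) :
    ∃ (N : ℕ) (H : Fin N → AddSubgroup ((Fin n → ℤ) →+ ℤ)),
      (∀ i, TwistedNovikov.IsFull (H i) ∧ H i ≠ ⊤) ∧
      ∀ ξ : (Fin n → ℤ) →+ ℝ,
        TwistedNovikov.genericBetti π e₀ ρ φ k + q ≤
            TwistedNovikov.novikovBetti π e₀ ρ (ξ.comp φ) k ↔
          ∃ i, ξ ∈ TwistedNovikov.realSpan (H i) := by
  have : LocallyPathConnectedSpace X := TwistedNovikov.locallyPathConnectedSpace_of_finite X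
  have : PathConnectedSpace X := pathConnectedSpace_iff_connectedSpace.2 inferInstance
  have : LocallyPathConnectedSpace E :=
    TwistedNovikov.locallyPathConnectedSpace_of_isLocalHomeomorph hπ.isLocalHomeomorph
  obtain ⟨D, hD, betti_le⟩ := TwistedNovikov.exists_finite_novikovBetti_le ρ hπ φ k
  refine TwistedNovikov.exists_full_subgroups hD
    (fun ξ η hξη hξ => hξ.trans (betti_le ξ η hξη)) fun ξ hξ jump => ?_
  have betti_eq := TwistedNovikov.novikovBetti_eq_genericBetti ρ hπ φ ξ k hξ
  omega

theorem mainTheorem9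
    {X : Type u} [TopologicalSpace X] [T2Space X] [ConnectedSpace X]
    [Topology.CWComplex (Set.univ : Set X)] [Topology.CWComplex.Finite (Set.univ : Set X)]
    {E : Type v} [TopologicalSpace E] [SimplyConnectedSpace E]
    (π : C(E, X)) (hπ : IsCoveringMap π) (e₀ : E)
    {R : Type w} [CommRing R] [IsDomain R] {l : ℕ}
    (ρ : FundamentalGroup X (π e₀) →* Matrix.GeneralLinearGroup (Fin l) R)
    {n : ℕ} (φ : Additive (FundamentalGroup X (π e₀)) →+ (Fin n → ℤ))
    (hφ : Function.Surjective φ)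
    (hφ' : ∀ g : FundamentalGroup X (π e₀),
      φ (Additive.ofMul g) = 0 ↔ IsOfFinOrder (Abelianization.of g))
    (k q : ℕ) (hq : 0 < q) :
    ∃ (N : ℕ) (H : Fin N → AddSubgroup ((Fin n → ℤ) →+ ℤ)),
      (∀ i, TwistedNovikov.IsFull (H i) ∧ H i ≠ ⊤) ∧
      ∀ (ξ : Additive (FundamentalGroup X (π e₀)) →+ ℝ) (ξ' : (Fin n → ℤ) →+ ℝ),
        ξ = ξ'.comp φ →
        (TwistedNovikov.genericBetti π e₀ ρ φ k + q ≤ TwistedNovikov.novikovBetti π e₀ ρ ξ k ↔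
          ∃ i, ξ' ∈ TwistedNovikov.realSpan (H i)) := by
  obtain ⟨N, H, isFull, mem_iff⟩ := mainTheorem9_general π hπ e₀ ρ φ k q hq
  refine ⟨N, H, isFull, ?_⟩
  rintro _ ξ rfl
  exact mem_iff ξ
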